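/- Let $M>0$. Let $a=a(M)>0$ be the unique positive root of $1+r^2-\frac Mr=0$, and for $r\ge a$ put $$h(r)=\int_r^\infty\frac{dt}{\sqrt{t(t+t^3-M)}},\qquad \rho(r)=\log\frac{1+e^{-h(r)}}{1-e^{-h(r)}},\qquad \rho(M)=\rho(a).$$ Let $\rho\mapsto r(\rho)$ be the inverse of $r\mapsto\rho(r)$ on $[\rho(M),\infty)$, let $\varphi>0$ be defined by $\varphi(\rho)^4=r(\rho)^2/\sinh^2\rho$ for $\rho\ge\rho(M)$, and put $$b=\frac{e^{\rho(M)}-1}{e^{\rho(M)}+1},\qquad \psi(\tau)=\varphi\Big(\log\frac{1+\tau}{1-\tau}\Big)\ (b\le\tau<1),\qquad \rho_0(M)=\log\frac{1+b^2}{1-b^2}.$$ Define $$f(\tau)=\begin{cases}\psi(\tau), & b\le\tau<1,\\[2pt] b\,\psi\big(\tfrac{b^2}{\tau}\big)\Big(\dfrac{1-\tau^2}{\tau^2-b^4}\Big)^{1/2}, & b^2<\tau<b,\end{cases}\qquad \phi(\rho)=f\Big(\frac{e^\rho-1}{e^\rho+1}\Big)\quad(\rho>\rho_0(M)).$$ The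 anti-de Sitter-Schwarzschild metric with mass $M$ is $g=\phi^4(d\rho^2+\sinh^2\rho\,d\sigma^2)$ on $\mathbb H^3\setminus B(\rho_0(M))$. Here $\mathbb H^3$ carries the hyperbolic metric $d\rho^2+\sinh^2\rho\,d\sigma^2$, $d\sigma^2$ is the standard metric $g_0$ of the unit sphere $\mathbb S^2$, and $B(\rho_0(M))$ is the closed geodesic ball about $\rho=0$. In the unit ball model with $\tau=|x|$, $\rho=\log\frac{1+\tau}{1-\tau}$, this is the metric $\frac{4f(\tau)^4}{(1-\tau^2)^2}|dx|^2$ on $b^2<|x|<1$. A complete noncompact Riemannian manifold $(X^3,g)$ is called asymptotically hyperbolic if there are a compact manifold $(\overline X,\overline g)$ with boundary $\partial X$ and a smooth function $t$ on $\overline X$ such that: $X=\overline X\setminus\partial X$; $t=0$ on $\partial X$ and $t>0$ on $X$; $\overline g=t^2g$ extends to be $C^3$ up to the boundary; $|dt|_{\overline g}=1$ on $\partial X$; and each component of $\partial X$ is the standard sphere $(\mathbb S^2,g_0)$ with a collar neighborhood in which $g=\sinh^{-2}t\,(dt^2+g_t)$, $g_t=g_0+\frac{t^3}{3}h+O(t^4)$,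 where $h$ is a $C^2$ symmetric two-tensor on $\mathbb S^2$. Then $\rho_0(M)>0$, $\phi$ is smooth on $(\rho_0(M),\infty)$, $g$ is a smooth, complete Riemannian metric on $\mathbb H^3\setminus B(\rho_0(M))$, and: (i) $\phi>1$, $\lim_{\rho\to\infty}\phi=1$ and $\lim_{\rho\to\rho_0(M)^+}\phi=\infty$. (ii) $(\mathbb H^3\setminus B(\rho_0(M)),g)$ is asymptotically hyperbolic with constant scalar curvature $-6$. (iii) $\phi_\rho<0$ and $(\sinh^2\rho\,\phi_\rho)_\rho=\frac34\sinh^2\rho\,\phi(\phi^4-1)$ on $(\rho_0(M),\infty)$. (iv) There are $\rho_2>\rho_1>\rho_2'>\rho_0(M)$ such that, among all $c>\rho_0(M)$, $c=\rho_2$, $c=\rho_1$ and $c=\rho_2'$ are the only values for which the level surface $\{\rho=c\}$ has constant mean curvature $2$, $0$ and $-2$ respectively (the mean curvature is the sum of the principal curvatures in $g$, with respect to the unit normal in the direction $\frac{\partial}{\partial\rho}$). -/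

import Mathlib

open Set Filter Topology
open scoped ContDiff ENNReal

noncomputable section

namespace AdSSch

/-- Euclidean three-space, carrying the global coordinates `x 0, x 1, x 2`. -/
abbrev E3 : Type := EuclideanSpace ℝ (Fin 3)

/-! ### Riemannian geometry on subsets of Euclidean three-space, in the global coordinates

A metric is given by its coefficient matrix `G x = (g_ij(x))`. -/

/-- The field of coefficient matrices of a Riemannian metric. -/
abbrev MetricField : Type := E3 → Matrix (Fin 3) (Fin 3) ℝ

/-- The bilinear form `A(v, w) = ∑ A_ij v_i w_j`. -/
def form (A : Matrix (Fin 3) (Fin 3) ℝ) (v w : E3) : ℝ :=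
  ∑ i, ∑ j, A i j * v i * w j

/-- `G` is a Riemannian metric of class `C^n` on the set `U`: its coefficients are `C^n` on `U`
and its values on `U` are symmetric and positive definite. -/
def IsRiemannianMetric (n : WithTop ℕ∞) (U : Set E3) (G : MetricField) : Prop :=
  (∀ i j, ContDiffOn ℝ n (fun x => G x i j) U) ∧ ∀ x ∈ U, (G x).PosDef

/-- The partial derivative `∂_i u`. -/
def pd (i : Fin 3) (u : E3 → ℝ) (x : E3) : ℝ :=
  fderiv ℝ u x (EuclideanSpace.single i 1)

/-- Christoffel symbols
`Γ^k_ij = 1/2 ∑_l g^kl (∂_i g_jl + ∂_j g_il - ∂_l g_ij)`. -/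
def christoffel (G : MetricField) (k i j : Fin 3) (x : E3) : ℝ :=
  1 / 2 * ∑ l, (G x)⁻¹ k l *
    (pd i (fun y => G y j l) x + pd j (fun y => G y i l) x - pd l (fun y => G y i j) x)

/-- Ricci tensor
`R_ij = ∑_k (∂_k Γ^k_ij - ∂_j Γ^k_ik) + ∑_{k,l} (Γ^k_kl Γ^l_ij - Γ^k_jl Γ^l_ik)`. -/
def ricci (G : MetricField) (i j : Fin 3) (x : E3) : ℝ :=
  ∑ k, (pd k (christoffel G k i j) x - pd j (christoffel G k i k) x) +
    ∑ k, ∑ l, (christoffel G k k l x * christoffel G l i j x -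
      christoffel G k j l x * christoffel G l i k x)

/-- Scalar curvature `R = ∑ g^ij R_ij`. -/
def scalarCurvature (G : MetricField) (x : E3) : ℝ :=
  ∑ i, ∑ j, (G x)⁻¹ i j * ricci G i j x

/-- The gradient of `u`, with components `∑_j g^ij ∂_j u`. -/
def gradient (G : MetricField) (u : E3 → ℝ) (x : E3) : E3 :=
  WithLp.toLp 2 (fun i => ∑ j, (G x)⁻¹ i j * pd j u x)

/-- The unit normal `ν = ∇u / |∇u|` of the level surfaces of `u`, pointing to where `u` grows. -/
def unitNormal (G : MetricField) (u : E3 → ℝ) (x : E3) : E3 :=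
  (√(form (G x) (gradient G u x) (gradient G u x)))⁻¹ • gradient G u x

/-- Mean curvature at `x` of the level surface of `u` through `x`, with respect to the unit normal
`ν = ∇u / |∇u|`: the trace of `v ↦ ∇_v ν`, that is
`div ν = ∑_i ∂_i ν^i + ∑_{i,j} Γ^i_ij ν^j`.
As `∇_v ν` is orthogonal to `ν`, this is the sum of the two principal curvatures, and round
spheres in Euclidean space have positive mean curvature for the outward normal. -/
def meanCurvature (G : MetricField) (u : E3 → ℝ) (x : E3) : ℝ :=
  ∑ i, pd i (fun y => unitNormal G u y i) x +
    ∑ i, ∑ j, christoffel G i i j x * unitNormal G u x j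

/-- Length of the curve `γ` on `[0, 1]`. -/
def curveLength (G : MetricField) (γ : ℝ → E3) : ℝ :=
  ∫ s in (0 : ℝ)..1, √(form (G (γ s)) (deriv γ s) (deriv γ s))

/-- Riemannian distance in `U`: the infimum of the lengths of the `C^1` curves in `U` that join
the two points (`∞` if there is none). -/
def riemDist (U : Set E3) (G : MetricField) (x y : E3) : ℝ≥0∞ :=
  ⨅ γ : {γ : ℝ → E3 // ContDiffOn ℝ 1 γ (Icc 0 1) ∧ MapsTo γ (Icc 0 1) U ∧ γ 0 = x ∧ γ 1 = y},
    ENNReal.ofReal (curveLength G γ.1)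

/-- `(U, G)` is complete: every Cauchy sequence for the Riemannian distance converges in `U`. -/
def IsCompleteMetric (U : Set E3) (G : MetricField) : Prop :=
  ∀ x : ℕ → E3, (∀ n, x n ∈ U) →
    (∀ ε : ℝ≥0∞, 0 < ε → ∃ N, ∀ m ≥ N, ∀ n ≥ N, riemDist U G (x m) (x n) < ε) →
    ∃ y ∈ U, Tendsto (fun n => riemDist U G (x n) y) atTop (𝓝 0)

/-! ### Asymptotically hyperbolic metrics -/

/-- `K` is a compact region with smooth boundary: near each of its boundary points it is a
superlevel set `{q ≥ 0}` of a smooth function with non-vanishing differential. -/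
def IsCompactSmoothRegion (K : Set E3) : Prop :=
  IsCompact K ∧ ∀ p ∈ frontier K, ∃ U : Set E3, IsOpen U ∧ p ∈ U ∧ ∃ q : E3 → ℝ,
    ContDiffOn ℝ ∞ q U ∧ fderiv ℝ q p ≠ 0 ∧ ∀ x ∈ U, x ∈ K ↔ 0 ≤ q x

/-- The boundary component `S` of `K` with the metric induced by `Gbar` is the standard unit
two-sphere `(S², g₀)`, and it has a collar neighbourhood in `K`, parametrized by
`Φ : [0, ε) × S² → K` with `t (Φ s θ) = s`, in which
`g = sinh⁻² t (dt² + g_t)`, `g_t = g₀ + (t³/3) h + O(t⁴)`, where `h` is a symmetric two-tensor of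
class `C^2` on `S²`.
Maps and tensors on the unit sphere are written as restrictions of maps and tensors on
`ℝ³ ∖ {0}`; the tangent space of the sphere at `θ` is the orthogonal complement of `θ`. -/
def HasHyperbolicCollar (K : Set E3) (G Gbar : MetricField) (t : E3 → ℝ) (S : Set E3) : Prop :=
  ∃ ε : ℝ, 0 < ε ∧ ∃ Φ : ℝ → E3 → E3,
    ContDiffOn ℝ ∞ (fun p : ℝ × E3 => Φ p.1 p.2) (Ico 0 ε ×ˢ {0}ᶜ) ∧
    InjOn (fun p : ℝ × E3 => Φ p.1 p.2) (Ico 0 ε ×ˢ Metric.sphere 0 1) ∧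
    (∀ s ∈ Ico 0 ε, ∀ θ ∈ Metric.sphere (0 : E3) 1, t (Φ s θ) = s) ∧
    Φ 0 '' Metric.sphere 0 1 = S ∧
    (∃ V : Set E3, IsOpen V ∧ S ⊆ V ∧
      (fun p : ℝ × E3 => Φ p.1 p.2) '' (Ico 0 ε ×ˢ Metric.sphere 0 1) = V ∩ K) ∧
    (∀ θ ∈ Metric.sphere (0 : E3) 1, ∀ v w : E3, inner ℝ θ v = 0 → inner ℝ θ w = 0 →
      form (Gbar (Φ 0 θ)) (fderiv ℝ (Φ 0) θ v) (fderiv ℝ (Φ 0) θ w) = inner ℝ v w) ∧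
    ∃ γ : ℝ → MetricField, ∃ h : MetricField,
      (∀ s ∈ Ioo 0 ε, ∀ θ ∈ Metric.sphere (0 : E3) 1,
        (γ s θ).IsSymm ∧
        ∀ a b : ℝ, ∀ v w : E3, inner ℝ θ v = 0 → inner ℝ θ w = 0 →
          form (G (Φ s θ))
              (a • deriv (fun σ => Φ σ θ) s + fderiv ℝ (Φ s) θ v)
              (b • deriv (fun σ => Φ σ θ) s + fderiv ℝ (Φ s) θ w) =
            (Real.sinh s ^ 2)⁻¹ * (a * b + form (γ s θ) v w)) ∧
      (∀ i j, ContDiffOn ℝ 2 (fun θ => h θ i j) {0}ᶜ) ∧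
      (∀ θ ∈ Metric.sphere (0 : E3) 1, (h θ).IsSymm) ∧
      ∃ C : ℝ, ∀ s ∈ Ioo 0 ε, ∀ θ ∈ Metric.sphere (0 : E3) 1,
        ∀ v w : E3, inner ℝ θ v = 0 → inner ℝ θ w = 0 →
          |form (γ s θ) v w - inner ℝ v w - s ^ 3 / 3 * form (h θ) v w| ≤
            C * s ^ 4 * ‖v‖ * ‖w‖

/-- The interior of the compact region `K`, with the metric `G`, is conformally compactified by
`K` in the sense of the definition of asymptotic hyperbolicity: there are a smooth function `t` on
`K` that vanishes on the boundary and is positive inside, and a metric `Gbar` of class `C^3` up to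
the boundary, equal to `t² G` inside, with `|dt|_Gbar = 1` on the boundary, and each connected
component of the boundary is a standard sphere with a hyperbolic collar. -/
def IsConformallyCompactified (K : Set E3) (G : MetricField) : Prop :=
  IsCompactSmoothRegion K ∧ IsRiemannianMetric ∞ (interior K) G ∧
  ∃ t : E3 → ℝ, ∃ Gbar : MetricField,
    ContDiffOn ℝ ∞ t K ∧
    (∀ x ∈ frontier K, t x = 0) ∧ (∀ x ∈ interior K, 0 < t x) ∧
    IsRiemannianMetric 3 K Gbar ∧ (∀ x ∈ interior K, Gbar x = t x ^ 2 • G x) ∧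
    (∀ x ∈ frontier K,
      ∑ i, ∑ j, (Gbar x)⁻¹ i j * fderivWithin ℝ t K x (EuclideanSpace.single i 1) *
        fderivWithin ℝ t K x (EuclideanSpace.single j 1) = 1) ∧
    ∀ p ∈ frontier K, HasHyperbolicCollar K G Gbar t (connectedComponentIn (frontier K) p)

/-- The open set `U` of `ℝ³` with the metric `G` is an asymptotically hyperbolic manifold: it is
complete and noncompact, and it is isometric, by a diffeomorphism `F`, to the interior of a compact
manifold with boundary with the properties above. (A compact manifold with boundary whose interior
is diffeomorphic to an open subset of `ℝ³` can be pushed into its interior along a collar; so it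
is no restriction to take it as a compact region of `ℝ³`. The inverse of `F` is smooth because
`F` is bijective and, as an isometry, has invertible differentials.) -/
def IsAsymptoticallyHyperbolic (U : Set E3) (G : MetricField) : Prop :=
  IsOpen U ∧ ¬ IsCompact U ∧ IsRiemannianMetric ∞ U G ∧ IsCompleteMetric U G ∧
  ∃ K : Set E3, ∃ G' : MetricField, ∃ F : E3 → E3,
    ContDiffOn ℝ ∞ F U ∧ BijOn F U (interior K) ∧
    (∀ x ∈ U, ∀ v w : E3, form (G' (F x)) (fderiv ℝ F x v) (fderiv ℝ F x w) = form (G x) v w) ∧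
    IsConformallyCompactified K G'

/-! ### The anti-de Sitter-Schwarzschild metric -/

/-- `a(M)`, the root of `1 + r² - M/r = 0` in `(0, ∞)` (it is unique for `M > 0`). -/
def horizonRadius (M : ℝ) : ℝ :=
  sInf {r : ℝ | 0 < r ∧ 1 + r ^ 2 - M / r = 0}

/-- `h(r) = ∫_r^∞ dt / √(t (t + t³ - M))`, for `r ≥ a(M)`. -/
def hInt (M r : ℝ) : ℝ :=
  ∫ t in Ioi r, 1 / √(t * (t + t ^ 3 - M))

/-- `ρ(r) = log ((1 + e^{-h(r)}) / (1 - e^{-h(r)})) = log (coth (h(r) / 2))`. -/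
def rhoOfR (M r : ℝ) : ℝ :=
  Real.log ((1 + Real.exp (-hInt M r)) / (1 - Real.exp (-hInt M r)))

/-- `ρ(M) = ρ(a(M))`. -/
def rhoHorizon (M : ℝ) : ℝ := rhoOfR M (horizonRadius M)

/-- `r(ρ)`, for `ρ ≥ ρ(M)`: the inverse of `r ↦ ρ(r)` on `[a(M), ∞)`. -/
def rOfRho (M ρ : ℝ) : ℝ := Function.invFunOn (rhoOfR M) (Ici (horizonRadius M)) ρ

/-- The conformal factor of one half on `[ρ(M), ∞)`: `φ > 0`, `φ⁴ = r(ρ)² / sinh² ρ`. -/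
def phiOuter (M ρ : ℝ) : ℝ := (rOfRho M ρ ^ 2 / Real.sinh ρ ^ 2) ^ (1 / 4 : ℝ)

/-- `b(M) = (e^{ρ(M)} - 1) / (e^{ρ(M)} + 1)`. -/
def bRadius (M : ℝ) : ℝ := (Real.exp (rhoHorizon M) - 1) / (Real.exp (rhoHorizon M) + 1)

/-- `ψ(τ) = φ(log ((1 + τ) / (1 - τ)))`, the same factor in the ball model, for `b ≤ τ < 1`. -/
def psiOuter (M τ : ℝ) : ℝ := phiOuter M (Real.log ((1 + τ) / (1 - τ)))

/-- The conformal factor of the glued metric in the ball model: `ψ(τ)` for `b ≤ τ < 1`, and for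
`b² < τ < b` the factor `b ψ(b²/τ) ((1 - τ²)/(τ² - b⁴))^{1/2}` of the pull-back of the metric by
the inversion `x ↦ b² x / |x|²`. -/
def fGlued (M τ : ℝ) : ℝ :=
  if bRadius M ≤ τ then psiOuter M τ
  else bRadius M * psiOuter M (bRadius M ^ 2 / τ) *
    √((1 - τ ^ 2) / (τ ^ 2 - bRadius M ^ 4))

/-- `ρ₀(M) = log ((1 + b²) / (1 - b²))`. -/
def rho0 (M : ℝ) : ℝ := Real.log ((1 + bRadius M ^ 2) / (1 - bRadius M ^ 2))

/-- `φ_M(ρ) = f(τ)`, where `τ = (e^ρ - 1) / (e^ρ + 1)`. -/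
def phi (M ρ : ℝ) : ℝ := fGlued M ((Real.exp ρ - 1) / (Real.exp ρ + 1))

/-- The metric `dρ² + sinh² ρ dσ²` of hyperbolic space in the unit ball model,
`4 |dx|² / (1 - |x|²)²`. -/
def hypMetric : MetricField := fun x => (4 / (1 - ‖x‖ ^ 2) ^ 2) • (1 : Matrix (Fin 3) (Fin 3) ℝ)

/-- `ρ`, the hyperbolic distance from the centre of the ball model. -/
def hypRho (x : E3) : ℝ := Real.log ((1 + ‖x‖) / (1 - ‖x‖))

/-- `ℍ³ ∖ B(ρ₀(M))` in the ball model. -/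
def adsDomain (M : ℝ) : Set E3 := {x | ‖x‖ < 1 ∧ rho0 M < hypRho x}

/-- The anti-de Sitter-Schwarzschild metric `φ_M⁴ (dρ² + sinh² ρ dσ²)`. -/
def adsMetric (M : ℝ) : MetricField := fun x => phi M (hypRho x) ^ 4 • hypMetric x

/-- The level surface `ρ = c` has constant mean curvature `H` in the anti-de Sitter-Schwarzschild
metric, with respect to the unit normal in the direction `∂/∂ρ`. -/
def LevelHasMeanCurvature (M c H : ℝ) : Prop :=
  ∀ x : E3, ‖x‖ < 1 → hypRho x = c → meanCurvature (adsMetric M) hypRho x = H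

end AdSSch

end

namespace AdSSch

/-! ### The area radius as a function of the logarithm of the Euclidean radius -/

/-! Write `M = a + a ^ 3`, so that `a` is the horizon radius, and put `s = log ‖x‖`. In the ball
model the metric is `(R / ‖x‖) ^ 2 |dx| ^ 2`, where the area radius satisfies `R' ^ 2 = R ^ 2 + R ^
4 - M R`. The square root of the right side is singular at the horizon, and the gluing there is the
delicate point of the construction. The substitution `R = a / (1 - y ^ 2)` resolves it: `ds/dy = 2 /
√(quartic a y)` is smooth, positive and even in `y`. So `y ∈ (-1, 1)` is one smooth coordinate on
both halves, `y ↦ -y` is the inversion in the sphere of radius `b = exp (arc a 0)`, and `y = ±1` are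
the two ends. `hInt_eq` and `fGlued_exp` show that the two-branch definition is this single metric.

The curvature statements reduce to the first integral `areaRadiusDeriv_sq` and its derivative
`hasDerivAt_areaRadiusDeriv`: they give scalar curvature `-6` and, with `φ ^ 2 = R / sinh ρ`, the
equation for `φ`. Comparison with the massless integral `arsinh (1 / R)` gives `φ > 1`
(`arsinh_lt_neg_arc`). Then `sinh ^ 2 ρ φ_ρ` is strictly increasing, and it can never be nonnegative
because `φ` tends to `1` from above (`phiFlux_neg`). The mean curvature is `2 R' / R ^ 2 = 2 y
√(quartic a y) / a`. It vanishes only at `y = 0` and equals `±2` exactly where `R = M`, that is at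
`y = ±a / √(1 + a ^ 2)`.

Completeness uses two functions that are 1-Lipschitz for the Riemannian distance. A multiple of a
linear function makes Cauchy sequences converge in the closed Euclidean shell, and a multiple of
`log R` keeps their limits off its boundary.

For asymptotic hyperbolicity the closed shell is the compactification. With `u = 1 / R`, the
geodesic defining function `t` solves `dt / sinh t = du / (u √(1 + u ^ 2 - M u ^ 3))`. Hence `tanh
(t / 2) = (u / 2) exp (jetExponent a u)`, which is smooth across `u = 0`, and `isBigO_expansion`
yields `R ^ 2 sinh ^ 2 t = 1 + (M / 3) t ^ 3 + O(t ^ 4)`, so that `h = M g₀` at both ends. -/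

/-- The quartic polynomial that occurs under the square root in `arc`. -/
noncomputable def quartic (a y : ℝ) : ℝ :=
  a ^ 2 + a ^ 2 * (1 - y ^ 2) + (1 + a ^ 2) * (1 - y ^ 2) ^ 2

/-- The logarithm of the Euclidean radius, as a function of the variable `y` with
`r = a / (1 - y ^ 2)`. -/
noncomputable def arc (a y : ℝ) : ℝ := ∫ x in (1 : ℝ)..y, 2 / √(quartic a x)

/-- The inverse of `arc a`. -/
noncomputable def arcInv (a : ℝ) : ℝ → ℝ := Function.invFun (arc a)

/-- The area radius `r` as a function of `log ‖x‖`. -/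
noncomputable def areaRadius (a s : ℝ) : ℝ := a / (1 - arcInv a s ^ 2)

/-- The derivative of `areaRadius a`. -/
noncomputable def areaRadiusDeriv (a s : ℝ) : ℝ :=
  a * arcInv a s * √(quartic a (arcInv a s)) / (1 - arcInv a s ^ 2) ^ 2

section

variable {a : ℝ}

theorem quartic_pos (ha : 0 < a) (y : ℝ) : 0 < quartic a y := by
  unfold quartic
  have h2 : 0 < a ^ 2 := by positivity
  nlinarith [mul_nonneg h2.le (sq_nonneg (1 + 2 * (1 - y ^ 2))), sq_nonneg (1 - y ^ 2)]

theorem contDiff_quartic : ContDiff ℝ ∞ (quartic a) := by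
  unfold quartic; fun_prop

theorem hasDerivAt_quartic (y : ℝ) :
    HasDerivAt (quartic a) (-2 * y * (a ^ 2 + 2 * (1 + a ^ 2) * (1 - y ^ 2))) y := by
  have h : HasDerivAt (fun y : ℝ => 1 - y ^ 2) (-(2 * y)) y := by
    simpa using (hasDerivAt_pow 2 y).const_sub 1
  refine (((hasDerivAt_const y (a ^ 2)).add (h.const_mul (a ^ 2))).add
    ((h.pow 2).const_mul (1 + a ^ 2))).congr_deriv ?_
  norm_num
  ring

theorem contDiff_arcIntegrand (ha : 0 < a) : ContDiff ℝ ∞ (fun x => 2 / √(quartic a x)) :=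
  contDiff_const.div (contDiff_quartic.sqrt fun x => (quartic_pos ha x).ne')
    fun x => (Real.sqrt_pos.2 (quartic_pos ha x)).ne'

theorem arcIntegrand_pos (ha : 0 < a) (y : ℝ) : 0 < 2 / √(quartic a y) :=
  div_pos two_pos (Real.sqrt_pos.2 (quartic_pos ha y))

theorem hasDerivAt_arc (ha : 0 < a) (y : ℝ) : HasDerivAt (arc a) (2 / √(quartic a y)) y :=
  (contDiff_arcIntegrand ha).continuous.integral_hasStrictDerivAt 1 y |>.hasDerivAt

theorem deriv_arc (ha : 0 < a) : deriv (arc a) = fun x => 2 / √(quartic a x) :=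
  funext fun y => (hasDerivAt_arc ha y).deriv

theorem contDiff_arc (ha : 0 < a) : ContDiff ℝ ∞ (arc a) := by
  rw [contDiff_infty_iff_deriv, deriv_arc ha]
  exact ⟨fun y => (hasDerivAt_arc ha y).differentiableAt, contDiff_arcIntegrand ha⟩

theorem strictMono_arc (ha : 0 < a) : StrictMono (arc a) :=
  strictMono_of_deriv_pos fun y => by
    rw [deriv_arc ha]; exact arcIntegrand_pos ha y

theorem arc_one : arc a 1 = 0 := by simp [arc]

/-- The integrand is even, so `arc a - arc a 0` is odd. This is the symmetry that exchanges the two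
halves of the glued manifold. -/
theorem arc_neg (ha : 0 < a) (y : ℝ) : arc a (-y) = 2 * arc a 0 - arc a y := by
  have hc : Continuous fun x => 2 / √(quartic a x) := (contDiff_arcIntegrand ha).continuous
  have hi := fun p q => hc.intervalIntegrable (μ := MeasureTheory.volume) p q
  have h1 : ∫ x in (0 : ℝ)..(-y), 2 / √(quartic a x) = -∫ x in (0 : ℝ)..y, 2 / √(quartic a x) := by
    have h := intervalIntegral.integral_comp_neg (a := 0) (b := -y) fun x => 2 / √(quartic a x)
    have h2 : ∀ x, quartic a (-x) = quartic a x := fun x => by simp [quartic]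
    simp only [h2, neg_neg, neg_zero] at h
    rw [h, intervalIntegral.integral_symm]
  have h2 := intervalIntegral.integral_add_adjacent_intervals (hi 1 0) (hi 0 (-y))
  have h3 := intervalIntegral.integral_add_adjacent_intervals (hi 1 0) (hi 0 y)
  unfold arc
  linarith

theorem arc_neg_one (ha : 0 < a) : arc a (-1) = 2 * arc a 0 := by
  rw [arc_neg ha, arc_one, sub_zero]

theorem arc_zero_neg (ha : 0 < a) : arc a 0 < 0 := by
  simpa [arc_one] using strictMono_arc ha zero_lt_one

theorem arcInv_arc (ha : 0 < a) (y : ℝ) : arcInv a (arc a y) = y :=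
  Function.leftInverse_invFun (strictMono_arc ha).injective y

theorem arcInv_zero (ha : 0 < a) : arcInv a 0 = 1 := by
  conv_lhs => rw [← arc_one (a := a), arcInv_arc ha]

theorem arc_arcInv {s : ℝ} (hs : s ∈ range (arc a)) : arc a (arcInv a s) = s :=
  Function.invFun_eq hs

theorem isOpenEmbedding_arc (ha : 0 < a) : IsOpenEmbedding (arc a) :=
  .of_continuous_injective_isOpenMap (contDiff_arc ha).continuous (strictMono_arc ha).injective
    (isOpenMap_of_hasStrictDerivAt
      (fun y => (contDiff_arcIntegrand ha).continuous.integral_hasStrictDerivAt 1 y)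
      fun y => (arcIntegrand_pos ha y).ne')

/-- Since `arc a` is defined and regular for all real `y`, its open range contains the endpoints
`arc a (±1)`. The inverse is therefore smooth across both boundary spheres, which the
compactification needs. -/
theorem contDiffAt_arcInv (ha : 0 < a) {s : ℝ} (hs : s ∈ range (arc a)) :
    ContDiffAt ℝ ∞ (arcInv a) s := by
  obtain ⟨y, rfl⟩ := hs
  let e := (isOpenEmbedding_arc ha).toOpenPartialHomeomorph (arc a)
  have hy : arc a y ∈ e.target := by simp [e]
  have h1 : e.symm (arc a y) = y := (isOpenEmbedding_arc ha).toOpenPartialHomeomorph_left_inv _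
  have h2 : ContDiffAt ℝ ∞ e.symm (arc a y) :=
    e.contDiffAt_symm_deriv (f₀' := 2 / √(quartic a y)) (arcIntegrand_pos ha y).ne' hy
      (by rw [h1]; exact hasDerivAt_arc ha y) (contDiff_arc ha).contDiffAt
  refine h2.congr_of_eventuallyEq ?_
  filter_upwards [(isOpenEmbedding_arc ha).isOpen_range.mem_nhds (mem_range_self y)]
  rintro _ ⟨z, rfl⟩
  rw [arcInv_arc ha, (isOpenEmbedding_arc ha).toOpenPartialHomeomorph_left_inv]

theorem hasDerivAt_arcInv (ha : 0 < a) {s : ℝ} (hs : s ∈ range (arc a)) :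
    HasDerivAt (arcInv a) (√(quartic a (arcInv a s)) / 2) s := by
  have h := HasDerivAt.of_local_left_inverse (f := arc a) (g := arcInv a) (a := s)
    (contDiffAt_arcInv ha hs).continuousAt (hasDerivAt_arc ha _) (arcIntegrand_pos ha _).ne'
    (by
      filter_upwards [(isOpenEmbedding_arc ha).isOpen_range.mem_nhds hs] with x hx
      exact arc_arcInv hx)
  rwa [inv_div] at h

/-- The logarithms of the Euclidean radii of the points of the manifold. -/
def logRange (a : ℝ) : Set ℝ := Ioo (2 * arc a 0) 0

theorem logRange_eq_image (ha : 0 < a) : logRange a = arc a '' Ioo (-1) 1 := by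
  have h := (contDiff_arc ha).continuous
  rw [logRange, ← arc_neg_one ha, ← arc_one (a := a)]
  refine Subset.antisymm (intermediate_value_Ioo (by norm_num) h.continuousOn) ?_
  rintro _ ⟨y, hy, rfl⟩
  exact ⟨strictMono_arc ha hy.1, strictMono_arc ha hy.2⟩

theorem mem_range_arc_of_mem_Icc (ha : 0 < a) {s : ℝ} (hs : s ∈ Icc (2 * arc a 0) 0) :
    s ∈ range (arc a) := by
  rw [← arc_neg_one ha, ← arc_one (a := a)] at hs
  obtain ⟨y, -, rfl⟩ :=
    intermediate_value_Icc (by norm_num) (contDiff_arc ha).continuous.continuousOn hs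
  exact mem_range_self y

theorem mem_range_arc (ha : 0 < a) {s : ℝ} (hs : s ∈ logRange a) : s ∈ range (arc a) :=
  mem_range_arc_of_mem_Icc ha (Ioo_subset_Icc_self hs)

theorem arcInv_mem (ha : 0 < a) {s : ℝ} (hs : s ∈ logRange a) : arcInv a s ∈ Ioo (-1 : ℝ) 1 := by
  rw [logRange_eq_image ha] at hs
  obtain ⟨y, hy, rfl⟩ := hs
  rwa [arcInv_arc ha]

theorem one_sub_arcInv_sq_pos (ha : 0 < a) {s : ℝ} (hs : s ∈ logRange a) :
    0 < 1 - arcInv a s ^ 2 := by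
  have h := arcInv_mem ha hs
  nlinarith [h.1, h.2]

theorem areaRadius_pos (ha : 0 < a) {s : ℝ} (hs : s ∈ logRange a) : 0 < areaRadius a s :=
  div_pos ha (one_sub_arcInv_sq_pos ha hs)

theorem le_areaRadius (ha : 0 < a) {s : ℝ} (hs : s ∈ logRange a) : a ≤ areaRadius a s := by
  rw [areaRadius, le_div_iff₀ (one_sub_arcInv_sq_pos ha hs)]
  nlinarith [mul_nonneg ha.le (sq_nonneg (arcInv a s))]

theorem hasDerivAt_areaRadius (ha : 0 < a) {s : ℝ} (hs : s ∈ logRange a) :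
    HasDerivAt (areaRadius a) (areaRadiusDeriv a s) s := by
  have hw := (one_sub_arcInv_sq_pos ha hs).ne'
  refine ((hasDerivAt_const s a).div (((hasDerivAt_arcInv ha (mem_range_arc ha hs)).pow 2).const_sub
    1) hw).congr_deriv ?_
  simp only [areaRadiusDeriv, Pi.pow_apply]
  norm_num
  ring

/-- The first integral behind all curvature computations. Only the square is a function of the area
radius: the sign of the derivative is that of `y`. -/
theorem areaRadiusDeriv_sq (ha : 0 < a) {s : ℝ} (hs : s ∈ logRange a) :
    areaRadiusDeriv a s ^ 2 =
      areaRadius a s ^ 2 + areaRadius a s ^ 4 - (a + a ^ 3) * areaRadius a s := by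
  have hw := (one_sub_arcInv_sq_pos ha hs).ne'
  rw [areaRadiusDeriv, areaRadius, div_pow, mul_pow, Real.sq_sqrt (quartic_pos ha _).le, quartic]
  field_simp
  ring

/-- Formally this is the differentiated first integral divided by `2 R'`. As `R'` vanishes at the
horizon, it is computed from the formula in `y` instead. -/
theorem hasDerivAt_areaRadiusDeriv (ha : 0 < a) {s : ℝ} (hs : s ∈ logRange a) :
    HasDerivAt (areaRadiusDeriv a)
      (areaRadius a s + 2 * areaRadius a s ^ 3 - (a + a ^ 3) / 2) s := by
  have hw := (one_sub_arcInv_sq_pos ha hs).ne'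
  have hY := hasDerivAt_arcInv ha (mem_range_arc ha hs)
  have hq := ((hasDerivAt_quartic (a := a) (arcInv a s)).comp s hY).sqrt
    (quartic_pos ha (arcInv a s)).ne'
  have hd := ((hY.pow 2).const_sub 1).pow 2
  have h := ((hY.const_mul a).mul hq).div hd (pow_ne_zero 2 hw)
  refine h.congr_deriv ?_
  have hs0 := (Real.sqrt_pos.2 (quartic_pos ha (arcInv a s))).ne'
  have hs2 := Real.sq_sqrt (quartic_pos ha (arcInv a s)).le
  norm_num [areaRadius]
  generalize √(quartic a (arcInv a s)) = q at hs0 hs2 ⊢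
  rw [quartic] at hs2
  field_simp
  rw [hs2]
  ring

theorem contDiffAt_areaRadius (ha : 0 < a) {s : ℝ} (hs : s ∈ logRange a) :
    ContDiffAt ℝ ∞ (areaRadius a) s :=
  contDiffAt_const.div (contDiffAt_const.sub ((contDiffAt_arcInv ha (mem_range_arc ha hs)).pow 2))
    (one_sub_arcInv_sq_pos ha hs).ne'

theorem arcInv_reflect (ha : 0 < a) {s : ℝ} (hs : s ∈ range (arc a)) :
    arcInv a (2 * arc a 0 - s) = -arcInv a s := by
  obtain ⟨y, rfl⟩ := hs
  rw [← arc_neg ha, arcInv_arc ha, arcInv_arc ha]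

theorem areaRadius_reflect (ha : 0 < a) {s : ℝ} (hs : s ∈ range (arc a)) :
    areaRadius a (2 * arc a 0 - s) = areaRadius a s := by
  rw [areaRadius, arcInv_reflect ha hs, neg_sq, areaRadius]

theorem areaRadius_arc (ha : 0 < a) (y : ℝ) : areaRadius a (arc a y) = a / (1 - y ^ 2) := by
  rw [areaRadius, arcInv_arc ha]

end


/-! ### The conformal factor and the metric in terms of `areaRadius` -/

/-- The distance from the centre of the ball model as a function of `log ‖x‖`. -/
noncomputable def ballRho (s : ℝ) : ℝ := Real.log ((1 + Real.exp s) / (1 - Real.exp s))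

/-- The inverse of `ballRho`. -/
noncomputable def logRad (ρ : ℝ) : ℝ := Real.log ((Real.exp ρ - 1) / (Real.exp ρ + 1))

theorem exp_ballRho {s : ℝ} (hs : s < 0) :
    Real.exp (ballRho s) = (1 + Real.exp s) / (1 - Real.exp s) := by
  have h1 : 0 < 1 - Real.exp s := by simpa using hs
  rw [ballRho, Real.exp_log (by positivity)]

theorem exp_logRad {ρ : ℝ} (hρ : 0 < ρ) :
    Real.exp (logRad ρ) = (Real.exp ρ - 1) / (Real.exp ρ + 1) := by
  have h1 : 0 < Real.exp ρ - 1 := by simpa using hρ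
  rw [logRad, Real.exp_log (by positivity)]

theorem exp_ballRho_ratio {s : ℝ} (hs : s < 0) :
    (Real.exp (ballRho s) - 1) / (Real.exp (ballRho s) + 1) = Real.exp s := by
  have h1 : 0 < 1 - Real.exp s := by simpa using hs
  rw [exp_ballRho hs]
  field_simp
  ring

theorem logRad_ballRho {s : ℝ} (hs : s < 0) : logRad (ballRho s) = s := by
  rw [logRad, exp_ballRho_ratio hs, Real.log_exp]

theorem ballRho_logRad {ρ : ℝ} (hρ : 0 < ρ) : ballRho (logRad ρ) = ρ := by
  rw [ballRho, exp_logRad hρ, ← Real.log_exp ρ]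
  congr 1
  rw [Real.log_exp]
  field_simp
  ring

theorem ballRho_strictMonoOn : StrictMonoOn ballRho (Iio 0) := by
  intro s hs t ht hst
  have h1 : 0 < 1 - Real.exp s := by simpa using hs
  have h2 : 0 < 1 - Real.exp t := by simpa using ht
  have h3 := Real.exp_lt_exp.2 hst
  refine Real.log_lt_log (by positivity) ?_
  rw [div_lt_div_iff₀ h1 h2]
  nlinarith

theorem ballRho_pos {s : ℝ} (hs : s < 0) : 0 < ballRho s := by
  have h1 : 0 < 1 - Real.exp s := by simpa using hs
  refine Real.log_pos ?_
  rw [one_lt_div h1]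
  linarith [Real.exp_pos s]

theorem logRad_neg {ρ : ℝ} (hρ : 0 < ρ) : logRad ρ < 0 := by
  have h1 : 0 < Real.exp ρ - 1 := by simpa using hρ
  refine Real.log_neg (by positivity) ?_
  rw [div_lt_one (by positivity)]
  linarith

theorem ballRho_lt_iff {s ρ : ℝ} (hs : s < 0) (hρ : 0 < ρ) : ballRho s < ρ ↔ s < logRad ρ := by
  conv_lhs => rw [← ballRho_logRad hρ]
  exact ballRho_strictMonoOn.lt_iff_lt hs (logRad_neg hρ)

theorem sinh_ballRho {s : ℝ} (hs : s < 0) :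
    Real.sinh (ballRho s) = 2 * Real.exp s / (1 - Real.exp s ^ 2) := by
  have h1 : 0 < 1 - Real.exp s := by simpa using hs
  have h2 : 1 - Real.exp s ^ 2 = (1 - Real.exp s) * (1 + Real.exp s) := by ring
  have h3 := Real.exp_pos s
  rw [Real.sinh_eq, Real.exp_neg, exp_ballRho hs, h2]
  field_simp
  ring

/-- With `τ = exp s` the factors are `(1 - τ ^ 2) / (2 τ)` and its reciprocal. This turns division
by `sinh ρ` into multiplication by a function of `s`. -/
theorem sinh_neg_mul_sinh_ballRho {s : ℝ} (hs : s < 0) :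
    Real.sinh (-s) * Real.sinh (ballRho s) = 1 := by
  have h1 : 0 < 1 - Real.exp s := by simpa using hs
  have h2 : 1 - Real.exp s ^ 2 = (1 - Real.exp s) * (1 + Real.exp s) := by ring
  have h4 : (1 - Real.exp s) * (1 + Real.exp s) ≠ 0 := by positivity
  rw [sinh_ballRho hs, Real.sinh_eq, neg_neg, Real.exp_neg, h2]
  field_simp
  ring

theorem hasDerivAt_logRad {ρ : ℝ} (hρ : 0 < ρ) : HasDerivAt logRad (1 / Real.sinh ρ) ρ := by
  have h1 : 0 < Real.exp ρ - 1 := by simpa using hρ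
  have h2 : 0 < Real.exp ρ + 1 := by positivity
  have h := (((Real.hasDerivAt_exp ρ).sub_const 1).div ((Real.hasDerivAt_exp ρ).add_const 1)
    h2.ne').log (div_pos h1 h2).ne'
  refine h.congr_deriv ?_
  have h3 : Real.exp ρ ^ 2 - 1 = (Real.exp ρ - 1) * (Real.exp ρ + 1) := by ring
  have h4 : Real.sinh ρ = (Real.exp ρ - 1) * (Real.exp ρ + 1) / (2 * Real.exp ρ) := by
    rw [Real.sinh_eq, Real.exp_neg]; field_simp; ring
  rw [h4, Pi.div_apply]
  field_simp
  ring

theorem contDiffAt_logRad {ρ : ℝ} (hρ : 0 < ρ) : ContDiffAt ℝ ∞ logRad ρ := by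
  have h1 : 0 < Real.exp ρ - 1 := by simpa using hρ
  have h2 : 0 < Real.exp ρ + 1 := by positivity
  exact ((Real.contDiff_exp.contDiffAt.sub contDiffAt_const).div
    (Real.contDiff_exp.contDiffAt.add contDiffAt_const) h2.ne').log (div_pos h1 h2).ne'

theorem horizonRadius_set {M : ℝ} {a : ℝ} (ha : 0 < a) (h : a + a ^ 3 = M) :
    {r : ℝ | 0 < r ∧ 1 + r ^ 2 - M / r = 0} = {a} := by
  ext r
  simp only [mem_ofPred_eq, mem_singleton_iff]
  constructor
  · rintro ⟨hr, h1⟩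
    have h2 : r + r ^ 3 = M := by
      field_simp at h1
      linarith
    have h3 : (r - a) * (1 + r ^ 2 + r * a + a ^ 2) = 0 := by linear_combination h2 - h
    rcases mul_eq_zero.1 h3 with h4 | h4
    · linarith
    · have : 0 < r * a := by positivity
      nlinarith
  · rintro rfl
    refine ⟨ha, ?_⟩
    rw [← h]
    field_simp
    ring

theorem horizonRadius_eq {M : ℝ} {a : ℝ} (ha : 0 < a) (h : a + a ^ 3 = M) :
    horizonRadius M = a := by
  rw [horizonRadius, horizonRadius_set ha h, csInf_singleton]

theorem exists_horizon {M : ℝ} (hM : 0 < M) : ∃ a : ℝ, 0 < a ∧ a + a ^ 3 = M := by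
  have hc : ContinuousOn (fun r : ℝ => r + r ^ 3) (Icc 0 M) := by fun_prop
  have := intermediate_value_Icc hM.le hc
  obtain ⟨r, hr, h⟩ := this (show M ∈ _ by simp; constructor <;> positivity)
  refine ⟨r, hr.1.lt_of_ne ?_, h⟩
  rintro rfl
  simp at h
  exact hM.ne h

section

variable {a : ℝ}

theorem image_areaRadius (ha : 0 < a) {y : ℝ} (hy : y ∈ Ico (0 : ℝ) 1) :
    (fun x => a / (1 - x ^ 2)) '' Ioo y 1 = Ioi (a / (1 - y ^ 2)) := by
  have hy2 : 0 < 1 - y ^ 2 := by nlinarith [hy.1, hy.2]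
  ext r
  constructor
  · rintro ⟨x, hx, rfl⟩
    have hx2 : 0 < 1 - x ^ 2 := by nlinarith [hy.1, hx.1, hx.2]
    exact div_lt_div_of_pos_left ha hx2 (by nlinarith [hy.1, hx.1])
  · intro hr
    have hr' : a / (1 - y ^ 2) < r := hr
    have hr0 : 0 < r := lt_trans (by positivity) hr'
    have h1 : a / r < 1 - y ^ 2 := by
      rw [div_lt_iff₀ hr0]; rw [div_lt_iff₀ hy2] at hr'; linarith
    have h2 : 0 < a / r := by positivity
    refine ⟨√(1 - a / r), ⟨?_, ?_⟩, ?_⟩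
    · exact Real.lt_sqrt_of_sq_lt (by linarith)
    · rw [Real.sqrt_lt' one_pos]; linarith
    · simp only
      rw [Real.sq_sqrt (by nlinarith [hy.1]), sub_sub_cancel, div_div_cancel₀ ha.ne']

/-- Substitute `t = a / (1 - x ^ 2)`. The radicand acquires a double zero at `x = 0`, whose root
cancels the simple zero of the Jacobian, so the improper integral becomes that of a smooth function,
also when it starts at the horizon. -/
theorem hInt_eq (ha : 0 < a) {y : ℝ} (hy : y ∈ Ico (0 : ℝ) 1) :
    hInt (a + a ^ 3) (a / (1 - y ^ 2)) = -arc a y := by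
  have hpos : ∀ x ∈ Ioo y 1, 0 < x ∧ 0 < 1 - x ^ 2 := fun x hx =>
    ⟨hy.1.trans_lt hx.1, by nlinarith [hy.1, hx.1, hx.2]⟩
  have hd : ∀ x ∈ Ioo y 1, HasDerivWithinAt (fun x => a / (1 - x ^ 2))
      (2 * a * x / (1 - x ^ 2) ^ 2) (Ioo y 1) x := fun x hx => by
    refine (((hasDerivAt_const x a).div ((hasDerivAt_pow 2 x).const_sub 1)
      (hpos x hx).2.ne').congr_deriv ?_).hasDerivWithinAt
    norm_num
    ring
  have hinj : InjOn (fun x => a / (1 - x ^ 2)) (Ioo y 1) := fun p hp q hq h => by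
    have h1 := hpos p hp
    have h2 := hpos q hq
    have h3 : a / (1 - p ^ 2) = a / (1 - q ^ 2) := h
    rw [div_eq_div_iff h1.2.ne' h2.2.ne'] at h3
    have h4 : (p - q) * (p + q) = 0 := mul_left_cancel₀ ha.ne' (by linear_combination h3)
    rcases mul_eq_zero.1 h4 with h5 | h5 <;> linarith
  rw [hInt, ← image_areaRadius ha hy,
    MeasureTheory.integral_image_eq_integral_abs_deriv_smul measurableSet_Ioo hd hinj, arc,
    intervalIntegral.integral_symm, neg_neg, intervalIntegral.integral_of_le hy.2.le,
    MeasureTheory.integral_Ioc_eq_integral_Ioo]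
  refine MeasureTheory.setIntegral_congr_fun measurableSet_Ioo fun x hx => ?_
  obtain ⟨h1, h2⟩ := hpos x hx
  have hq := quartic_pos ha x
  have h3 : a / (1 - x ^ 2) * (a / (1 - x ^ 2) + (a / (1 - x ^ 2)) ^ 3 - (a + a ^ 3)) =
      (a * x / (1 - x ^ 2) ^ 2) ^ 2 * quartic a x := by
    rw [quartic]
    field_simp
    ring
  have h4 : 0 < a * x / (1 - x ^ 2) ^ 2 := by positivity
  have h5 := Real.sqrt_pos.2 hq
  simp only [smul_eq_mul]
  rw [h3, Real.sqrt_mul (sq_nonneg _), Real.sqrt_sq h4.le, abs_of_pos (by positivity)]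
  field_simp

theorem rhoOfR_eq (ha : 0 < a) {y : ℝ} (hy : y ∈ Ico (0 : ℝ) 1) :
    rhoOfR (a + a ^ 3) (a / (1 - y ^ 2)) = ballRho (arc a y) := by
  rw [rhoOfR, hInt_eq ha hy, neg_neg, ballRho]

theorem arc_neg_of_lt_one (ha : 0 < a) {y : ℝ} (hy : y < 1) : arc a y < 0 := by
  simpa [arc_one] using strictMono_arc ha hy

theorem exists_eq_div (ha : 0 < a) {r : ℝ} (hr : a ≤ r) :
    ∃ y ∈ Ico (0 : ℝ) 1, r = a / (1 - y ^ 2) := by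
  have hr0 : 0 < r := ha.trans_le hr
  have h1 : a / r ≤ 1 := (div_le_one hr0).2 hr
  have h2 : 0 < a / r := by positivity
  refine ⟨√(1 - a / r), ⟨Real.sqrt_nonneg _, ?_⟩, ?_⟩
  · rw [Real.sqrt_lt' one_pos]; linarith
  · rw [Real.sq_sqrt (by linarith), sub_sub_cancel, div_div_cancel₀ ha.ne']

theorem injOn_rhoOfR (ha : 0 < a) : InjOn (rhoOfR (a + a ^ 3)) (Ici a) := by
  intro p hp q hq h
  obtain ⟨y, hy, rfl⟩ := exists_eq_div ha hp
  obtain ⟨z, hz, rfl⟩ := exists_eq_div ha hq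
  rw [rhoOfR_eq ha hy, rhoOfR_eq ha hz] at h
  have h1 := ballRho_strictMonoOn.injOn (arc_neg_of_lt_one ha hy.2) (arc_neg_of_lt_one ha hz.2) h
  rw [(strictMono_arc ha).injective h1]

/-- `Function.invFunOn` is pinned down by injectivity of `rhoOfR` on `[a, ∞)`. Hence the formula is
claimed only on the outer half, where `y ≥ 0`. -/
theorem rOfRho_eq (ha : 0 < a) {s : ℝ} (hs : s ∈ Ico (arc a 0) 0) :
    rOfRho (a + a ^ 3) (ballRho s) = areaRadius a s := by
  have hc := (contDiff_arc ha).continuous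
  have h1 := intermediate_value_Ico zero_le_one hc.continuousOn
  rw [arc_one] at h1
  obtain ⟨y, hy, rfl⟩ := h1 hs
  have h2 : a ≤ a / (1 - y ^ 2) := by
    rw [le_div_iff₀ (by nlinarith [hy.1, hy.2])]
    nlinarith [mul_nonneg ha.le (sq_nonneg y)]
  rw [areaRadius_arc ha, ← rhoOfR_eq ha hy, rOfRho, horizonRadius_eq ha rfl]
  exact (injOn_rhoOfR ha).leftInvOn_invFunOn h2

theorem rhoHorizon_eq (ha : 0 < a) : rhoHorizon (a + a ^ 3) = ballRho (arc a 0) := by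
  have := rhoOfR_eq ha (y := 0) (by simp)
  rw [rhoHorizon, horizonRadius_eq ha rfl]
  simpa using this

theorem bRadius_eq (ha : 0 < a) : bRadius (a + a ^ 3) = Real.exp (arc a 0) := by
  rw [bRadius, rhoHorizon_eq ha, exp_ballRho_ratio (arc_zero_neg ha)]

theorem rho0_eq (ha : 0 < a) : rho0 (a + a ^ 3) = ballRho (2 * arc a 0) := by
  rw [rho0, bRadius_eq ha, ballRho, ← Real.exp_nat_mul]
  norm_num

theorem rho0_pos (ha : 0 < a) : 0 < rho0 (a + a ^ 3) := by
  rw [rho0_eq ha]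
  exact ballRho_pos (by linarith [arc_zero_neg ha])

theorem phiOuter_eq (ha : 0 < a) {s : ℝ} (hs : s ∈ Ico (arc a 0) 0) :
    phiOuter (a + a ^ 3) (ballRho s) =
      √(areaRadius a s * (1 - Real.exp s ^ 2) / (2 * Real.exp s)) := by
  have hs' : s ∈ logRange a := ⟨by linarith [arc_zero_neg ha, hs.1], hs.2⟩
  have hR := areaRadius_pos ha hs'
  have h1 : 0 < 1 - Real.exp s := by simpa using hs.2
  have h2 := Real.exp_pos s
  have h3 : 0 < 1 - Real.exp s ^ 2 := by nlinarith
  rw [phiOuter, rOfRho_eq ha hs, sinh_ballRho hs.2, ← div_pow, Real.sqrt_eq_rpow,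
    ← Real.rpow_natCast, ← Real.rpow_mul (by positivity)]
  congr 1
  · field_simp
  · norm_num

theorem mem_logRange_of_rho0_lt (ha : 0 < a) {ρ : ℝ} (hρ : rho0 (a + a ^ 3) < ρ) :
    logRad ρ ∈ logRange a := by
  have h0 := (rho0_pos ha).trans hρ
  rw [rho0_eq ha, ballRho_lt_iff (by linarith [arc_zero_neg ha]) h0] at hρ
  exact ⟨hρ, logRad_neg h0⟩

/-- One formula serves both branches: the area radius is invariant under `s ↦ 2 * arc a 0 - s`, and
the extra factor in the inner branch accounts for the change of the remaining terms. No matching of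
derivatives at `τ = b` is then needed. -/
theorem fGlued_exp (ha : 0 < a) {s : ℝ} (hs : s ∈ logRange a) :
    fGlued (a + a ^ 3) (Real.exp s) =
      √(areaRadius a s * (1 - Real.exp s ^ 2) / (2 * Real.exp s)) := by
  have hpsi : ∀ t ∈ Ico (arc a 0) 0, psiOuter (a + a ^ 3) (Real.exp t) =
      √(areaRadius a t * (1 - Real.exp t ^ 2) / (2 * Real.exp t)) := fun t ht =>
    phiOuter_eq ha ht
  rw [fGlued, bRadius_eq ha]
  split_ifs with h
  · exact hpsi s ⟨Real.exp_le_exp.1 h, hs.2⟩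
  · have h1 : s < arc a 0 := by simpa using h
    have h2 : Real.exp (arc a 0) ^ 2 / Real.exp s = Real.exp (2 * arc a 0 - s) := by
      rw [Real.exp_sub, ← Real.exp_nat_mul]; norm_num
    have hR := areaRadius_pos ha hs
    have hs1 : 0 < 1 - Real.exp s := by simpa using hs.2
    have hs2 := Real.exp_pos s
    have hs3 : 0 < 1 - Real.exp s ^ 2 := by nlinarith
    have hb := Real.exp_pos (arc a 0)
    have hbs : Real.exp (arc a 0) ^ 2 < Real.exp s := by
      rw [← Real.exp_nat_mul]; exact Real.exp_lt_exp.2 (by simpa using hs.1)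
    have hbs2 : 0 < Real.exp s ^ 2 - Real.exp (arc a 0) ^ 4 := by nlinarith [pow_pos hb 2]
    rw [h2, hpsi _ ⟨by linarith, by linarith [hs.1]⟩,
      areaRadius_reflect ha (mem_range_arc ha hs), ← h2]
    have h3 : 0 ≤ areaRadius a s * (1 - (Real.exp (arc a 0) ^ 2 / Real.exp s) ^ 2) /
        (2 * (Real.exp (arc a 0) ^ 2 / Real.exp s)) := by
      have : 1 - (Real.exp (arc a 0) ^ 2 / Real.exp s) ^ 2 =
          (Real.exp s ^ 2 - Real.exp (arc a 0) ^ 4) / Real.exp s ^ 2 := by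
        field_simp
      rw [this]
      positivity
    rw [mul_assoc, ← Real.sqrt_mul h3]
    nth_rw 1 [← Real.sqrt_sq hb.le]
    rw [← Real.sqrt_mul (sq_nonneg _)]
    congr 1
    field_simp

theorem phi_eq (ha : 0 < a) {ρ : ℝ} (hρ : rho0 (a + a ^ 3) < ρ) :
    phi (a + a ^ 3) ρ = √(areaRadius a (logRad ρ) / Real.sinh ρ) := by
  have h0 := (rho0_pos ha).trans hρ
  have hs := mem_logRange_of_rho0_lt ha hρ
  rw [phi, ← exp_logRad h0, fGlued_exp ha hs]
  nth_rw 5 [← ballRho_logRad h0]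
  rw [sinh_ballRho hs.2]
  congr 1
  field_simp

/-! ### The domain and the metric in the ball model. -/

theorem hypRho_eq {x : E3} (hx : x ≠ 0) : hypRho x = ballRho (Real.log ‖x‖) := by
  rw [hypRho, ballRho, Real.exp_log (norm_pos_iff.2 hx)]

theorem mem_adsDomain_iff (ha : 0 < a) {x : E3} :
    x ∈ adsDomain (a + a ^ 3) ↔ Real.log ‖x‖ ∈ logRange a := by
  -- The origin lies in neither set: `hypRho 0 = 0` is below `rho0`, while the default value `log 0
  -- = 0` is an excluded endpoint of `logRange a`.
  by_cases hx : x = 0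
  · subst hx
    simp [adsDomain, hypRho, logRange, (rho0_pos ha).le]
  have hn := norm_pos_iff.2 hx
  have h1 : ‖x‖ < 1 ↔ Real.log ‖x‖ < 0 := (Real.log_neg_iff hn).symm
  rw [adsDomain, mem_ofPred_eq, hypRho_eq hx, rho0_eq ha, logRange, mem_Ioo, h1]
  constructor
  · rintro ⟨h2, h3⟩
    exact ⟨(ballRho_strictMonoOn.lt_iff_lt (mem_Iio.2 (by linarith [arc_zero_neg ha])) h2).1 h3, h2⟩
  · rintro ⟨h2, h3⟩
    exact ⟨h3, (ballRho_strictMonoOn.lt_iff_lt (mem_Iio.2 (by linarith [arc_zero_neg ha])) h3).2 h2⟩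

theorem ne_zero_of_mem_adsDomain (ha : 0 < a) {x : E3} (hx : x ∈ adsDomain (a + a ^ 3)) :
    x ≠ 0 := by
  rintro rfl
  rw [mem_adsDomain_iff ha] at hx
  simp [logRange] at hx

/-- Here `φ ^ 4 = (R / sinh ρ) ^ 2`, and the hyperbolic factor `4 / (1 - τ ^ 2) ^ 2` is `(sinh ρ /
τ) ^ 2`, so `sinh ρ` cancels. -/
theorem adsMetric_eq (ha : 0 < a) {x : E3} (hx : x ∈ adsDomain (a + a ^ 3)) :
    adsMetric (a + a ^ 3) x =
      (areaRadius a (Real.log ‖x‖) / ‖x‖) ^ 2 • (1 : Matrix (Fin 3) (Fin 3) ℝ) := by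
  have hx0 := ne_zero_of_mem_adsDomain ha hx
  have hs := (mem_adsDomain_iff ha).1 hx
  have hn := norm_pos_iff.2 hx0
  have hR := areaRadius_pos ha hs
  have h1 : ‖x‖ < 1 := hx.1
  have h2 : 0 < 1 - ‖x‖ ^ 2 := by nlinarith
  rw [adsMetric, hypMetric, smul_smul, phi_eq ha hx.2, hypRho_eq hx0, logRad_ballRho hs.2,
    sinh_ballRho hs.2, Real.exp_log hn]
  congr 1
  have h3 : 0 ≤ areaRadius a (Real.log ‖x‖) / (2 * ‖x‖ / (1 - ‖x‖ ^ 2)) := by positivity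
  rw [show (4 : ℕ) = 2 * 2 from rfl, pow_mul, Real.sq_sqrt h3]
  field_simp
  norm_num

end


/-! ### The conformal factor -/

section

variable {a : ℝ}

/-- The left side is the value of `h` for zero mass at the same area radius. The difference of the
two sides is strictly decreasing in `y` and vanishes at `y = 1`; this covers the inner half as well.
-/
theorem arsinh_lt_neg_arc (ha : 0 < a) {y : ℝ} (hy : y ∈ Ioo (-1 : ℝ) 1) :
    Real.arsinh ((1 - y ^ 2) / a) < -arc a y := by
  have hd : ∀ x, HasDerivAt (fun x => -arc a x - Real.arsinh ((1 - x ^ 2) / a))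
      (-(2 / √(quartic a x)) - (√(1 + ((1 - x ^ 2) / a) ^ 2))⁻¹ * (-(2 * x) / a)) x := fun x => by
    have h : HasDerivAt (fun y : ℝ => (1 - y ^ 2) / a) (-(2 * x) / a) x := by
      simpa using ((hasDerivAt_pow 2 x).const_sub 1).div_const a
    exact (hasDerivAt_arc ha x).neg.sub h.arsinh
  have h : StrictAntiOn (fun x => -arc a x - Real.arsinh ((1 - x ^ 2) / a)) (Icc (-1) 1) := by
    refine strictAntiOn_of_deriv_neg (convex_Icc _ _)
      (fun x _ => (hd x).continuousAt.continuousWithinAt) fun x hx => ?_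
    rw [interior_Icc] at hx
    rw [(hd x).deriv]
    have hw : 0 < 1 - x ^ 2 := by nlinarith [hx.1, hx.2]
    have h1 := Real.sqrt_pos.2 (quartic_pos ha x)
    have h2 : 0 < √(1 + ((1 - x ^ 2) / a) ^ 2) := Real.sqrt_pos.2 (by positivity)
    -- The square of the right side exceeds that of the left by `(1 + a ^ 2) (1 - x ^ 2) ^ 3`.
    have h3 : x * √(quartic a x) < a * √(1 + ((1 - x ^ 2) / a) ^ 2) := by
      refine lt_of_pow_lt_pow_left₀ 2 (by positivity) ?_
      rw [mul_pow, mul_pow, Real.sq_sqrt (quartic_pos ha x).le, Real.sq_sqrt (by positivity),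
        quartic]
      field_simp
      nlinarith [pow_pos hw 3, mul_pos (pow_pos hw 3) (pow_pos ha 2)]
    have h4 : -(2 / √(quartic a x)) - (√(1 + ((1 - x ^ 2) / a) ^ 2))⁻¹ * (-(2 * x) / a) =
        2 * (x * √(quartic a x) - a * √(1 + ((1 - x ^ 2) / a) ^ 2)) /
          (a * √(quartic a x) * √(1 + ((1 - x ^ 2) / a) ^ 2)) := by
      field_simp
      ring
    rw [h4]
    exact div_neg_of_neg_of_pos (by linarith) (by positivity)
  have := h (Ioo_subset_Icc_self hy) (right_mem_Icc.2 (by norm_num)) hy.2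
  simp only [arc_one] at this
  norm_num at this
  linarith

theorem one_lt_areaRadius_mul_sinh (ha : 0 < a) {s : ℝ} (hs : s ∈ logRange a) :
    1 < areaRadius a s * Real.sinh (-s) := by
  have h1 := arsinh_lt_neg_arc ha (arcInv_mem ha hs)
  rw [arc_arcInv (mem_range_arc ha hs), ← Real.sinh_lt_sinh, Real.sinh_arsinh] at h1
  have h2 := mul_lt_mul_of_pos_left h1 (areaRadius_pos ha hs)
  have hw := one_sub_arcInv_sq_pos ha hs
  have h3 : areaRadius a s * ((1 - arcInv a s ^ 2) / a) = 1 := by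
    rw [areaRadius]; field_simp
  rwa [h3] at h2

theorem areaRadius_mul_sinh_eq (ha : 0 < a) {ρ : ℝ} (hρ : rho0 (a + a ^ 3) < ρ) :
    areaRadius a (logRad ρ) / Real.sinh ρ = areaRadius a (logRad ρ) * Real.sinh (-logRad ρ) := by
  have h0 := (rho0_pos ha).trans hρ
  have h := sinh_neg_mul_sinh_ballRho (logRad_neg h0)
  rw [ballRho_logRad h0] at h
  rw [div_eq_iff (Real.sinh_pos_iff.2 h0).ne', mul_assoc, h, mul_one]

theorem one_lt_phi (ha : 0 < a) {ρ : ℝ} (hρ : rho0 (a + a ^ 3) < ρ) : 1 < phi (a + a ^ 3) ρ := by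
  rw [phi_eq ha hρ, Real.lt_sqrt zero_le_one, areaRadius_mul_sinh_eq ha hρ, one_pow]
  exact one_lt_areaRadius_mul_sinh ha (mem_logRange_of_rho0_lt ha hρ)

theorem contDiffOn_phi (ha : 0 < a) :
    ContDiffOn ℝ ∞ (phi (a + a ^ 3)) (Ioi (rho0 (a + a ^ 3))) := by
  intro ρ hρ
  have h0 := (rho0_pos ha).trans hρ
  have hs := mem_logRange_of_rho0_lt ha hρ
  have h1 : ContDiffAt ℝ ∞ (fun ρ => √(areaRadius a (logRad ρ) / Real.sinh ρ)) ρ := by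
    refine (((contDiffAt_areaRadius ha hs).comp ρ (contDiffAt_logRad h0)).div
      Real.contDiff_sinh.contDiffAt (Real.sinh_pos_iff.2 h0).ne').sqrt ?_
    exact (div_pos (areaRadius_pos ha hs) (Real.sinh_pos_iff.2 h0)).ne'
  exact h1.contDiffWithinAt.congr (fun x hx => phi_eq ha hx) (phi_eq ha hρ)

/-- A quotient of type `0 / 0`, evaluated by the derivatives at `0`: `-1` for `sinh (-s)` and `-a`
for `1 - arcInv a s ^ 2`. -/
theorem tendsto_areaRadius_mul_sinh (ha : 0 < a) :
    Tendsto (fun s => areaRadius a s * Real.sinh (-s)) (𝓝[≠] 0) (𝓝 1) := by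
  have h0 : (0 : ℝ) ∈ range (arc a) := ⟨1, arc_one⟩
  have hY0 : arcInv a 0 = 1 := by rw [← arc_one (a := a), arcInv_arc ha]
  have h1 : HasDerivAt (fun s => 1 - arcInv a s ^ 2) (-a) 0 := by
    have := ((hasDerivAt_arcInv ha h0).pow 2).const_sub 1
    refine this.congr_deriv ?_
    have h2 : √(quartic a 1) = a := by
      rw [quartic]; norm_num; exact Real.sqrt_sq ha.le
    rw [hY0, h2]
    norm_num
    ring
  have h2 : HasDerivAt (fun s => Real.sinh (-s)) (-1) 0 := by
    simpa using (hasDerivAt_neg (0 : ℝ)).sinh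
  have h3 := (h2.tendsto_slope.div h1.tendsto_slope (by simp [ha.ne'])).const_mul a
  have h4 : a * (-1 / -a) = 1 := by field_simp
  rw [h4] at h3
  refine h3.congr' ?_
  filter_upwards [self_mem_nhdsWithin] with s hs
  have hs' : s ≠ 0 := hs
  simp only [Pi.div_apply, slope_def_field, hY0, areaRadius]
  norm_num
  rw [div_div_div_cancel_right₀ hs', mul_div_assoc', div_mul_eq_mul_div]
  ring

theorem tendsto_logRad_atTop : Tendsto logRad atTop (𝓝[<] 0) := by
  refine tendsto_nhdsWithin_iff.2 ⟨?_, ?_⟩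
  · have h1 : Tendsto (fun ρ => (Real.exp ρ - 1) / (Real.exp ρ + 1)) atTop (𝓝 1) := by
      have h2 : Tendsto (fun ρ => 1 - 2 / (Real.exp ρ + 1)) atTop (𝓝 (1 - 0)) :=
        tendsto_const_nhds.sub (tendsto_const_nhds.div_atTop
          (tendsto_atTop_add_const_right _ _ Real.tendsto_exp_atTop))
      rw [sub_zero] at h2
      refine h2.congr fun ρ => ?_
      have := Real.exp_pos ρ
      field_simp
      ring
    have h3 := (Real.continuousAt_log one_ne_zero).tendsto.comp h1
    rwa [Real.log_one] at h3
  · filter_upwards [eventually_gt_atTop 0] with ρ hρ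
    exact logRad_neg hρ

theorem tendsto_phi_atTop (ha : 0 < a) : Tendsto (phi (a + a ^ 3)) atTop (𝓝 1) := by
  have h1 := (tendsto_areaRadius_mul_sinh ha).comp
    (tendsto_logRad_atTop.mono_right (nhdsWithin_mono 0 fun x (hx : x < 0) => hx.ne))
  have h2 := h1.sqrt
  rw [Real.sqrt_one] at h2
  refine h2.congr' ?_
  filter_upwards [eventually_gt_atTop (rho0 (a + a ^ 3))] with ρ hρ
  rw [phi_eq ha hρ, areaRadius_mul_sinh_eq ha hρ, Function.comp_apply]

theorem tendsto_areaRadius_left (ha : 0 < a) :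
    Tendsto (areaRadius a) (𝓝[>] (2 * arc a 0)) atTop := by
  have h0 : 2 * arc a 0 ∈ range (arc a) := ⟨-1, arc_neg_one ha⟩
  have hY0 : arcInv a (2 * arc a 0) = -1 := by rw [← arc_neg_one ha, arcInv_arc ha]
  have h1 : Tendsto (fun s => 1 - arcInv a s ^ 2) (𝓝[>] (2 * arc a 0)) (𝓝[>] 0) := by
    refine tendsto_nhdsWithin_iff.2 ⟨?_, ?_⟩
    · have h2 := ((contDiffAt_arcInv ha h0).continuousAt.tendsto.pow 2).const_sub 1
      rw [hY0, neg_one_sq, sub_self] at h2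
      exact h2.mono_left nhdsWithin_le_nhds
    · filter_upwards [Ioo_mem_nhdsGT (show 2 * arc a 0 < 0 by linarith [arc_zero_neg ha])] with s hs
      exact one_sub_arcInv_sq_pos ha hs
  have h2 := h1.inv_tendsto_nhdsGT_zero.const_mul_atTop ha
  exact h2.congr fun s => by simp [areaRadius, div_eq_mul_inv]

theorem tendsto_phi_rho0 (ha : 0 < a) :
    Tendsto (phi (a + a ^ 3)) (𝓝[>] (rho0 (a + a ^ 3))) atTop := by
  have hr := rho0_pos ha
  have h0 : logRad (rho0 (a + a ^ 3)) = 2 * arc a 0 := by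
    rw [rho0_eq ha, logRad_ballRho (by linarith [arc_zero_neg ha])]
  have h1 : Tendsto logRad (𝓝[>] (rho0 (a + a ^ 3))) (𝓝[>] (2 * arc a 0)) := by
    refine tendsto_nhdsWithin_iff.2 ⟨?_, ?_⟩
    · have := (contDiffAt_logRad hr).continuousAt.tendsto
      rw [h0] at this
      exact this.mono_left nhdsWithin_le_nhds
    · filter_upwards [self_mem_nhdsWithin] with ρ hρ
      exact (mem_logRange_of_rho0_lt ha hρ).1
  have h2 := (tendsto_areaRadius_left ha).comp h1
  have h3 : Tendsto (fun ρ => (Real.sinh ρ)⁻¹) (𝓝[>] (rho0 (a + a ^ 3)))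
      (𝓝 (Real.sinh (rho0 (a + a ^ 3)))⁻¹) :=
    ((Real.continuous_sinh.tendsto _).inv₀ (Real.sinh_pos_iff.2 hr).ne').mono_left
      nhdsWithin_le_nhds
  have h4 := h2.atTop_mul_pos (inv_pos.2 (Real.sinh_pos_iff.2 hr)) h3
  refine (Real.tendsto_sqrt_atTop.comp h4).congr' ?_
  filter_upwards [self_mem_nhdsWithin] with ρ hρ
  rw [phi_eq ha hρ, div_eq_mul_inv]; rfl

/-- `sinh² ρ φ_ρ`. -/
noncomputable def phiFlux (a ρ : ℝ) : ℝ :=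
  (areaRadiusDeriv a (logRad ρ) - areaRadius a (logRad ρ) * Real.cosh ρ) /
    (2 * √(areaRadius a (logRad ρ) / Real.sinh ρ))

theorem hasDerivAt_sqrt_areaRadius_div (ha : 0 < a) {ρ : ℝ} (hρ : rho0 (a + a ^ 3) < ρ) :
    HasDerivAt (fun ρ => √(areaRadius a (logRad ρ) / Real.sinh ρ))
      (phiFlux a ρ / Real.sinh ρ ^ 2) ρ := by
  have h0 := (rho0_pos ha).trans hρ
  have hs := mem_logRange_of_rho0_lt ha hρ
  have hN := Real.sinh_pos_iff.2 h0
  have hR := areaRadius_pos ha hs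
  have hRd := (hasDerivAt_areaRadius ha hs).comp ρ (hasDerivAt_logRad h0)
  have hq : 0 < √(areaRadius a (logRad ρ) / Real.sinh ρ) := Real.sqrt_pos.2 (div_pos hR hN)
  refine ((hRd.div (Real.hasDerivAt_sinh ρ) hN.ne').sqrt (div_pos hR hN).ne').congr_deriv ?_
  simp only [phiFlux, Function.comp_apply, Pi.div_apply]
  field_simp

theorem hasDerivAt_phi (ha : 0 < a) {ρ : ℝ} (hρ : rho0 (a + a ^ 3) < ρ) :
    HasDerivAt (phi (a + a ^ 3)) (phiFlux a ρ / Real.sinh ρ ^ 2) ρ :=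
  (hasDerivAt_sqrt_areaRadius_div ha hρ).congr_of_eventuallyEq <| by
    filter_upwards [Ioi_mem_nhds hρ] with σ hσ using phi_eq ha hσ

theorem hasDerivAt_phiFlux (ha : 0 < a) {ρ : ℝ} (hρ : rho0 (a + a ^ 3) < ρ) :
    HasDerivAt (phiFlux a) (3 / 4 * Real.sinh ρ ^ 2 *
      (phi (a + a ^ 3) ρ * (phi (a + a ^ 3) ρ ^ 4 - 1))) ρ := by
  have h0 := (rho0_pos ha).trans hρ
  have hs := mem_logRange_of_rho0_lt ha hρ
  have hN := Real.sinh_pos_iff.2 h0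
  have hR := areaRadius_pos ha hs
  have hl := hasDerivAt_logRad h0
  have hRd := (hasDerivAt_areaRadius ha hs).comp ρ hl
  have hRdd := (hasDerivAt_areaRadiusDeriv ha hs).comp ρ hl
  have hq : 0 < √(areaRadius a (logRad ρ) / Real.sinh ρ) := Real.sqrt_pos.2 (div_pos hR hN)
  have h := (hRdd.sub (hRd.mul (Real.hasDerivAt_cosh ρ))).div
    ((hasDerivAt_sqrt_areaRadius_div ha hρ).const_mul 2) (by positivity)
  refine h.congr_deriv ?_
  have hsq := areaRadiusDeriv_sq ha hs
  have hc := Real.cosh_sq ρ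
  have hq2 := Real.sq_sqrt (div_pos hR hN).le
  simp only [Function.comp_apply, phiFlux, phi_eq ha hρ, Pi.sub_apply, Pi.mul_apply]
  generalize √(areaRadius a (logRad ρ) / Real.sinh ρ) = q at hq hq2 ⊢
  generalize areaRadius a (logRad ρ) = R at hR hsq hq2 ⊢
  generalize areaRadiusDeriv a (logRad ρ) = R' at hsq ⊢
  generalize Real.sinh ρ = N at hN hc hq2 ⊢
  generalize Real.cosh ρ = C at hc ⊢
  -- Once `R` is eliminated in favour of `q = φ`, the claim is a polynomial identity modulo the
  -- first integral and `cosh ^ 2 = sinh ^ 2 + 1`.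
  have hRq : R = q ^ 2 * N := by rw [hq2]; field_simp
  subst hRq
  field_simp
  linear_combination (-4 : ℝ) * hsq + (-4 * q ^ 4 * N ^ 2) * hc

/-- Since `φ > 1`, the flux is strictly increasing. If it were nonnegative at `ρ`, then `φ` would be
monotone from there on and its limit would be at least `φ(ρ) > 1`, but the limit is `1`. -/
theorem phiFlux_neg (ha : 0 < a) {ρ : ℝ} (hρ : rho0 (a + a ^ 3) < ρ) : phiFlux a ρ < 0 := by
  by_contra! h
  have hlt : ∀ σ ∈ Ici ρ, rho0 (a + a ^ 3) < σ := fun σ hσ => lt_of_lt_of_le hρ hσ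
  have hmono : StrictMonoOn (phiFlux a) (Ici ρ) := by
    refine strictMonoOn_of_deriv_pos (convex_Ici ρ)
      (fun σ hσ => (hasDerivAt_phiFlux ha (hlt σ hσ)).continuousAt.continuousWithinAt)
      fun σ hσ => ?_
    have hσ' := hlt σ (interior_subset hσ)
    have h1 := one_lt_phi ha hσ'
    have h2 := one_lt_pow₀ h1 (four_ne_zero)
    have h3 := Real.sinh_pos_iff.2 ((rho0_pos ha).trans hσ')
    rw [(hasDerivAt_phiFlux ha hσ').deriv]
    have h4 : 0 < phi (a + a ^ 3) σ ^ 4 - 1 := by linarith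
    have h5 := zero_lt_one.trans h1
    positivity
  have hphi : MonotoneOn (phi (a + a ^ 3)) (Ici ρ) := by
    refine monotoneOn_of_deriv_nonneg (convex_Ici ρ)
      (fun σ hσ => (hasDerivAt_phi ha (hlt σ hσ)).continuousAt.continuousWithinAt)
      (fun σ hσ => (hasDerivAt_phi ha
        (hlt σ (interior_subset hσ))).differentiableAt.differentiableWithinAt) fun σ hσ => ?_
    have hσ' := interior_subset hσ
    rw [(hasDerivAt_phi ha (hlt σ hσ')).deriv]
    exact div_nonneg (h.trans (hmono.monotoneOn self_mem_Ici hσ' hσ')) (sq_nonneg _)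
  have h1 := ge_of_tendsto (tendsto_phi_atTop ha)
    ((eventually_ge_atTop ρ).mono fun σ hσ => hphi self_mem_Ici hσ hσ)
  exact absurd (one_lt_phi ha hρ) h1.not_gt

theorem deriv_phi_neg (ha : 0 < a) {ρ : ℝ} (hρ : rho0 (a + a ^ 3) < ρ) :
    deriv (phi (a + a ^ 3)) ρ < 0 := by
  rw [(hasDerivAt_phi ha hρ).deriv]
  exact div_neg_of_neg_of_pos (phiFlux_neg ha hρ)
    (pow_pos (Real.sinh_pos_iff.2 ((rho0_pos ha).trans hρ)) 2)

theorem hasDerivAt_sinh_sq_mul_deriv_phi (ha : 0 < a) {ρ : ℝ} (hρ : rho0 (a + a ^ 3) < ρ) :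
    HasDerivAt (fun σ => Real.sinh σ ^ 2 * deriv (phi (a + a ^ 3)) σ)
      (3 / 4 * Real.sinh ρ ^ 2 * (phi (a + a ^ 3) ρ * (phi (a + a ^ 3) ρ ^ 4 - 1))) ρ := by
  refine (hasDerivAt_phiFlux ha hρ).congr_of_eventuallyEq ?_
  filter_upwards [Ioi_mem_nhds hρ] with σ hσ
  have := (Real.sinh_pos_iff.2 ((rho0_pos ha).trans hσ)).ne'
  rw [(hasDerivAt_phi ha hσ).deriv]
  field_simp

end


/-! ### Radial conformally flat metrics -/

theorem inv_smul_one {c : ℝ} (hc : c ≠ 0) :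
    (c • (1 : Matrix (Fin 3) (Fin 3) ℝ))⁻¹ = c⁻¹ • 1 :=
  Matrix.inv_eq_right_inv (by simp [smul_smul, inv_mul_cancel₀ hc])

theorem norm_sq_eq_sum (x : E3) : ‖x‖ ^ 2 = x 0 ^ 2 + x 1 ^ 2 + x 2 ^ 2 := by
  rw [EuclideanSpace.norm_sq_eq, Fin.sum_univ_three]
  simp

theorem form_smul_one (c : ℝ) (v w : E3) :
    form (c • (1 : Matrix (Fin 3) (Fin 3) ℝ)) v w = c * inner ℝ v w := by
  simp [form, Fin.sum_univ_three, Matrix.one_apply, PiLp.inner_apply]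
  ring

theorem hasFDerivAt_comp_log_norm {g : ℝ → ℝ} {g' : ℝ} {x : E3} (hx : x ≠ 0)
    (hg : HasDerivAt g g' (Real.log ‖x‖)) :
    HasFDerivAt (fun y : E3 => g (Real.log ‖y‖)) ((g' / ‖x‖ ^ 2) • innerSL ℝ x) x := by
  have hn : ‖x‖ ^ 2 ≠ 0 := by simpa using hx
  have h1 : HasFDerivAt (fun y : E3 => Real.log ‖y‖) ((1 / ‖x‖ ^ 2) • innerSL ℝ x) x := by
    have h2 := ((hasStrictFDerivAt_norm_sq x).hasFDerivAt.log hn).const_mul (1 / 2)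
    have h3 : (fun y : E3 => Real.log ‖y‖) = fun y => 1 / 2 * Real.log (‖y‖ ^ 2) := by
      ext y; rw [Real.log_pow]; push_cast; ring
    rw [h3]
    refine h2.congr_fderiv ?_
    ext v
    simp
    field_simp
  refine (hg.comp_hasFDerivAt x h1).congr_fderiv ?_
  rw [smul_smul]
  congr 1
  ring

theorem inner_single_one (x : E3) (i : Fin 3) : inner ℝ x (EuclideanSpace.single i 1) = x i := by
  rw [real_inner_comm]; simp [EuclideanSpace.inner_single_left]

theorem pd_eq_of_hasFDerivAt {u : E3 → ℝ} {x : E3} {d : ℝ}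
    (h : HasFDerivAt u (d • innerSL ℝ x) x) (i : Fin 3) : pd i u x = d * x i := by
  rw [pd, h.fderiv]
  simp [inner_single_one]

theorem pd_congr {u v : E3 → ℝ} {x : E3} (h : u =ᶠ[𝓝 x] v) (i : Fin 3) :
    pd i u x = pd i v x := by
  rw [pd, pd, h.fderiv_eq]

theorem pd_mul_coord {B : E3 → ℝ} {x : E3} {d : ℝ} (h : HasFDerivAt B (d • innerSL ℝ x) x)
    (l : E3 →L[ℝ] ℝ) (m : Fin 3) :
    pd m (fun y => B y * l y) x =
      d * x m * l x + B x * l (EuclideanSpace.single m 1) := by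
  have h1 := h.mul l.hasFDerivAt
  rw [pd, show (fun y => B y * l y) = B * l from rfl, h1.fderiv]
  simp [inner_single_one]
  ring

/-- The linear form `x ↦ δ_jk x_i + δ_ik x_j - δ_ij x_k`. -/
noncomputable def christoffelForm (k i j : Fin 3) : E3 →L[ℝ] ℝ :=
  (if k = j then (1 : ℝ) else 0) • EuclideanSpace.proj i +
    (if k = i then (1 : ℝ) else 0) • EuclideanSpace.proj j -
    (if i = j then (1 : ℝ) else 0) • EuclideanSpace.proj k

theorem christoffelForm_apply (k i j : Fin 3) (x : E3) :
    christoffelForm k i j x = (if k = j then x i else 0) + (if k = i then x j else 0) -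
      (if i = j then x k else 0) := by
  unfold christoffelForm
  split_ifs <;> simp

/-- For a metric `c δ_ij` only `∇c / (2 c)` enters the Christoffel symbols, and for radial `c` this
gradient is a multiple of `x`. Each symbol thus becomes a scalar times a fixed linear form. -/
theorem christoffel_of_eventuallyEq {G : MetricField} {c : E3 → ℝ} {x : E3} {d : ℝ}
    (hG : G =ᶠ[𝓝 x] fun y => c y • 1) (hc : c x ≠ 0) (h : HasFDerivAt c (d • innerSL ℝ x) x)
    (k i j : Fin 3) :
    christoffel G k i j x = d / (2 * c x) * christoffelForm k i j x := by
  have hpd : ∀ m p q, pd m (fun y => G y p q) x = if p = q then d * x m else 0 := by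
    intro m p q
    have h1 : (fun y => G y p q) =ᶠ[𝓝 x] fun y => if p = q then c y else 0 := by
      filter_upwards [hG] with y hy
      simp [hy, Matrix.one_apply]
    rw [pd_congr h1]
    split_ifs
    · exact pd_eq_of_hasFDerivAt h m
    · simp [pd]
  simp only [christoffel, hpd, hG.eq_of_nhds, inv_smul_one hc, christoffelForm_apply]
  simp only [Matrix.smul_apply, Matrix.one_apply, smul_eq_mul, mul_ite, mul_one, mul_zero,
    ite_mul, zero_mul, Finset.sum_ite_eq, Finset.mem_univ, if_true]
  have e1 : (j = k) = (k = j) := propext eq_comm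
  have e2 : (i = k) = (k = i) := propext eq_comm
  simp only [e1, e2]
  split_ifs <;> field_simp <;> ring

/-- The inverse metric is a multiple of the identity, so only the diagonal Ricci components count.
They are polynomials in `B x`, `d` and the coordinates. -/
theorem scalarCurvature_of_christoffel {G : MetricField} {B : E3 → ℝ} {x : E3} {c d : ℝ}
    (hc : c ≠ 0) (hG : G x = c • 1)
    (hΓ : ∀ k i j, christoffel G k i j =ᶠ[𝓝 x] fun y => B y * christoffelForm k i j y)
    (h : HasFDerivAt B (d • innerSL ℝ x) x) :
    scalarCurvature G x = -(12 * B x + 4 * d * ‖x‖ ^ 2 + 2 * B x ^ 2 * ‖x‖ ^ 2) / c := by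
  have hpd : ∀ m k i j, pd m (christoffel G k i j) x = d * x m * christoffelForm k i j x +
      B x * christoffelForm k i j (EuclideanSpace.single m 1) := fun m k i j => by
    rw [pd_congr (hΓ k i j), pd_mul_coord h]
  have hv : ∀ k i j, christoffel G k i j x = B x * christoffelForm k i j x :=
    fun k i j => (hΓ k i j).eq_of_nhds
  have hr : scalarCurvature G x = (ricci G 0 0 x + ricci G 1 1 x + ricci G 2 2 x) / c := by
    simp [scalarCurvature, hG, inv_smul_one hc, Fin.sum_univ_three, Matrix.one_apply]
    field_simp
  rw [hr, norm_sq_eq_sum]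
  congr 1
  simp only [ricci, hpd, hv, christoffelForm_apply, Fin.sum_univ_three]
  simp
  ring

/-- Normalising cancels `d`, so the result is the same for every function that increases radially.
-/
theorem unitNormal_of_eq {G : MetricField} {u : E3 → ℝ} {x : E3} {q d : ℝ} (hx : x ≠ 0)
    (hq : 0 < q) (hd : 0 < d) (hG : G x = (q / ‖x‖) ^ 2 • 1)
    (hu : HasFDerivAt u (d • innerSL ℝ x) x) (i : Fin 3) : unitNormal G u x i = q⁻¹ * x i := by
  have hn := norm_pos_iff.2 hx
  have hc : (q / ‖x‖) ^ 2 ≠ 0 := by positivity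
  have hgrad : gradient G u x = (d / (q / ‖x‖) ^ 2) • x := by
    ext j
    simp [gradient, hG, inv_smul_one hc, pd_eq_of_hasFDerivAt hu, Matrix.one_apply]
    field_simp
  have h1 : form (G x) (gradient G u x) (gradient G u x) = (d * ‖x‖ ^ 2 / q) ^ 2 := by
    rw [hG, hgrad, form_smul_one, real_inner_smul_left, real_inner_smul_right,
      real_inner_self_eq_norm_sq]
    field_simp
  rw [unitNormal, h1, Real.sqrt_sq (by positivity), hgrad]
  simp
  field_simp

theorem meanCurvature_of_christoffel {G : MetricField} {u E : E3 → ℝ} {x : E3} {b d : ℝ}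
    (hν : ∀ i, (fun y => unitNormal G u y i) =ᶠ[𝓝 x] fun y => E y * y i)
    (hΓ : ∀ k i j, christoffel G k i j x = b * christoffelForm k i j x)
    (h : HasFDerivAt E (d • innerSL ℝ x) x) :
    meanCurvature G u x = 3 * E x + d * ‖x‖ ^ 2 + 3 * b * E x * ‖x‖ ^ 2 := by
  have hpd : ∀ i, pd i (fun y => unitNormal G u y i) x = d * x i * x i + E x := fun i => by
    rw [pd_congr (hν i)]
    have := pd_mul_coord h (EuclideanSpace.proj i) i
    simpa using this
  have hv : ∀ j, unitNormal G u x j = E x * x j := fun j => (hν j).eq_of_nhds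
  simp only [meanCurvature, hpd, hv, hΓ, christoffelForm_apply, norm_sq_eq_sum,
    Fin.sum_univ_three]
  simp
  ring


/-! ### Curvatures of the anti-de Sitter-Schwarzschild metric -/

section

variable {a : ℝ}

theorem mem_adsDomain_iff_norm (ha : 0 < a) {x : E3} :
    x ∈ adsDomain (a + a ^ 3) ↔ ‖x‖ ∈ Ioo (Real.exp (2 * arc a 0)) 1 := by
  rw [mem_adsDomain_iff ha, logRange, mem_Ioo, mem_Ioo]
  by_cases hx : x = 0
  · subst hx
    simp [(Real.exp_pos _).le]
  have hn := norm_pos_iff.2 hx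
  rw [Real.lt_log_iff_exp_lt hn, Real.log_neg_iff hn]

theorem isOpen_adsDomain (ha : 0 < a) : IsOpen (adsDomain (a + a ^ 3)) := by
  have : adsDomain (a + a ^ 3) = (fun x : E3 => ‖x‖) ⁻¹' Ioo (Real.exp (2 * arc a 0)) 1 :=
    Set.ext fun x => mem_adsDomain_iff_norm ha
  rw [this]
  exact isOpen_Ioo.preimage continuous_norm

/-- The square of the conformal factor of the metric with respect to the Euclidean metric, as a
function of `log ‖x‖`. -/
noncomputable def conf (a s : ℝ) : ℝ := (areaRadius a s * Real.exp (-s)) ^ 2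

theorem conf_pos (ha : 0 < a) {s : ℝ} (hs : s ∈ logRange a) : 0 < conf a s :=
  pow_pos (mul_pos (areaRadius_pos ha hs) (Real.exp_pos _)) 2

theorem conf_log (ha : 0 < a) {x : E3} (hx : x ∈ adsDomain (a + a ^ 3)) :
    conf a (Real.log ‖x‖) = (areaRadius a (Real.log ‖x‖) / ‖x‖) ^ 2 := by
  have hn := norm_pos_iff.2 (ne_zero_of_mem_adsDomain ha hx)
  rw [conf, Real.exp_neg, Real.exp_log hn, div_eq_mul_inv]

theorem adsMetric_eq_conf (ha : 0 < a) {x : E3} (hx : x ∈ adsDomain (a + a ^ 3)) :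
    adsMetric (a + a ^ 3) x = conf a (Real.log ‖x‖) • (1 : Matrix (Fin 3) (Fin 3) ℝ) := by
  rw [adsMetric_eq ha hx, conf_log ha hx]

theorem adsMetric_eventuallyEq (ha : 0 < a) {x : E3} (hx : x ∈ adsDomain (a + a ^ 3)) :
    adsMetric (a + a ^ 3) =ᶠ[𝓝 x] fun y => conf a (Real.log ‖y‖) • 1 := by
  filter_upwards [(isOpen_adsDomain ha).mem_nhds hx] with y hy using adsMetric_eq_conf ha hy

theorem hasDerivAt_exp_neg (s : ℝ) : HasDerivAt (fun s => Real.exp (-s)) (-Real.exp (-s)) s := by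
  simpa using (hasDerivAt_neg s).exp

/-- The logarithmic derivative of `areaRadius a s * exp (-s)`. -/
noncomputable def logDerivConf (a s : ℝ) : ℝ := areaRadiusDeriv a s / areaRadius a s - 1

theorem hasDerivAt_conf (ha : 0 < a) {s : ℝ} (hs : s ∈ logRange a) :
    HasDerivAt (conf a) (2 * conf a s * logDerivConf a s) s := by
  refine (((hasDerivAt_areaRadius ha hs).mul (hasDerivAt_exp_neg s)).pow 2).congr_deriv ?_
  have := (areaRadius_pos ha hs).ne'
  simp only [conf, logDerivConf, Pi.mul_apply]
  norm_num
  field_simp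
  ring

/-- In `(R' / R)' = (R'' R - R' ^ 2) / R ^ 2` both equations for `R` apply and `R'` drops out. -/
theorem hasDerivAt_logDerivConf (ha : 0 < a) {s : ℝ} (hs : s ∈ logRange a) :
    HasDerivAt (logDerivConf a)
      (areaRadius a s ^ 2 + (a + a ^ 3) / (2 * areaRadius a s)) s := by
  have hR := (areaRadius_pos ha hs).ne'
  refine (((hasDerivAt_areaRadiusDeriv ha hs).div (hasDerivAt_areaRadius ha hs)
    hR).sub_const 1).congr_deriv ?_
  have h := areaRadiusDeriv_sq ha hs
  field_simp
  linear_combination (-2 : ℝ) * h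

theorem christoffel_adsMetric (ha : 0 < a) {x : E3} (hx : x ∈ adsDomain (a + a ^ 3))
    (k i j : Fin 3) :
    christoffel (adsMetric (a + a ^ 3)) k i j x =
      logDerivConf a (Real.log ‖x‖) * Real.exp (-Real.log ‖x‖) ^ 2 * christoffelForm k i j x := by
  have hs := (mem_adsDomain_iff ha).1 hx
  have hx0 := ne_zero_of_mem_adsDomain ha hx
  have hn := norm_pos_iff.2 hx0
  have hc := (conf_pos ha hs).ne'
  rw [christoffel_of_eventuallyEq (adsMetric_eventuallyEq ha hx) hc
    (hasFDerivAt_comp_log_norm hx0 (hasDerivAt_conf ha hs)), Real.exp_neg, Real.exp_log hn]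
  field_simp

theorem scalarCurvature_adsMetric (ha : 0 < a) {x : E3} (hx : x ∈ adsDomain (a + a ^ 3)) :
    scalarCurvature (adsMetric (a + a ^ 3)) x = -6 := by
  have hs := (mem_adsDomain_iff ha).1 hx
  have hx0 := ne_zero_of_mem_adsDomain ha hx
  have hn := norm_pos_iff.2 hx0
  have hc := (conf_pos ha hs).ne'
  have hd := hasFDerivAt_comp_log_norm hx0 ((hasDerivAt_logDerivConf ha hs).mul
    ((hasDerivAt_exp_neg (Real.log ‖x‖)).pow 2))
  rw [scalarCurvature_of_christoffel hc (adsMetric_eq_conf ha hx) (B := fun y =>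
    logDerivConf a (Real.log ‖y‖) * Real.exp (-Real.log ‖y‖) ^ 2) (fun k i j => by
      filter_upwards [(isOpen_adsDomain ha).mem_nhds hx] with y hy
      exact christoffel_adsMetric ha hy k i j) hd]
  have hR := areaRadius_pos ha hs
  have hsq := areaRadiusDeriv_sq ha hs
  simp only [conf, logDerivConf, Pi.pow_apply]
  rw [Real.exp_neg, Real.exp_log hn]
  norm_num
  field_simp
  linear_combination (-4 : ℝ) * hsq

theorem hasDerivAt_ballRho {s : ℝ} (hs : s < 0) : HasDerivAt ballRho (1 / Real.sinh (-s)) s := by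
  have h1 : 0 < 1 - Real.exp s := by simpa using hs
  have h2 := Real.exp_pos s
  have h := ((((Real.hasDerivAt_exp s).const_add 1).div ((Real.hasDerivAt_exp s).const_sub 1)
    h1.ne').log (by simp only [Pi.div_apply]; positivity))
  refine h.congr_deriv ?_
  have h3 : Real.sinh (-s) = (1 - Real.exp s) * (1 + Real.exp s) / (2 * Real.exp s) := by
    rw [Real.sinh_eq, neg_neg, Real.exp_neg]; field_simp; ring
  rw [h3, Pi.div_apply]
  field_simp
  ring

theorem unitNormal_adsMetric (ha : 0 < a) {x : E3} (hx : x ∈ adsDomain (a + a ^ 3)) (i : Fin 3) :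
    unitNormal (adsMetric (a + a ^ 3)) hypRho x i = (areaRadius a (Real.log ‖x‖))⁻¹ * x i := by
  have hs := (mem_adsDomain_iff ha).1 hx
  have hx0 := ne_zero_of_mem_adsDomain ha hx
  have hn := norm_pos_iff.2 hx0
  have hd : 0 < 1 / Real.sinh (-Real.log ‖x‖) / ‖x‖ ^ 2 := by
    have := Real.sinh_pos_iff.2 (neg_pos.2 hs.2)
    positivity
  refine unitNormal_of_eq hx0 (areaRadius_pos ha hs) hd (adsMetric_eq ha hx)
    ((hasFDerivAt_comp_log_norm hx0 (hasDerivAt_ballRho hs.2)).congr_of_eventuallyEq ?_) i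
  filter_upwards [isOpen_ne.mem_nhds hx0] with y hy using hypRho_eq hy

theorem meanCurvature_adsMetric (ha : 0 < a) {x : E3} (hx : x ∈ adsDomain (a + a ^ 3)) :
    meanCurvature (adsMetric (a + a ^ 3)) hypRho x =
      2 * areaRadiusDeriv a (Real.log ‖x‖) / areaRadius a (Real.log ‖x‖) ^ 2 := by
  have hs := (mem_adsDomain_iff ha).1 hx
  have hx0 := ne_zero_of_mem_adsDomain ha hx
  have hn := norm_pos_iff.2 hx0
  have hR := areaRadius_pos ha hs
  rw [meanCurvature_of_christoffel (E := fun y => (areaRadius a (Real.log ‖y‖))⁻¹) (fun i => by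
      filter_upwards [(isOpen_adsDomain ha).mem_nhds hx] with y hy
      exact unitNormal_adsMetric ha hy i) (christoffel_adsMetric ha hx)
    (hasFDerivAt_comp_log_norm hx0 ((hasDerivAt_areaRadius ha hs).inv hR.ne')),
    Real.exp_neg, Real.exp_log hn]
  simp only [logDerivConf]
  field_simp
  ring

/-! ### Level surfaces of constant mean curvature. -/

theorem meanCurvature_eq_arcInv (ha : 0 < a) {s : ℝ} (hs : s ∈ logRange a) :
    2 * areaRadiusDeriv a s / areaRadius a s ^ 2 =
      2 * (arcInv a s * √(quartic a (arcInv a s)) / a) := by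
  have hw := (one_sub_arcInv_sq_pos ha hs).ne'
  rw [areaRadiusDeriv, areaRadius]
  field_simp

/-- Squaring gives an equation in `y ^ 2` with a single admissible root, and the sign `ε` then
selects one of the two values of `y`. -/
theorem arcInv_mul_sqrt_eq_iff (ha : 0 < a) {y : ℝ} (hy : y ∈ Ioo (-1 : ℝ) 1) (ε : ℝ)
    (hε : ε ^ 2 = 1) :
    y * √(quartic a y) / a = ε ↔ y = ε * (a / √(1 + a ^ 2)) := by
  have hw : 0 < 1 - y ^ 2 := by nlinarith [hy.1, hy.2]
  have hq := Real.sqrt_pos.2 (quartic_pos ha y)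
  have hq2 := Real.sq_sqrt (quartic_pos ha y).le
  have h1 : 0 < √(1 + a ^ 2) := Real.sqrt_pos.2 (by positivity)
  have h2 : √(1 + a ^ 2) ^ 2 = 1 + a ^ 2 := Real.sq_sqrt (by positivity)
  -- The double zeros at `y = ±1` belong to the two ends, where the mean curvature tends to `±2`;
  -- they are excluded by `hw`.
  have key : y ^ 2 * quartic a y - a ^ 2 = (1 - y ^ 2) ^ 2 * (y ^ 2 * (1 + a ^ 2) - a ^ 2) := by
    rw [quartic]; ring
  have hεpos : 0 < ε * y → y ^ 2 * (1 + a ^ 2) = a ^ 2 → y = ε * (a / √(1 + a ^ 2)) := by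
    intro h3 h4
    have h5 : (ε * y) * √(1 + a ^ 2) = a := by
      refine (pow_left_inj₀ (by positivity) ha.le two_ne_zero).1 ?_
      rw [mul_pow, mul_pow, h2, hε, one_mul, h4]
    field_simp
    linear_combination ε * h5 - y * √(1 + a ^ 2) * hε
  constructor
  · intro h
    rw [div_eq_iff ha.ne'] at h
    have h3 : y ^ 2 * (1 + a ^ 2) - a ^ 2 = 0 := by
      have h4 : y ^ 2 * quartic a y - a ^ 2 = 0 := by
        linear_combination (y * √(quartic a y) + ε * a) * h + a ^ 2 * hε - y ^ 2 * hq2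
      rw [key] at h4
      exact (mul_eq_zero.1 h4).resolve_left (by positivity)
    refine hεpos ?_ (by linarith)
    have h5 : (ε * y) * √(quartic a y) = a := by linear_combination ε * h + a * hε
    exact pos_of_mul_pos_left (by rw [h5]; exact ha) hq.le
  · intro h
    have h4 : y ^ 2 * (1 + a ^ 2) = a ^ 2 := by
      rw [h, mul_pow, hε, div_pow, h2]; field_simp
    have h3 : 0 < ε * y := by
      have : ε * y = ε ^ 2 * (a / √(1 + a ^ 2)) := by rw [h]; ring
      rw [this, hε]; positivity
    have h5 : (ε * y) * √(quartic a y) = a := by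
      refine (pow_left_inj₀ (by positivity) ha.le two_ne_zero).1 ?_
      rw [mul_pow, mul_pow, hq2, hε, one_mul]
      linarith [key, mul_eq_zero_of_right ((1 - y ^ 2) ^ 2) (sub_eq_zero.2 h4)]
    rw [div_eq_iff ha.ne']
    linear_combination ε * h5 - y * √(quartic a y) * hε

theorem levelHasMeanCurvature_iff (ha : 0 < a) {c : ℝ} (hc : rho0 (a + a ^ 3) < c) (H : ℝ) :
    LevelHasMeanCurvature (a + a ^ 3) c H ↔
      2 * (arcInv a (logRad c) * √(quartic a (arcInv a (logRad c))) / a) = H := by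
  have h0 := (rho0_pos ha).trans hc
  have hs := mem_logRange_of_rho0_lt ha hc
  have key : ∀ x : E3, ‖x‖ < 1 → hypRho x = c →
      meanCurvature (adsMetric (a + a ^ 3)) hypRho x =
        2 * (arcInv a (logRad c) * √(quartic a (arcInv a (logRad c))) / a) := by
    intro x hx1 hxc
    have hx : x ∈ adsDomain (a + a ^ 3) := ⟨hx1, by rwa [hxc]⟩
    have hlog := ((mem_adsDomain_iff ha).1 hx)
    rw [hypRho_eq (ne_zero_of_mem_adsDomain ha hx)] at hxc
    rw [meanCurvature_adsMetric ha hx, meanCurvature_eq_arcInv ha hlog, ← hxc,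
      logRad_ballRho hlog.2]
  constructor
  -- The level surface must be shown to be nonempty, since otherwise the curvature condition would
  -- be vacuous; a point on the first axis serves.
  · intro h
    have hn : ‖(EuclideanSpace.single 0 (Real.exp (logRad c)) : E3)‖ = Real.exp (logRad c) := by
      simp
    have h1 : ‖(EuclideanSpace.single 0 (Real.exp (logRad c)) : E3)‖ < 1 := by
      rw [hn]; simpa using hs.2
    have h2 : hypRho (EuclideanSpace.single 0 (Real.exp (logRad c)) : E3) = c := by
      rw [hypRho_eq (by simp), hn, Real.log_exp, ballRho_logRad h0]
    rw [← key _ h1 h2, h _ h1 h2]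
  · rintro rfl
    exact key

theorem arcInv_logRad_eq_iff (ha : 0 < a) {c y : ℝ} (hc : rho0 (a + a ^ 3) < c)
    (hy : y ∈ Ioo (-1 : ℝ) 1) : arcInv a (logRad c) = y ↔ c = ballRho (arc a y) := by
  have h0 := (rho0_pos ha).trans hc
  constructor
  · rintro rfl
    rw [arc_arcInv (mem_range_arc ha (mem_logRange_of_rho0_lt ha hc)), ballRho_logRad h0]
  · rintro rfl
    rw [logRad_ballRho (arc_neg_of_lt_one ha hy.2), arcInv_arc ha]

theorem exists_levels (ha : 0 < a) : ∃ ρ₂ ρ₁ ρ₂' : ℝ, ρ₁ < ρ₂ ∧ ρ₂' < ρ₁ ∧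
    rho0 (a + a ^ 3) < ρ₂' ∧ ∀ c, rho0 (a + a ^ 3) < c →
      (LevelHasMeanCurvature (a + a ^ 3) c 2 ↔ c = ρ₂) ∧
      (LevelHasMeanCurvature (a + a ^ 3) c 0 ↔ c = ρ₁) ∧
      (LevelHasMeanCurvature (a + a ^ 3) c (-2) ↔ c = ρ₂') := by
  set y₀ := a / √(1 + a ^ 2) with hy₀
  have h1 : 0 < √(1 + a ^ 2) := Real.sqrt_pos.2 (by positivity)
  have hy0 : 0 < y₀ := div_pos ha h1
  have hy1 : y₀ < 1 := by
    rw [hy₀, div_lt_one h1]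
    exact Real.lt_sqrt_of_sq_lt (by linarith)
  have hlt : ∀ {y z : ℝ}, z < 1 → y < z → ballRho (arc a y) < ballRho (arc a z) :=
    fun hz hyz => ballRho_strictMonoOn (arc_neg_of_lt_one ha (hyz.trans hz))
      (arc_neg_of_lt_one ha hz) (strictMono_arc ha hyz)
  -- The levels correspond to `y = y₀`, `0`, `-y₀`, and `arc` and `ballRho` preserve order. At `±y₀`
  -- the area radius is `a (1 + a ^ 2) = M`.
  refine ⟨ballRho (arc a y₀), ballRho (arc a 0), ballRho (arc a (-y₀)), hlt hy1 hy0,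
    hlt one_pos (by linarith), ?_, fun c hc => ?_⟩
  · rw [rho0_eq ha, ← arc_neg_one ha]
    exact hlt (by linarith) (by linarith)
  · have hY := arcInv_mem ha (mem_logRange_of_rho0_lt ha hc)
    simp only [levelHasMeanCurvature_iff ha hc]
    refine ⟨?_, ?_, ?_⟩
    · rw [← arcInv_logRad_eq_iff ha hc ⟨by linarith, hy1⟩]
      have := arcInv_mul_sqrt_eq_iff ha hY 1 (by norm_num)
      rw [one_mul] at this
      rw [← this]
      constructor <;> intro h <;> linarith
    · rw [← arcInv_logRad_eq_iff ha hc ⟨by norm_num, by norm_num⟩]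
      have hq := (Real.sqrt_pos.2 (quartic_pos ha (arcInv a (logRad c)))).ne'
      simp [hq, ha.ne']
    · rw [← arcInv_logRad_eq_iff ha hc ⟨by linarith, by linarith⟩]
      have := arcInv_mul_sqrt_eq_iff ha hY (-1) (by norm_num)
      rw [neg_one_mul] at this
      rw [← this]
      constructor <;> intro h <;> linarith

theorem contDiffAt_log_norm {x : E3} (hx : x ≠ 0) {n : WithTop ℕ∞} :
    ContDiffAt ℝ n (fun y : E3 => Real.log ‖y‖) x :=
  (contDiffAt_norm ℝ hx).log (norm_ne_zero_iff.2 hx)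

theorem isRiemannianMetric_smul_one {n : WithTop ℕ∞} {U : Set E3} {G : MetricField} {c : E3 → ℝ}
    (hc : ContDiffOn ℝ n c U) (hpos : ∀ x ∈ U, 0 < c x) (hG : ∀ x ∈ U, G x = c x • 1) :
    IsRiemannianMetric n U G := by
  refine ⟨fun i j => ?_, fun x hx => ?_⟩
  · have h : ContDiffOn ℝ n (fun x => c x * (1 : Matrix (Fin 3) (Fin 3) ℝ) i j) U :=
      hc.mul contDiffOn_const
    exact h.congr fun x hx => by rw [hG x hx, Matrix.smul_apply, smul_eq_mul]
  · rw [hG x hx]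
    exact Matrix.PosDef.one.smul (hpos x hx)

theorem isRiemannianMetric_adsMetric (ha : 0 < a) :
    IsRiemannianMetric ∞ (adsDomain (a + a ^ 3)) (adsMetric (a + a ^ 3)) := by
  refine isRiemannianMetric_smul_one (c := fun x => conf a (Real.log ‖x‖)) (fun x hx => ?_)
    (fun x hx => conf_pos ha ((mem_adsDomain_iff ha).1 hx)) (fun x hx => adsMetric_eq_conf ha hx)
  have h1 : ContDiffAt ℝ ∞ (conf a) (Real.log ‖x‖) :=
    ((contDiffAt_areaRadius ha ((mem_adsDomain_iff ha).1 hx)).mul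
      (Real.contDiff_exp.comp contDiff_neg).contDiffAt).pow 2
  exact (h1.comp x (contDiffAt_log_norm (ne_zero_of_mem_adsDomain ha hx))).contDiffWithinAt

end


/-! ### Completeness -/

theorem sqrt_form_smul_one {A : Matrix (Fin 3) (Fin 3) ℝ} {c : ℝ} (hA : A = c • 1)
    (hc : 0 ≤ c) (v : E3) : √(form A v v) = √c * ‖v‖ := by
  rw [hA, form_smul_one, real_inner_self_eq_norm_sq, Real.sqrt_mul hc,
    Real.sqrt_sq (norm_nonneg v)]

theorem integrableOn_speed {U : Set E3} {G : MetricField}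
    (hG : ∀ i j, ContinuousOn (fun x => G x i j) U) {γ : ℝ → E3}
    (hγ : ContDiffOn ℝ 1 γ (Icc 0 1)) (hU : MapsTo γ (Icc 0 1) U) :
    MeasureTheory.IntegrableOn (fun s => √(form (G (γ s)) (deriv γ s) (deriv γ s)))
      (Icc 0 1) := by
  have hd : ContinuousOn (derivWithin γ (Icc 0 1)) (Icc 0 1) :=
    hγ.continuousOn_derivWithin (uniqueDiffOn_Icc zero_lt_one) le_rfl
  have hdi : ∀ i : Fin 3, ContinuousOn (fun s => derivWithin γ (Icc 0 1) s i) (Icc 0 1) :=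
    fun i => (EuclideanSpace.proj i : E3 →L[ℝ] ℝ).continuous.comp_continuousOn hd
  have hc : ContinuousOn (fun s => √(form (G (γ s)) (derivWithin γ (Icc 0 1) s)
      (derivWithin γ (Icc 0 1) s))) (Icc 0 1) := by
    refine ContinuousOn.sqrt ?_
    unfold form
    exact continuousOn_finsetSum _ fun i _ => continuousOn_finsetSum _ fun j _ =>
      (((hG i j).comp hγ.continuousOn hU).mul (hdi i)).mul (hdi j)
  have h := hc.integrableOn_Icc (μ := MeasureTheory.volume)
  -- The values of `γ` outside `[0, 1]` are arbitrary, so `deriv γ` is controlled only in the open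
  -- interval; the endpoints have measure zero.
  rw [integrableOn_Icc_iff_integrableOn_Ioo] at h ⊢
  refine h.congr_fun (fun s hs => ?_) measurableSet_Ioo
  simp only
  rw [derivWithin_of_mem_nhds (Icc_mem_nhds hs.1 hs.2)]

/-- The fundamental theorem of calculus along `γ`: a function whose differential is bounded by the
Riemannian norm grows at most by the length. Both distance estimates below arise from a suitable
choice of `l`. -/
theorem sub_le_curveLength {U : Set E3} {G : MetricField}
    (hG : ∀ i j, ContinuousOn (fun x => G x i j) U) {γ : ℝ → E3}
    (hγ : ContDiffOn ℝ 1 γ (Icc 0 1)) (hU : MapsTo γ (Icc 0 1) U) {l : E3 → ℝ}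
    {l' : E3 → E3 →L[ℝ] ℝ} (hl : ∀ x ∈ U, HasFDerivAt l (l' x) x)
    (hle : ∀ x ∈ U, ∀ v, l' x v ≤ √(form (G x) v v)) :
    l (γ 1) - l (γ 0) ≤ curveLength G γ := by
  refine intervalIntegral.sub_le_integral_of_hasDeriv_right_of_le (g := l ∘ γ)
    (g' := fun s => l' (γ s) (deriv γ s)) zero_le_one ?_ (fun s hs => ?_)
    (integrableOn_speed hG hγ hU) fun s hs => hle _ (hU (Ioo_subset_Icc_self hs)) _
  · have hlc : ContinuousOn l U := fun x hx => (hl x hx).continuousAt.continuousWithinAt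
    exact hlc.comp hγ.continuousOn hU
  · have h1 : DifferentiableAt ℝ γ s :=
      ((hγ s (Ioo_subset_Icc_self hs)).contDiffAt (Icc_mem_nhds hs.1 hs.2)).differentiableAt
        one_ne_zero
    exact ((hl _ (hU (Ioo_subset_Icc_self hs))).comp_hasDerivAt s h1.hasDerivAt).hasDerivWithinAt

theorem ofReal_sub_le_riemDist {U : Set E3} {G : MetricField}
    (hG : ∀ i j, ContinuousOn (fun x => G x i j) U) {l : E3 → ℝ}
    {l' : E3 → E3 →L[ℝ] ℝ} (hl : ∀ x ∈ U, HasFDerivAt l (l' x) x)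
    (hle : ∀ x ∈ U, ∀ v, l' x v ≤ √(form (G x) v v)) (x y : E3) :
    ENNReal.ofReal (l y - l x) ≤ riemDist U G x y := by
  refine le_iInf fun γ => ENNReal.ofReal_le_ofReal ?_
  obtain ⟨γ, h1, h2, rfl, rfl⟩ := γ
  exact sub_le_curveLength hG h1 h2 hl hle

/-- Near a point of `U` the Riemannian distance is bounded by the Euclidean one. -/
theorem tendsto_riemDist {U : Set E3} (hU : IsOpen U) {G : MetricField} {c : E3 → ℝ}
    (hG : ∀ x ∈ U, G x = c x • 1) (hpos : ∀ x ∈ U, 0 < c x) (hc : ContinuousOn c U) {y : E3}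
    (hy : y ∈ U) : Tendsto (fun x => riemDist U G x y) (𝓝 y) (𝓝 0) := by
  have hcy : ContinuousAt c y := hc.continuousAt (hU.mem_nhds hy)
  -- On a ball inside `U` with `c < c y + 1`, the straight segment to the centre is an admissible
  -- curve of controlled length.
  obtain ⟨δ, hδ, hball⟩ := Metric.mem_nhds_iff.1
    (Filter.inter_mem (hU.mem_nhds hy) (hcy.eventually_lt_const (lt_add_one (c y))))
  have hbound : ∀ x ∈ Metric.ball y δ,
      riemDist U G x y ≤ ENNReal.ofReal (√(c y + 1) * ‖y - x‖) := by
    intro x hx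
    have hmem : ∀ s ∈ Icc (0 : ℝ) 1, x + s • (y - x) ∈ Metric.ball y δ := fun s hs =>
      (convex_ball y δ).add_smul_sub_mem hx (Metric.mem_ball_self hδ) hs
    have hd : ∀ s, HasDerivAt (fun s : ℝ => x + s • (y - x)) (y - x) s := fun s => by
      simpa using ((hasDerivAt_id s).smul_const (y - x)).const_add x
    let γ : {γ : ℝ → E3 // ContDiffOn ℝ 1 γ (Icc 0 1) ∧ MapsTo γ (Icc 0 1) U ∧ γ 0 = x ∧
        γ 1 = y} :=
      ⟨fun s => x + s • (y - x), by fun_prop, fun s hs => (hball (hmem s hs)).1, by simp, by simp⟩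
    refine (iInf_le _ γ).trans (ENNReal.ofReal_le_ofReal ?_)
    have h := intervalIntegral.norm_integral_le_of_norm_le_const (a := 0) (b := 1)
      (f := fun s => √(form (G (γ.1 s)) (deriv γ.1 s) (deriv γ.1 s)))
      (C := √(c y + 1) * ‖y - x‖) fun s hs => by
        have hs' := hball (hmem s (uIoc_subset_uIcc.trans (uIcc_of_le zero_le_one).subset hs))
        rw [Real.norm_of_nonneg (Real.sqrt_nonneg _), (hd s).deriv,
          sqrt_form_smul_one (hG _ hs'.1) (hpos _ hs'.1).le]
        exact mul_le_mul_of_nonneg_right (Real.sqrt_le_sqrt (le_of_lt hs'.2)) (norm_nonneg _)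
    rw [sub_zero, abs_one, mul_one] at h
    exact (le_abs_self _).trans h
  have hlim : Tendsto (fun x => ENNReal.ofReal (√(c y + 1) * ‖y - x‖)) (𝓝 y) (𝓝 0) := by
    have h : Continuous fun x => ENNReal.ofReal (√(c y + 1) * ‖y - x‖) :=
      ENNReal.continuous_ofReal.comp (by fun_prop)
    simpa using h.tendsto y
  refine tendsto_of_tendsto_of_tendsto_of_le_of_le' tendsto_const_nhds hlim
    (Eventually.of_forall fun _ => zero_le) ?_
  filter_upwards [Metric.ball_mem_nhds y hδ] with x hx using hbound x hx

section

variable {a : ℝ}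

theorem continuousOn_adsMetric (ha : 0 < a) (i j : Fin 3) :
    ContinuousOn (fun x => adsMetric (a + a ^ 3) x i j) (adsDomain (a + a ^ 3)) :=
  ((isRiemannianMetric_adsMetric ha).1 i j).continuousOn

theorem sqrt_form_adsMetric (ha : 0 < a) {x : E3} (hx : x ∈ adsDomain (a + a ^ 3)) (v : E3) :
    √(form (adsMetric (a + a ^ 3) x) v v) = areaRadius a (Real.log ‖x‖) / ‖x‖ * ‖v‖ := by
  have hR := areaRadius_pos ha ((mem_adsDomain_iff ha).1 hx)
  rw [sqrt_form_smul_one (adsMetric_eq ha hx) (sq_nonneg _), Real.sqrt_sq (by positivity)]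

/-- The test function is `a` times the linear form in the direction `y - x`. It is admissible
because the conformal factor `R / ‖z‖` is at least `a`. -/
theorem mul_norm_sub_le_riemDist (ha : 0 < a) (x y : E3) :
    ENNReal.ofReal (a * ‖y - x‖) ≤
      riemDist (adsDomain (a + a ^ 3)) (adsMetric (a + a ^ 3)) x y := by
  have h := ofReal_sub_le_riemDist (continuousOn_adsMetric ha)
    (l := fun z => (a • innerSL ℝ (‖y - x‖⁻¹ • (y - x))) z)
    (l' := fun _ => a • innerSL ℝ (‖y - x‖⁻¹ • (y - x)))
    (fun z _ => ContinuousLinearMap.hasFDerivAt _)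
    (fun z hz v => by
      have hn := norm_pos_iff.2 (ne_zero_of_mem_adsDomain ha hz)
      have hR := le_areaRadius ha ((mem_adsDomain_iff ha).1 hz)
      rw [sqrt_form_adsMetric ha hz]
      have h1 : inner ℝ (‖y - x‖⁻¹ • (y - x)) v ≤ ‖v‖ := by
        refine (real_inner_le_norm _ _).trans (mul_le_of_le_one_left (norm_nonneg v) ?_)
        rw [norm_smul, norm_inv, norm_norm]
        exact inv_mul_le_one
      have h2 : a ≤ areaRadius a (Real.log ‖z‖) / ‖z‖ := by
        rw [le_div_iff₀ hn]
        nlinarith [hz.1]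
      calc (a • innerSL ℝ (‖y - x‖⁻¹ • (y - x))) v = a * inner ℝ (‖y - x‖⁻¹ • (y - x)) v := rfl
        _ ≤ a * ‖v‖ := mul_le_mul_of_nonneg_left h1 ha.le
        _ ≤ _ := mul_le_mul_of_nonneg_right h2 (norm_nonneg v)) x y
  refine le_trans (le_of_eq ?_) h
  congr 1
  simp only [← map_sub]
  change _ = a * inner ℝ (‖y - x‖⁻¹ • (y - x)) (y - x)
  rw [real_inner_smul_left, real_inner_self_eq_norm_sq]
  by_cases h0 : ‖y - x‖ = 0
  · simp [h0]
  · field_simp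

/-- The Riemannian norm of `d (log R)` is `|R'| / R ^ 2`, and the first integral together with `R ≥
a` bounds it by `1 + 1 / a`. -/
theorem log_areaRadius_sub_le_riemDist (ha : 0 < a) (x y : E3) :
    ENNReal.ofReal ((1 + 1 / a)⁻¹ * Real.log (areaRadius a (Real.log ‖y‖)) -
      (1 + 1 / a)⁻¹ * Real.log (areaRadius a (Real.log ‖x‖))) ≤
      riemDist (adsDomain (a + a ^ 3)) (adsMetric (a + a ^ 3)) x y := by
  have hlog : ∀ s ∈ logRange a, HasDerivAt (fun s => (1 + 1 / a)⁻¹ * Real.log (areaRadius a s))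
      ((1 + 1 / a)⁻¹ * (areaRadiusDeriv a s / areaRadius a s)) s := fun s hs =>
    ((hasDerivAt_areaRadius ha hs).log (areaRadius_pos ha hs).ne').const_mul _
  refine ofReal_sub_le_riemDist (continuousOn_adsMetric ha)
    (l := fun z => (1 + 1 / a)⁻¹ * Real.log (areaRadius a (Real.log ‖z‖)))
    (fun z hz => hasFDerivAt_comp_log_norm (ne_zero_of_mem_adsDomain ha hz)
      (hlog _ ((mem_adsDomain_iff ha).1 hz))) (fun z hz v => ?_) x y
  have hs := (mem_adsDomain_iff ha).1 hz
  have hn := norm_pos_iff.2 (ne_zero_of_mem_adsDomain ha hz)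
  have hR := areaRadius_pos ha hs
  have hRa := le_areaRadius ha hs
  have hC : 0 < 1 + 1 / a := by positivity
  rw [sqrt_form_adsMetric ha hz]
  set R := areaRadius a (Real.log ‖z‖)
  have h1 : |areaRadiusDeriv a (Real.log ‖z‖)| ≤ (1 + 1 / a) * R ^ 2 := by
    refine abs_le_of_sq_le_sq ?_ (by positivity)
    rw [areaRadiusDeriv_sq ha hs]
    have h2 : R ^ 2 ≤ (1 / a) ^ 2 * R ^ 4 := by
      have h3 : (1 / a) ^ 2 * R ^ 4 = (R / a) ^ 2 * R ^ 2 := by ring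
      rw [h3]
      exact le_mul_of_one_le_left (sq_nonneg R) (one_le_pow₀ ((one_le_div ha).2 hRa))
    have h4 : 0 ≤ (a + a ^ 3) * R := by positivity
    have h5 : ((1 + 1 / a) * R ^ 2) ^ 2 = R ^ 4 + (1 / a) ^ 2 * R ^ 4 + 2 / a * R ^ 4 := by ring
    have h6 : 0 ≤ 2 / a * R ^ 4 := by positivity
    rw [h5]
    linarith
  change (1 + 1 / a)⁻¹ * (areaRadiusDeriv a (Real.log ‖z‖) / R) / ‖z‖ ^ 2 * inner ℝ z v ≤ _
  calc _ ≤ |(1 + 1 / a)⁻¹ * (areaRadiusDeriv a (Real.log ‖z‖) / R) / ‖z‖ ^ 2 * inner ℝ z v| :=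
        le_abs_self _
    _ = (1 + 1 / a)⁻¹ * (|areaRadiusDeriv a (Real.log ‖z‖)| / R) / ‖z‖ ^ 2 * |inner ℝ z v| := by
        rw [abs_mul, abs_div, abs_mul, abs_div, abs_of_pos hR, abs_of_pos (inv_pos.2 hC),
          abs_of_pos (pow_pos hn 2)]
    _ ≤ (1 + 1 / a)⁻¹ * ((1 + 1 / a) * R ^ 2 / R) / ‖z‖ ^ 2 * (‖z‖ * ‖v‖) := by
        gcongr
        exact abs_real_inner_le_norm z v
    _ = R / ‖z‖ * ‖v‖ := by field_simp

/-- A Cauchy sequence converges in the closed Euclidean shell by the linear estimate. The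
logarithmic estimate bounds the area radius along it, hence keeps `1 - arcInv ^ 2` away from zero,
so the limit is not on the boundary. -/
theorem isCompleteMetric_adsMetric (ha : 0 < a) :
    IsCompleteMetric (adsDomain (a + a ^ 3)) (adsMetric (a + a ^ 3)) := by
  intro x hx hcau
  have hcs : CauchySeq x := by
    refine Metric.cauchySeq_iff.2 fun ε hε => ?_
    obtain ⟨N, hN⟩ := hcau (ENNReal.ofReal (a * ε)) (ENNReal.ofReal_pos.2 (by positivity))
    refine ⟨N, fun m hm n hn => ?_⟩
    have h := (mul_norm_sub_le_riemDist ha _ _).trans_lt (hN n hn m hm)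
    rw [ENNReal.ofReal_lt_ofReal_iff (by positivity)] at h
    rw [dist_eq_norm]
    exact lt_of_mul_lt_mul_left h ha.le
  obtain ⟨y, hy⟩ := cauchySeq_tendsto_of_complete hcs
  have hnorm : Tendsto (fun n => ‖x n‖) atTop (𝓝 ‖y‖) := hy.norm
  have hmem : ‖y‖ ∈ Icc (Real.exp (2 * arc a 0)) 1 :=
    isClosed_Icc.mem_of_tendsto hnorm (Eventually.of_forall fun n =>
      Ioo_subset_Icc_self ((mem_adsDomain_iff_norm ha).1 (hx n)))
  have hy0 : 0 < ‖y‖ := (Real.exp_pos _).trans_le hmem.1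
  have hlogmem : Real.log ‖y‖ ∈ Icc (2 * arc a 0) 0 :=
    ⟨(Real.le_log_iff_exp_le hy0).2 hmem.1, Real.log_nonpos hy0.le hmem.2⟩
  have hrange := mem_range_arc_of_mem_Icc ha hlogmem
  obtain ⟨N, hN⟩ := hcau 1 one_pos
  set B := Real.exp ((1 + 1 / a) * (1 + (1 + 1 / a)⁻¹ *
    Real.log (areaRadius a (Real.log ‖x N‖)))) with hB
  have hC : 0 < 1 + 1 / a := by positivity
  have hbound : ∀ n ≥ N, a / B ≤ 1 - arcInv a (Real.log ‖x n‖) ^ 2 := fun n hn => by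
    have hs := (mem_adsDomain_iff ha).1 (hx n)
    have h := (log_areaRadius_sub_le_riemDist ha _ _).trans_lt (hN N le_rfl n hn)
    rw [← ENNReal.ofReal_one, ENNReal.ofReal_lt_ofReal_iff one_pos, sub_lt_iff_lt_add] at h
    have h2 := mul_lt_mul_of_pos_left h hC
    rw [mul_inv_cancel_left₀ hC.ne', Real.log_lt_iff_lt_exp (areaRadius_pos ha hs), ← hB,
      areaRadius, div_lt_iff₀ (one_sub_arcInv_sq_pos ha hs)] at h2
    rw [div_le_iff₀ (Real.exp_pos _)]
    linarith
  have hlim : Tendsto (fun n => 1 - arcInv a (Real.log ‖x n‖) ^ 2) atTop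
      (𝓝 (1 - arcInv a (Real.log ‖y‖) ^ 2)) :=
    (((contDiffAt_arcInv ha hrange).continuousAt.tendsto.comp
      (hnorm.log hy0.ne')).pow 2).const_sub 1
  have hpos : 0 < 1 - arcInv a (Real.log ‖y‖) ^ 2 :=
    lt_of_lt_of_le (div_pos ha (Real.exp_pos _))
      (ge_of_tendsto hlim ((eventually_ge_atTop N).mono hbound))
  have hyU : y ∈ adsDomain (a + a ^ 3) := by
    rw [mem_adsDomain_iff ha]
    refine ⟨hlogmem.1.lt_of_ne fun h => ?_, hlogmem.2.lt_of_ne fun h => ?_⟩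
    · rw [← h, ← arc_neg_one ha, arcInv_arc ha] at hpos
      norm_num at hpos
    · rw [h, arcInv_zero ha] at hpos
      norm_num at hpos
  refine ⟨y, hyU, ?_⟩
  refine (tendsto_riemDist (isOpen_adsDomain ha) (fun z hz => adsMetric_eq_conf ha hz)
    (fun z hz => conf_pos ha ((mem_adsDomain_iff ha).1 hz)) (fun z hz => ?_) hyU).comp hy
  exact ((hasFDerivAt_comp_log_norm (ne_zero_of_mem_adsDomain ha hz)
    (hasDerivAt_conf ha ((mem_adsDomain_iff ha).1 hz))).continuousAt).continuousWithinAt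

end


/-! ### The geodesic defining function in terms of the inverse of the area radius -/

/-- `2 artanh z`. -/
noncomputable def logRatio (z : ℝ) : ℝ := Real.log (1 + z) - Real.log (1 - z)

theorem hasDerivAt_logRatio {z : ℝ} (hz : |z| < 1) :
    HasDerivAt logRatio (2 / (1 - z ^ 2)) z := by
  obtain ⟨h1, h2⟩ := abs_lt.1 hz
  have h3 : 1 + z ≠ 0 := by linarith
  have h4 : 1 - z ≠ 0 := by linarith
  have h5 : 1 - z ^ 2 = (1 + z) * (1 - z) := by ring
  refine ((((hasDerivAt_id z).const_add 1).log h3).sub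
    (((hasDerivAt_id z).const_sub 1).log h4)).congr_deriv ?_
  simp only [id]
  rw [h5]
  field_simp
  ring

theorem exp_logRatio {z : ℝ} (hz : |z| < 1) : Real.exp (logRatio z) = (1 + z) / (1 - z) := by
  obtain ⟨h1, h2⟩ := abs_lt.1 hz
  rw [logRatio, Real.exp_sub, Real.exp_log (by linarith), Real.exp_log (by linarith)]

theorem sinh_logRatio {z : ℝ} (hz : |z| < 1) :
    Real.sinh (logRatio z) = 2 * z / (1 - z ^ 2) := by
  obtain ⟨h1, h2⟩ := abs_lt.1 hz
  have h3 : 1 + z ≠ 0 := by linarith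
  have h4 : 1 - z ≠ 0 := by linarith
  have h5 : 1 - z ^ 2 = (1 + z) * (1 - z) := by ring
  rw [Real.sinh_eq, Real.exp_neg, exp_logRatio hz, h5]
  field_simp
  ring

theorem analyticAt_logRatio {z : ℝ} (hz : |z| < 1) : AnalyticAt ℝ logRatio z := by
  obtain ⟨h1, h2⟩ := abs_lt.1 hz
  exact ((analyticAt_const.add analyticAt_id).log (by simp; linarith)).sub
    ((analyticAt_const.sub analyticAt_id).log (by simp; linarith))

theorem logRatio_zero : logRatio 0 = 0 := by simp [logRatio]

/-- The singularity of `logRatio z / z` at `0` is removable because `logRatio` is analytic. This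
lets `t / u` be smooth across the boundary. -/
theorem contDiffAt_dslope_logRatio {z : ℝ} (hz : |z| < 1) :
    ContDiffAt ℝ ∞ (dslope logRatio 0) z := by
  rcases eq_or_ne z 0 with rfl | hne
  · obtain ⟨p, hp⟩ := analyticAt_logRatio hz
    exact (AnalyticAt.contDiffAt ⟨_, hp.has_fpower_series_dslope_fslope⟩)
  · refine ContDiffAt.congr_of_eventuallyEq ?_ (dslope_eventuallyEq_slope_of_ne _ hne)
    have : slope logRatio 0 = fun z => (z - 0)⁻¹ • (logRatio z - logRatio 0) := rfl
    rw [this]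
    exact ((contDiffAt_id.sub contDiffAt_const).inv (by simpa using hne)).smul
      ((analyticAt_logRatio hz).contDiffAt.sub contDiffAt_const)

theorem mul_dslope_logRatio (z : ℝ) : z * dslope logRatio 0 z = logRatio z := by
  have := sub_smul_dslope logRatio 0 z
  simpa [logRatio_zero] using this

theorem dslope_logRatio_zero : dslope logRatio 0 0 = 2 := by
  rw [dslope_same, (hasDerivAt_logRatio (by simp)).deriv]
  norm_num

theorem dslope_logRatio_pos {z : ℝ} (h0 : 0 ≤ z) (h1 : z < 1) : 0 < dslope logRatio 0 z := by
  rcases h0.eq_or_lt with rfl | h0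
  · rw [dslope_logRatio_zero]; norm_num
  · have h2 : 0 < logRatio z := by
      rw [logRatio, sub_pos]
      exact Real.log_lt_log (by linarith) (by linarith)
    rw [← mul_dslope_logRatio] at h2
    exact pos_of_mul_pos_right h2 h0.le

section

variable {a : ℝ}

/-- `1 + u² - M u³` for `M = a + a³`. -/
noncomputable def cubic (a u : ℝ) : ℝ := 1 + u ^ 2 - (a + a ^ 3) * u ^ 3

theorem cubic_eq (a u : ℝ) : cubic a u = (1 - a * u) * (1 + a * u + (1 + a ^ 2) * u ^ 2) := by
  rw [cubic]; ring

/-- The second factor in `cubic_eq` has no real zero, so the horizon `u = 1 / a` is the only one.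
Negative `u` are included because everything is continued past the boundary `u = 0`. -/
theorem cubic_pos (ha : 0 < a) {u : ℝ} (hu : u < 1 / a) : 0 < cubic a u := by
  have h1 : 0 < 1 - a * u := by
    rw [lt_div_iff₀ ha] at hu; linarith
  rw [cubic_eq]
  refine mul_pos h1 ?_
  nlinarith [sq_nonneg (1 + a * u / 2), sq_nonneg (a * u), sq_nonneg u, sq_nonneg (2 + a * u)]

theorem contDiff_cubic : ContDiff ℝ ∞ (cubic a) := by
  unfold cubic; fun_prop

/-- The function `((1 + v² - M v³)^{-1/2} - 1) / v`. -/
noncomputable def jetIntegrand (a v : ℝ) : ℝ :=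
  -(v * (1 - (a + a ^ 3) * v)) / (√(cubic a v) * (1 + √(cubic a v)))

theorem contDiffAt_jetIntegrand (ha : 0 < a) {v : ℝ} (hv : v < 1 / a) :
    ContDiffAt ℝ ∞ (jetIntegrand a) v := by
  have hp := cubic_pos ha hv
  have hs : ContDiffAt ℝ ∞ (fun v => √(cubic a v)) v := contDiff_cubic.contDiffAt.sqrt hp.ne'
  have h0 := Real.sqrt_pos.2 hp
  unfold jetIntegrand
  refine ContDiffAt.div (by fun_prop) (hs.mul (contDiffAt_const.add hs)) ?_
  positivity

/-- The integral of `jetIntegrand`. -/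
noncomputable def jetExponent (a u : ℝ) : ℝ := ∫ v in (0 : ℝ)..u, jetIntegrand a v

theorem hasDerivAt_jetExponent (ha : 0 < a) {u : ℝ} (hu : u < 1 / a) :
    HasDerivAt (jetExponent a) (jetIntegrand a u) u := by
  have hc : ContinuousOn (jetIntegrand a) (Iio (1 / a)) := fun v hv =>
    (contDiffAt_jetIntegrand ha hv).continuousAt.continuousWithinAt
  refine intervalIntegral.integral_hasDerivAt_right (hc.mono ?_).intervalIntegrable
    (hc.stronglyMeasurableAtFilter isOpen_Iio u hu) (contDiffAt_jetIntegrand ha hu).continuousAt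
  intro v hv
  exact lt_of_le_of_lt hv.2 (max_lt (by positivity) hu)

theorem contDiffOn_jetExponent (ha : 0 < a) : ContDiffOn ℝ ∞ (jetExponent a) (Iio (1 / a)) := by
  rw [contDiffOn_infty_iff_deriv_of_isOpen isOpen_Iio]
  have h : ContDiffOn ℝ ∞ (jetIntegrand a) (Iio (1 / a)) := fun u hu =>
    (contDiffAt_jetIntegrand ha hu).contDiffWithinAt
  exact ⟨fun u hu => (hasDerivAt_jetExponent ha hu).differentiableAt.differentiableWithinAt,
    h.congr fun u hu => (hasDerivAt_jetExponent ha hu).deriv⟩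

theorem contDiffAt_jetExponent (ha : 0 < a) {u : ℝ} (hu : u < 1 / a) :
    ContDiffAt ℝ ∞ (jetExponent a) u :=
  (contDiffOn_jetExponent ha).contDiffAt (Iio_mem_nhds hu)

theorem jetExponent_zero : jetExponent a 0 = 0 := by simp [jetExponent]

/-- `tanh (t / 2)` as a function of `u = 1 / r`. -/
noncomputable def halfTanh (a u : ℝ) : ℝ := u / 2 * Real.exp (jetExponent a u)

theorem halfTanh_zero : halfTanh a 0 = 0 := by simp [halfTanh]

theorem contDiffAt_halfTanh (ha : 0 < a) {u : ℝ} (hu : u < 1 / a) :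
    ContDiffAt ℝ ∞ (halfTanh a) u := by
  have h := (contDiffAt_jetExponent ha hu).exp
  unfold halfTanh
  exact (contDiffAt_id.div_const 2).mul h

/-- For `z = tanh (t / 2)` this is `z' = z / (u √cubic)`, the equation of the geodesic defining
function, with `u` cancelled so that it also holds at `u = 0`. -/
theorem hasDerivAt_halfTanh (ha : 0 < a) {u : ℝ} (hu : u < 1 / a) :
    HasDerivAt (halfTanh a) (Real.exp (jetExponent a u) / (2 * √(cubic a u))) u := by
  refine (((hasDerivAt_id u).div_const 2).mul (hasDerivAt_jetExponent ha hu).exp).congr_deriv ?_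
  have hp := cubic_pos ha hu
  have h0 := Real.sqrt_pos.2 hp
  have h2 := Real.sq_sqrt hp.le
  simp only [jetIntegrand, id]
  generalize √(cubic a u) = q at h0 h2
  rw [cubic] at h2
  field_simp
  linear_combination h2

/-- The quotient `t / u`, where `t` is the geodesic defining function and `u = 1 / r`. -/
noncomputable def defSlope (a u : ℝ) : ℝ :=
  dslope logRatio 0 (halfTanh a u) * (Real.exp (jetExponent a u) / 2)

/-- The geodesic defining function as a function of `u = 1 / r`. -/
noncomputable def defFun (a u : ℝ) : ℝ := logRatio (halfTanh a u)

theorem defFun_eq (a u : ℝ) : defFun a u = u * defSlope a u := by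
  rw [defFun, ← mul_dslope_logRatio, defSlope, halfTanh]
  ring

theorem defFun_zero : defFun a 0 = 0 := by rw [defFun_eq, zero_mul]

theorem defSlope_zero : defSlope a 0 = 1 := by
  rw [defSlope, halfTanh_zero, dslope_logRatio_zero, jetExponent_zero, Real.exp_zero]
  norm_num

theorem contDiffAt_defSlope (ha : 0 < a) {u : ℝ} (hu : u < 1 / a) (hz : |halfTanh a u| < 1) :
    ContDiffAt ℝ ∞ (defSlope a) u :=
  ((contDiffAt_dslope_logRatio hz).comp u (contDiffAt_halfTanh ha hu)).mul
    ((contDiffAt_jetExponent ha hu).exp.div_const 2)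

theorem contDiffAt_defFun (ha : 0 < a) {u : ℝ} (hu : u < 1 / a) (hz : |halfTanh a u| < 1) :
    ContDiffAt ℝ ∞ (defFun a) u :=
  ((analyticAt_logRatio hz).contDiffAt).comp u (contDiffAt_halfTanh ha hu)

/-- The derivative of `defFun a`. -/
noncomputable def defFunDeriv (a u : ℝ) : ℝ :=
  Real.exp (jetExponent a u) / ((1 - halfTanh a u ^ 2) * √(cubic a u))

theorem defFunDeriv_pos (ha : 0 < a) {u : ℝ} (hu : u < 1 / a) (hz : |halfTanh a u| < 1) :
    0 < defFunDeriv a u := by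
  have h1 := Real.sqrt_pos.2 (cubic_pos ha hu)
  have h2 : 0 < 1 - halfTanh a u ^ 2 := by
    rw [sub_pos, sq_lt_one_iff_abs_lt_one]; exact hz
  unfold defFunDeriv
  positivity

theorem hasDerivAt_defFun (ha : 0 < a) {u : ℝ} (hu : u < 1 / a) (hz : |halfTanh a u| < 1) :
    HasDerivAt (defFun a) (defFunDeriv a u) u := by
  refine ((hasDerivAt_logRatio hz).comp u (hasDerivAt_halfTanh ha hu)).congr_deriv ?_
  have h1 := Real.sqrt_pos.2 (cubic_pos ha hu)
  have h2 : 0 < 1 - halfTanh a u ^ 2 := by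
    rw [sub_pos, sq_lt_one_iff_abs_lt_one]; exact hz
  rw [defFunDeriv]
  field_simp

theorem sinh_defFun {u : ℝ} (hz : |halfTanh a u| < 1) :
    Real.sinh (defFun a u) = u * (Real.exp (jetExponent a u) / (1 - halfTanh a u ^ 2)) := by
  rw [defFun, sinh_logRatio hz, halfTanh]
  ring

theorem defSlope_pos {u : ℝ} (hu : 0 ≤ u) (hz : |halfTanh a u| < 1) : 0 < defSlope a u := by
  have h : 0 ≤ halfTanh a u := by unfold halfTanh; positivity
  exact mul_pos (dslope_logRatio_pos h (abs_lt.1 hz).2) (by positivity)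

/-! ### Expansion at infinity -/

open Asymptotics

/-- The derivative of the difference is `v ^ 3 * κ v` with `κ` continuous at `0`, so the mean value
inequality bounds the difference by a multiple of `u ^ 4`. The form of `κ` comes from `q ^ 2 - 1 = v
^ 2 (1 - M v)` for `q = √(cubic a v)`. -/
theorem isBigO_jetExponent (ha : 0 < a) :
    (fun u => jetExponent a u - (-(u ^ 2 / 4) + (a + a ^ 3) / 6 * u ^ 3)) =O[𝓝 0]
      fun u => u ^ 4 := by
  set M := a + a ^ 3
  let κ : ℝ → ℝ := fun v => (1 - M * v) ^ 2 * (1 + (1 + √(cubic a v))⁻¹) /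
    (2 * (√(cubic a v) * (1 + √(cubic a v))))
  have h0a : (0 : ℝ) < 1 / a := by positivity
  have hκ : ContinuousAt κ 0 := by
    have hs : ContinuousAt (fun v => √(cubic a v)) 0 :=
      (contDiff_cubic (a := a)).continuous.continuousAt.sqrt
    have h1 : √(cubic a 0) = 1 := by simp [cubic]
    refine ContinuousAt.div (ContinuousAt.mul (by fun_prop) (continuousAt_const.add
      ((continuousAt_const.add hs).inv₀ (by change 1 + √(cubic a 0) ≠ 0; rw [h1]; norm_num))))
      (continuousAt_const.mul (hs.mul (continuousAt_const.add hs))) (by rw [h1]; norm_num)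
  obtain ⟨δ, hδ, hball⟩ := Metric.mem_nhds_iff.1
    (Filter.inter_mem (Iio_mem_nhds h0a) (hκ.norm.eventually_lt_const (lt_add_one ‖κ 0‖)))
  have hd : ∀ v ∈ Metric.ball (0 : ℝ) δ, HasDerivAt
      (fun u => jetExponent a u - (-(u ^ 2 / 4) + M / 6 * u ^ 3)) (v ^ 3 * κ v) v := by
    intro v hv
    have hv' : v < 1 / a := (hball hv).1
    have hp := cubic_pos ha hv'
    have h0 := Real.sqrt_pos.2 hp
    have h2 := Real.sq_sqrt hp.le
    refine ((hasDerivAt_jetExponent ha hv').sub ((((hasDerivAt_pow 2 v).div_const 4).neg).add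
      ((hasDerivAt_pow 3 v).const_mul (M / 6)))).congr_deriv ?_
    simp only [jetIntegrand, κ]
    generalize √(cubic a v) = q at h0 h2
    rw [cubic] at h2
    change q ^ 2 = 1 + v ^ 2 - M * v ^ 3 at h2
    change -(v * (1 - M * v)) / (q * (1 + q)) - _ = _
    have h3 : v ^ 3 * (1 - M * v) ^ 2 = v * (1 - M * v) * (q ^ 2 - 1) := by rw [h2]; ring
    have h4 : v ^ 3 * ((1 - M * v) ^ 2 * (1 + (1 + q)⁻¹) / (2 * (q * (1 + q)))) =
        v * (1 - M * v) * (q ^ 2 - 1) * (1 + (1 + q)⁻¹) / (2 * (q * (1 + q))) := by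
      rw [← h3]; ring
    rw [h4]
    norm_num
    field_simp
    ring
  refine IsBigO.of_bound (‖κ 0‖ + 1) ?_
  filter_upwards [Metric.ball_mem_nhds 0 hδ] with u hu
  have hsub : Metric.closedBall (0 : ℝ) |u| ⊆ Metric.ball 0 δ :=
    Metric.closedBall_subset_ball (by simpa using hu)
  have h := (convex_closedBall (0 : ℝ) |u|).norm_image_sub_le_of_norm_hasDerivWithin_le
    (fun v hv => (hd v (hsub hv)).hasDerivWithinAt) (C := |u| ^ 3 * (‖κ 0‖ + 1)) (fun v hv => by
      rw [norm_mul, norm_pow, Real.norm_eq_abs]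
      have h1 : |v| ≤ |u| := by simpa using hv
      exact mul_le_mul (pow_le_pow_left₀ (abs_nonneg v) h1 3) (le_of_lt (hball (hsub hv)).2)
        (norm_nonneg _) (by positivity)) (Metric.mem_closedBall_self (abs_nonneg u))
    (show u ∈ _ by simp)
  simp only [jetExponent_zero, sub_zero, Real.norm_eq_abs] at h
  norm_num at h
  rw [Real.norm_eq_abs, Real.norm_eq_abs, Real.norm_eq_abs, abs_pow]
  calc _ ≤ _ := h
    _ = _ := by ring

theorem isBigO_pow_of_le {m n : ℕ} (h : m ≤ n) :
    (fun u : ℝ => u ^ n) =O[𝓝 0] fun u : ℝ => u ^ m := by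
  rcases h.eq_or_lt with rfl | h
  · exact isBigO_refl _ _
  · exact (isLittleO_pow_pow h).isBigO

theorem isBigO_one_of_continuousAt {f : ℝ → ℝ} (hf : ContinuousAt f 0) :
    f =O[𝓝 0] fun _ => (1 : ℝ) :=
  hf.tendsto.isBigO_one ℝ

theorem isBigO_exp_jetExponent (ha : 0 < a) :
    (fun u => Real.exp (jetExponent a u) - (1 - u ^ 2 / 4 + (a + a ^ 3) / 6 * u ^ 3)) =O[𝓝 0]
      fun u => u ^ 4 := by
  have hJ := isBigO_jetExponent ha
  have hJ2 : jetExponent a =O[𝓝 0] fun u => u ^ 2 := by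
    have h1 : (fun u : ℝ => -(u ^ 2 / 4) + (a + a ^ 3) / 6 * u ^ 3) =O[𝓝 0] fun u => u ^ 2 := by
      have h2 : (fun u : ℝ => u ^ 2 * (-(1 / 4) + (a + a ^ 3) / 6 * u)) =O[𝓝 0]
          fun u => u ^ 2 * 1 :=
        (isBigO_refl _ _).mul (isBigO_one_of_continuousAt (by fun_prop))
      simp only [mul_one] at h2
      exact h2.congr_left fun u => by ring
    exact ((hJ.trans (isBigO_pow_of_le (by norm_num))).add h1).congr_left fun u => by ring
  have hcont : Tendsto (jetExponent a) (𝓝 0) (𝓝 0) := by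
    have := (hasDerivAt_jetExponent ha (u := 0) (by positivity)).continuousAt.tendsto
    rwa [jetExponent_zero] at this
  have h1 := ((Real.exp_sub_sum_range_isBigO_pow 2).comp_tendsto hcont).trans
    ((hJ2.pow 2).congr_right (g₂ := fun u => u ^ 4) fun u => by ring)
  refine (h1.add hJ).congr_left fun u => ?_
  simp [Finset.sum_range_succ]
  ring

/-- The squared quotient is `(sinh t / u) ^ 2 = R ^ 2 sinh ^ 2 t`. The terms of order `u ^ 2` in the
exponential and in `1 / (1 - z ^ 2)` cancel, leaving the mass term at order three. -/
theorem isBigO_expansion (ha : 0 < a) :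
    (fun u => (Real.exp (jetExponent a u) / (1 - halfTanh a u ^ 2)) ^ 2 - 1 -
      (a + a ^ 3) / 3 * defFun a u ^ 3) =O[𝓝 0] fun u => u ^ 4 := by
  have h0a : (0 : ℝ) < 1 / a := by positivity
  have hz0 : |halfTanh a 0| < 1 := by simp [halfTanh_zero]
  have hE := isBigO_exp_jetExponent ha
  have cE : ContinuousAt (fun u => Real.exp (jetExponent a u)) 0 :=
    (contDiffAt_jetExponent ha h0a).continuousAt.rexp
  have cz : ContinuousAt (halfTanh a) 0 := (contDiffAt_halfTanh ha h0a).continuousAt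
  have cq : ContinuousAt (fun u => (1 - halfTanh a u ^ 2)⁻¹) 0 :=
    (continuousAt_const.sub (cz.pow 2)).inv₀ (by simp [halfTanh_zero])
  have hE1 : (fun u => Real.exp (jetExponent a u) - 1) =O[𝓝 0] fun u => u ^ 2 := by
    have h2 : (fun u : ℝ => u ^ 2 * (-(1 / 4) + (a + a ^ 3) / 6 * u)) =O[𝓝 0]
        fun u => u ^ 2 * 1 :=
      (isBigO_refl _ _).mul (isBigO_one_of_continuousAt (by fun_prop))
    simp only [mul_one] at h2
    exact ((hE.trans (isBigO_pow_of_le (by norm_num))).add h2).congr_left fun u => by ring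
  have hz : (fun u => halfTanh a u ^ 2 - u ^ 2 / 4) =O[𝓝 0] fun u => u ^ 4 := by
    have h2 : (fun u : ℝ => u ^ 2 * ((Real.exp (jetExponent a u) - 1) *
        ((Real.exp (jetExponent a u) + 1) / 4))) =O[𝓝 0] fun u => u ^ 2 * (u ^ 2 * 1) :=
      (isBigO_refl _ _).mul (hE1.mul (isBigO_one_of_continuousAt
        ((cE.add continuousAt_const).div_const 4)))
    exact (h2.congr_right fun u => by ring).congr_left fun u => by rw [halfTanh]; ring
  have hz3 : (fun u => (a + a ^ 3) / 6 * u ^ 3 * halfTanh a u ^ 2) =O[𝓝 0] fun u => u ^ 4 := by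
    have h2 : (fun u : ℝ => u ^ 4 * ((a + a ^ 3) / 24 * u * Real.exp (jetExponent a u) ^ 2)) =O[𝓝 0]
        fun u => u ^ 4 * 1 :=
      (isBigO_refl _ _).mul (isBigO_one_of_continuousAt
        ((continuousAt_const.mul continuousAt_id).mul (cE.pow 2)))
    simp only [mul_one] at h2
    exact h2.congr_left fun u => by rw [halfTanh]; ring
  have cF : ContinuousAt (fun u => Real.exp (jetExponent a u) / (1 - halfTanh a u ^ 2)) 0 :=
    cE.mul cq
  have hne : ∀ᶠ u in 𝓝 (0 : ℝ), 1 - halfTanh a u ^ 2 ≠ 0 :=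
    (continuousAt_const.sub (cz.pow 2)).eventually_ne (by simp [halfTanh_zero])
  -- Multiplied by `1 - z ^ 2`, the difference is the sum of the three errors estimated in `hE`,
  -- `hz` and `hz3`.
  have hF : (fun u => Real.exp (jetExponent a u) / (1 - halfTanh a u ^ 2) -
      (1 + (a + a ^ 3) / 6 * u ^ 3)) =O[𝓝 0] fun u => u ^ 4 := by
    have h2 := ((hE.add hz).add hz3).mul (isBigO_one_of_continuousAt cq)
    simp only [mul_one] at h2
    refine h2.congr' ?_ EventuallyEq.rfl
    filter_upwards [hne] with u hu
    field_simp
    ring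
  have hF2 : (fun u => (Real.exp (jetExponent a u) / (1 - halfTanh a u ^ 2)) ^ 2 - 1 -
      (a + a ^ 3) / 3 * u ^ 3) =O[𝓝 0] fun u => u ^ 4 := by
    have h2 := hF.mul (isBigO_one_of_continuousAt (f := fun u =>
      Real.exp (jetExponent a u) / (1 - halfTanh a u ^ 2) + (1 + (a + a ^ 3) / 6 * u ^ 3))
      (cF.add (by fun_prop)))
    have h3 : (fun u : ℝ => u ^ 4 * ((a + a ^ 3) ^ 2 / 36 * u ^ 2)) =O[𝓝 0] fun u => u ^ 4 * 1 :=
      (isBigO_refl _ _).mul (isBigO_one_of_continuousAt (by fun_prop))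
    simp only [mul_one] at h2 h3
    exact (h2.add h3).congr_left fun u => by ring
  -- Since `t = u * defSlope a u` with `defSlope a u = 1 + O(u)`, replacing `u ^ 3` by `t ^ 3` costs
  -- only `O(u ^ 4)`.
  have hT : (fun u => (a + a ^ 3) / 3 * (defFun a u ^ 3 - u ^ 3)) =O[𝓝 0] fun u => u ^ 4 := by
    have cm := contDiffAt_defSlope ha h0a hz0
    have h1 := (cm.differentiableAt (by simp)).isBigO_sub
    simp only [defSlope_zero, sub_zero] at h1
    have h2 : (fun u : ℝ => u ^ 3 * ((defSlope a u - 1) * ((a + a ^ 3) / 3 *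
        (defSlope a u ^ 2 + defSlope a u + 1)))) =O[𝓝 0] fun u => u ^ 3 * (u * 1) :=
      (isBigO_refl _ _).mul (h1.mul (isBigO_one_of_continuousAt (continuousAt_const.mul
        (((cm.continuousAt.pow 2).add cm.continuousAt).add continuousAt_const))))
    exact (h2.congr_right fun u => by ring).congr_left fun u => by rw [defFun_eq]; ring
  exact (hF2.sub hT).congr_left fun u => by ring

end


/-! ### The boundary defining function and the collars -/

section

variable {a δ : ℝ}

/-- The geodesic defining function is a diffeomorphism on `(-3δ, 3δ)`. -/
structure IsCollarWidth (a δ : ℝ) : Prop where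
  pos : 0 < δ
  lt_inv : ∀ u ∈ Ioo (-(3 * δ)) (3 * δ), u < 1 / a
  abs_halfTanh : ∀ u ∈ Ioo (-(3 * δ)) (3 * δ), |halfTanh a u| < 1

theorem exists_isCollarWidth (ha : 0 < a) : ∃ δ, IsCollarWidth a δ := by
  have h0a : (0 : ℝ) < 1 / a := by positivity
  have cz := (contDiffAt_halfTanh ha h0a).continuousAt.abs
  have h1 : ∀ᶠ u in 𝓝 (0 : ℝ), u < 1 / a ∧ |halfTanh a u| < 1 :=
    (eventually_lt_nhds h0a).and (cz.eventually_lt_const (by simp [halfTanh_zero]))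
  obtain ⟨η, hη, h2⟩ := Metric.eventually_nhds_iff.1 h1
  have h3 : ∀ u ∈ Ioo (-(3 * (η / 3))) (3 * (η / 3)), u < 1 / a ∧ |halfTanh a u| < 1 :=
    fun u hu => h2 (by
      rw [Real.dist_eq, sub_zero, abs_lt]
      constructor <;> linarith [hu.1, hu.2])
  exact ⟨η / 3, by positivity, fun u hu => (h3 u hu).1, fun u hu => (h3 u hu).2⟩

/-- A cutoff function that is `1` on `(-∞, δ]` and `0` on `[2δ, ∞)`. -/
noncomputable def cutoff (δ u : ℝ) : ℝ := Real.smoothTransition (2 - u / δ)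

/-- The boundary defining function divided by `u`: it is `defSlope a u` for `u ≤ δ`. -/
noncomputable def bdrySlope (a δ u : ℝ) : ℝ :=
  cutoff δ u * defSlope a u + (1 - cutoff δ u)

theorem bdrySlope_of_le (hδ : 0 < δ) {u : ℝ} (hu : u ≤ δ) : bdrySlope a δ u = defSlope a u := by
  have : cutoff δ u = 1 := Real.smoothTransition.one_of_one_le (by
    have := (div_le_one hδ).2 hu
    linarith)
  rw [bdrySlope, this]
  ring

theorem bdrySlope_of_ge (hδ : 0 < δ) {u : ℝ} (hu : 2 * δ ≤ u) : bdrySlope a δ u = 1 := by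
  have : cutoff δ u = 0 := Real.smoothTransition.zero_of_nonpos (by
    have := (le_div_iff₀ hδ).2 hu
    linarith)
  rw [bdrySlope, this]
  ring

/-- For `u ≥ 3 * δ` nothing is known about `defSlope`, but there `bdrySlope` is locally the constant
`1`. The gap between `2 * δ` and `3 * δ` provides the overlap. -/
theorem contDiffAt_bdrySlope (ha : 0 < a) (h : IsCollarWidth a δ) {u : ℝ} (hu : -(3 * δ) < u) :
    ContDiffAt ℝ ∞ (bdrySlope a δ) u := by
  have hδ := h.pos
  rcases lt_or_ge u (3 * δ) with h1 | h1
  · have hc : ContDiffAt ℝ ∞ (cutoff δ) u :=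
      Real.smoothTransition.contDiff.contDiffAt.comp u
        (contDiffAt_const.sub (contDiffAt_id.div_const δ))
    exact (hc.mul (contDiffAt_defSlope ha (h.lt_inv u ⟨hu, h1⟩) (h.abs_halfTanh u ⟨hu, h1⟩))).add
      (contDiffAt_const.sub hc)
  · refine (contDiffAt_const (c := (1 : ℝ))).congr_of_eventuallyEq ?_
    filter_upwards [lt_mem_nhds (show 2 * δ < u by linarith)] with v hv
    exact bdrySlope_of_ge hδ hv.le

theorem bdrySlope_pos (h : IsCollarWidth a δ) {u : ℝ} (hu : 0 ≤ u) : 0 < bdrySlope a δ u := by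
  have hδ := h.pos
  rcases lt_or_ge u (2 * δ) with h1 | h1
  · have h2 := defSlope_pos hu (h.abs_halfTanh u ⟨by linarith, by linarith⟩)
    have h3 : 0 ≤ cutoff δ u := Real.smoothTransition.nonneg _
    have h4 : cutoff δ u ≤ 1 := Real.smoothTransition.le_one _
    rw [bdrySlope]
    rcases h3.eq_or_lt with h5 | h5
    · rw [← h5]; norm_num
    · nlinarith [mul_pos h5 h2]
  · rw [bdrySlope_of_ge hδ h1]; exact one_pos

theorem mul_bdrySlope_of_le (hδ : 0 < δ) {u : ℝ} (hu : u ≤ δ) :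
    u * bdrySlope a δ u = defFun a u := by
  rw [bdrySlope_of_le hδ hu, defFun_eq]

theorem defFun_nonneg_iff (h : IsCollarWidth a δ) {u : ℝ} (ha : 0 < a) (hu : u ∈ Ioo (-δ) δ) :
    0 ≤ defFun a u ↔ 0 ≤ u := by
  have hδ := h.pos
  have hmono : StrictMonoOn (defFun a) (Ioo (-δ) δ) := by
    have hd : ∀ v ∈ Ioo (-δ) δ, HasDerivAt (defFun a) (defFunDeriv a v) v ∧ 0 < defFunDeriv a v :=
      fun v hv => by
        have hv' : v ∈ Ioo (-(3 * δ)) (3 * δ) := ⟨by linarith [hv.1], by linarith [hv.2]⟩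
        exact ⟨hasDerivAt_defFun ha (h.lt_inv v hv') (h.abs_halfTanh v hv'),
          defFunDeriv_pos ha (h.lt_inv v hv') (h.abs_halfTanh v hv')⟩
    refine strictMonoOn_of_deriv_pos (convex_Ioo _ _)
      (fun v hv => (hd v hv).1.continuousAt.continuousWithinAt) fun v hv => ?_
    rw [interior_Ioo] at hv
    rw [(hd v hv).1.deriv]
    exact (hd v hv).2
  have := hmono.le_iff_le (a := 0) (b := u) ⟨by linarith, hδ⟩ hu
  rwa [defFun_zero] at this

/-- The inverse of the geodesic defining function near the boundary. -/
theorem exists_inverse_defFun (ha : 0 < a) (h : IsCollarWidth a δ) :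
    ∃ ε > 0, ∃ U : ℝ → ℝ, ∃ C : ℝ, U 0 = 0 ∧ ∀ t ∈ Ioo (-ε) ε, U t ∈ Ioo (-δ) δ ∧
      defFun a (U t) = t ∧ ContDiffAt ℝ ∞ U t ∧ HasDerivAt U (defFunDeriv a (U t))⁻¹ t ∧
      |(Real.exp (jetExponent a (U t)) / (1 - halfTanh a (U t) ^ 2)) ^ 2 - 1 -
        (a + a ^ 3) / 3 * t ^ 3| ≤ C * t ^ 4 := by
  have hδ := h.pos
  have hgood : ∀ v ∈ Ioo (-δ) δ, v < 1 / a ∧ |halfTanh a v| < 1 := fun v hv => by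
    have hv' : v ∈ Ioo (-(3 * δ)) (3 * δ) := ⟨by linarith [hv.1], by linarith [hv.2]⟩
    exact ⟨h.lt_inv v hv', h.abs_halfTanh v hv'⟩
  have h0 : (0 : ℝ) ∈ Ioo (-δ) δ := ⟨by linarith, hδ⟩
  have hd : ∀ v ∈ Ioo (-δ) δ, HasDerivAt (defFun a) (defFunDeriv a v) v := fun v hv =>
    hasDerivAt_defFun ha (hgood v hv).1 (hgood v hv).2
  have hne : ∀ v ∈ Ioo (-δ) δ, defFunDeriv a v ≠ 0 := fun v hv =>
    (defFunDeriv_pos ha (hgood v hv).1 (hgood v hv).2).ne'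
  have hcd : ∀ v ∈ Ioo (-δ) δ, ContDiffAt ℝ ∞ (defFun a) v := fun v hv =>
    contDiffAt_defFun ha (hgood v hv).1 (hgood v hv).2
  let e := (hcd 0 h0).toOpenPartialHomeomorph (defFun a)
    ((hd 0 h0).hasFDerivAt_equiv (hne 0 h0)) (by simp)
  have he : ∀ v, e v = defFun a v := fun v => rfl
  have h0t : (0 : ℝ) ∈ e.target := by
    have := (hcd 0 h0).image_mem_toOpenPartialHomeomorph_target
      ((hd 0 h0).hasFDerivAt_equiv (hne 0 h0)) (by simp)
    rwa [defFun_zero] at this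
  have h0s : (0 : ℝ) ∈ e.source := (hcd 0 h0).mem_toOpenPartialHomeomorph_source
      ((hd 0 h0).hasFDerivAt_equiv (hne 0 h0)) (by simp)
  have hU0 : e.symm 0 = 0 := by
    have := e.left_inv h0s
    rwa [he, defFun_zero] at this
  obtain ⟨C, hC, hbig⟩ := (isBigO_expansion ha).exists_pos
  have hsl : ∀ᶠ u in 𝓝 (0 : ℝ), 1 / 2 < defSlope a u :=
    ((contDiffAt_defSlope ha (hgood 0 h0).1 (hgood 0 h0).2).continuousAt).eventually_const_lt (by
      rw [defSlope_zero]; norm_num)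
  have hev : ∀ᶠ u in 𝓝 (0 : ℝ), u ∈ Ioo (-δ) δ ∧
      |(Real.exp (jetExponent a u) / (1 - halfTanh a u ^ 2)) ^ 2 - 1 -
        (a + a ^ 3) / 3 * defFun a u ^ 3| ≤ 16 * C * defFun a u ^ 4 := by
    filter_upwards [Ioo_mem_nhds h0.1 h0.2, hbig.bound, hsl] with u h1 h2 h3
    refine ⟨h1, ?_⟩
    rw [Real.norm_eq_abs, Real.norm_eq_abs, abs_of_nonneg (by positivity : 0 ≤ u ^ 4)] at h2
    refine h2.trans ?_
    rw [defFun_eq a u, mul_pow]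
    -- As `defSlope a u > 1 / 2`, one has `u ^ 4 ≤ 16 * defFun a u ^ 4`, whence the constant `16 *
    -- C`.
    have h4 : (1 / 2 : ℝ) ^ 4 ≤ defSlope a u ^ 4 := pow_le_pow_left₀ (by norm_num) h3.le 4
    have h5 : 0 ≤ C * u ^ 4 := by positivity
    nlinarith
  have hsymm : Tendsto e.symm (𝓝 0) (𝓝 0) := by
    have := (e.continuousAt_symm h0t).tendsto
    rwa [hU0] at this
  obtain ⟨ε, hε, hball⟩ := Metric.eventually_nhds_iff.1
    ((hsymm.eventually hev).and (e.open_target.mem_nhds h0t))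
  refine ⟨ε, hε, e.symm, 16 * C, hU0, fun t ht => ?_⟩
  obtain ⟨⟨h1, h2⟩, h3⟩ := hball (y := t) (by
    rw [Real.dist_eq, sub_zero, abs_lt]; exact ht)
  have h3' : t ∈ e.target := h3
  have h4 : defFun a (e.symm t) = t := by
    rw [← he]; exact e.right_inv h3'
  rw [h4] at h2
  have hs : ContDiffAt ℝ ∞ e.symm t :=
    e.contDiffAt_symm_deriv (hne _ h1) h3' (hd _ h1) (hcd _ h1)
  exact ⟨h1, h4, hs, HasDerivAt.of_local_left_inverse (f := defFun a) hs.continuousAt (hd _ h1)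
    (hne _ h1) (by
      filter_upwards [e.open_target.mem_nhds h3'] with x hx
      rw [← he]; exact e.right_inv hx), h2⟩

/-- The inverse of the area radius, which is smooth across the boundary. -/
noncomputable def invRadius (a s : ℝ) : ℝ := (1 - arcInv a s ^ 2) / a

theorem areaRadius_eq_inv (a s : ℝ) : areaRadius a s = (invRadius a s)⁻¹ := by
  rw [areaRadius, invRadius, inv_div]

theorem contDiffAt_invRadius (ha : 0 < a) {s : ℝ} (hs : s ∈ range (arc a)) :
    ContDiffAt ℝ ∞ (invRadius a) s :=
  (contDiffAt_const.sub ((contDiffAt_arcInv ha hs).pow 2)).div_const a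

theorem hasDerivAt_invRadius (ha : 0 < a) {s : ℝ} (hs : s ∈ range (arc a)) :
    HasDerivAt (invRadius a) (-(arcInv a s * √(quartic a (arcInv a s)) / a)) s := by
  refine ((((hasDerivAt_arcInv ha hs).pow 2).const_sub 1).div_const a).congr_deriv ?_
  norm_num
  field_simp

/-- The Euclidean radius of the points of the collar of one end, as a function of the geodesic
defining function. -/
theorem exists_collarRadius (ha : 0 < a) (h : IsCollarWidth a δ) {ς : ℝ} (hς : ς = 1 ∨ ς = -1) :
    ∃ ε > 0, ∃ ξ ξ' : ℝ → ℝ, ∃ C : ℝ, ξ 0 = Real.exp (arc a ς) ∧ ∀ t ∈ Ioo (-ε) ε,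
      0 < ξ t ∧ ContDiffAt ℝ ∞ ξ t ∧ (ξ t ∈ Icc (Real.exp (2 * arc a 0)) 1 ↔ 0 ≤ t) ∧
      invRadius a (Real.log (ξ t)) * bdrySlope a δ (invRadius a (Real.log (ξ t))) = t ∧
      HasDerivAt ξ (ξ' t) t ∧ ξ' t ≠ 0 ∧
      (0 < t → Real.log (ξ t) ∈ logRange a ∧
        (areaRadius a (Real.log (ξ t)) * (ξ' t / ξ t)) ^ 2 = (Real.sinh t ^ 2)⁻¹ ∧
        |Real.sinh t ^ 2 * areaRadius a (Real.log (ξ t)) ^ 2 - 1 - (a + a ^ 3) / 3 * t ^ 3| ≤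
          C * t ^ 4) := by
  have hδ := h.pos
  have hς2 : ς ^ 2 = 1 := by rcases hς with rfl | rfl <;> norm_num
  have hς0 : ς ≠ 0 := by rintro rfl; norm_num at hς2
  obtain ⟨ε, hε, U, C, hU0, hU⟩ := exists_inverse_defFun ha h
  -- Solving `u = (1 - y ^ 2) / a` gives `y = ς √(1 - a u)`, where `ς` selects the end; the second
  -- function is the chain-rule derivative.
  refine ⟨ε, hε, fun t => Real.exp (arc a (ς * √(1 - a * U t))), fun t =>
    Real.exp (arc a (ς * √(1 - a * U t))) * (2 / √(quartic a (ς * √(1 - a * U t))) *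
      (ς * (-(a * (defFunDeriv a (U t))⁻¹) / (2 * √(1 - a * U t))))), C, by simp [hU0], ?_⟩
  intro t ht
  obtain ⟨hmem, hdef, hcd, hdU, hexp⟩ := hU t ht
  have hmem3 : U t ∈ Ioo (-(3 * δ)) (3 * δ) := ⟨by linarith [hmem.1], by linarith [hmem.2]⟩
  have hlt := h.lt_inv _ hmem3
  have hz := h.abs_halfTanh _ hmem3
  have h1 : 0 < 1 - a * U t := by rw [lt_div_iff₀ ha] at hlt; linarith
  have hq1 := Real.sqrt_pos.2 h1
  have hq2 := Real.sq_sqrt h1.le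
  have hDpos := defFunDeriv_pos ha hlt hz
  have hy2 : (ς * √(1 - a * U t)) ^ 2 = 1 - a * U t := by rw [mul_pow, hς2, one_mul, hq2]
  have hinv : invRadius a (Real.log (Real.exp (arc a (ς * √(1 - a * U t))))) = U t := by
    rw [Real.log_exp, invRadius, arcInv_arc ha, hy2]
    field_simp
    ring
  have hiff : 0 ≤ t ↔ 0 ≤ U t := by
    rw [← defFun_nonneg_iff h ha hmem, hdef]
  refine ⟨Real.exp_pos _, ?_, ?_, ?_, ?_, ?_, ?_⟩
  · exact ((contDiff_arc ha).contDiffAt.comp t (contDiffAt_const.mul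
      ((contDiffAt_const.sub (contDiffAt_const.mul hcd)).sqrt h1.ne'))).exp
  -- Lying in the closed shell means `|y| ≤ 1`, which is `U t ≥ 0` and hence `t ≥ 0`. Negative `t`
  -- parametrise points beyond the boundary.
  · have h2 : Real.exp (arc a (ς * √(1 - a * U t))) ∈ Icc (Real.exp (2 * arc a 0)) 1 ↔
        ς * √(1 - a * U t) ∈ Icc (-1 : ℝ) 1 := by
      rw [mem_Icc, mem_Icc, Real.exp_le_exp, Real.exp_le_one_iff, ← arc_neg_one ha,
        (strictMono_arc ha).le_iff_le]
      conv_lhs => rw [← arc_one (a := a), (strictMono_arc ha).le_iff_le]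
    simp only
    rw [h2, hiff, mem_Icc, ← abs_le, ← sq_le_one_iff_abs_le_one, hy2]
    constructor
    · intro h3
      exact le_of_mul_le_mul_left (a := a) (by linarith) ha
    · intro h3
      nlinarith
  · simp only
    rw [hinv, mul_bdrySlope_of_le hδ hmem.2.le, hdef]
  · have h3 := (((hdU.const_mul a).const_sub 1).sqrt h1.ne').const_mul ς
    exact ((hasDerivAt_arc ha _).comp t h3).exp
  · have := arcIntegrand_pos ha (ς * √(1 - a * U t))
    simp only
    refine mul_ne_zero (Real.exp_pos _).ne' (mul_ne_zero this.ne' (mul_ne_zero hς0 ?_))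
    exact div_ne_zero (neg_ne_zero.2 (by positivity)) (by positivity)
  · intro ht0
    have hU0' : 0 ≤ U t := hiff.1 ht0.le
    have hUpos : 0 < U t := hU0'.lt_of_ne fun h3 => by
      rw [← h3, defFun_zero] at hdef
      exact ht0.ne hdef
    have hsinh : Real.sinh t = U t * (Real.exp (jetExponent a (U t)) /
        (1 - halfTanh a (U t) ^ 2)) := by
      rw [← sinh_defFun hz, hdef]
    have hz2 : 0 < 1 - halfTanh a (U t) ^ 2 := by
      rw [sub_pos, sq_lt_one_iff_abs_lt_one]; exact hz
    simp only
    rw [areaRadius_eq_inv, hinv]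
    refine ⟨?_, ?_, ?_⟩
    · rw [Real.log_exp, logRange_eq_image ha]
      refine ⟨_, ?_, rfl⟩
      rw [mem_Ioo, ← abs_lt, ← sq_lt_one_iff_abs_lt_one, hy2]
      nlinarith
    · have hp := cubic_pos ha hlt
      have hq := quartic_pos ha (ς * √(1 - a * U t))
      rw [hsinh, defFunDeriv]
      have hsp := Real.sqrt_pos.2 hp
      have hsq := Real.sqrt_pos.2 hq
      have hsp2 := Real.sq_sqrt hp.le
      have hsq2 := Real.sq_sqrt hq.le
      have he := Real.exp_pos (jetExponent a (U t))
      have he2 := Real.exp_pos (arc a (ς * √(1 - a * U t)))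
      rw [mul_div_cancel_left₀ _ he2.ne']
      -- Two expressions for `R' ^ 2 / R ^ 4`, up to the factor `a ^ 2`: one in `y`, the other in
      -- `u`.
      have hrel : √(1 - a * U t) ^ 2 * √(quartic a (ς * √(1 - a * U t))) ^ 2 =
          a ^ 2 * √(cubic a (U t)) ^ 2 := by
        rw [hq2, hsq2, hsp2, quartic, hy2, cubic]; ring
      generalize √(cubic a (U t)) = p at *
      generalize √(quartic a (ς * √(1 - a * U t))) = q at *
      generalize √(1 - a * U t) = w at *
      field_simp
      rw [hς2]
      linear_combination -hrel
    · have h4 : Real.sinh t ^ 2 * (U t)⁻¹ ^ 2 =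
          (Real.exp (jetExponent a (U t)) / (1 - halfTanh a (U t) ^ 2)) ^ 2 := by
        rw [hsinh]; field_simp
      rw [h4]
      exact hexp

end


/-! ### Spherical shells -/

/-- The closed spherical shell between the radii `r` and `1`. -/
def shell (r : ℝ) : Set E3 := {x | ‖x‖ ∈ Icc r 1}

section

variable {r : ℝ}

theorem isCompact_shell : IsCompact (shell r) := by
  refine Metric.isCompact_of_isClosed_isBounded (isClosed_Icc.preimage continuous_norm) ?_
  exact (Metric.isBounded_closedBall (x := (0 : E3)) (r := 1)).subset fun x hx => by
    simpa using hx.2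

theorem interior_shell (hr : 0 < r) : interior (shell r) = {x : E3 | ‖x‖ ∈ Ioo r 1} := by
  have h : shell r = Metric.closedBall (0 : E3) 1 ∩ (Metric.ball 0 r)ᶜ := by
    ext x
    simp [shell, and_comm]
  rw [h, interior_inter, interior_closedBall _ one_ne_zero, interior_compl,
    closure_ball _ hr.ne']
  ext x
  simp [and_comm]

theorem frontier_shell (hr : 0 < r) (hr1 : r < 1) :
    frontier (shell r) = Metric.sphere 0 r ∪ Metric.sphere 0 1 := by
  have hc : IsClosed (shell r) := isCompact_shell.isClosed
  rw [frontier, hc.closure_eq, interior_shell hr]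
  ext x
  simp only [shell, Set.mem_sdiff, mem_ofPred_eq, mem_Icc, mem_Ioo, mem_union,
    mem_sphere_zero_iff_norm]
  constructor
  · rintro ⟨⟨h1, h2⟩, h3⟩
    by_contra! h4
    exact h3 ⟨h1.lt_of_ne' h4.1, h2.lt_of_ne h4.2⟩
  · rintro (h | h) <;> rw [h] <;> simp [hr1.le]

theorem fderiv_norm_sq_ne_zero {p : E3} (hp : p ≠ 0) :
    fderiv ℝ (fun x : E3 => ‖x‖ ^ 2) p ≠ 0 := by
  intro h
  have h1 := DFunLike.congr_fun ((hasStrictFDerivAt_norm_sq p).hasFDerivAt.fderiv.symm.trans h) p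
  simp at h1
  exact hp h1

theorem isCompactSmoothRegion_shell (hr : 0 < r) (hr1 : r < 1) :
    IsCompactSmoothRegion (shell r) := by
  refine ⟨isCompact_shell, fun p hp => ?_⟩
  rw [frontier_shell hr hr1] at hp
  have hd : DifferentiableAt ℝ (fun x : E3 => ‖x‖ ^ 2) p :=
    (hasStrictFDerivAt_norm_sq p).hasFDerivAt.differentiableAt
  have hp0 : p ≠ 0 := by
    rintro rfl
    simp [hr.ne] at hp
  rcases hp with hp | hp <;> rw [mem_sphere_zero_iff_norm] at hp
  · refine ⟨{x | ‖x‖ < 1}, isOpen_lt continuous_norm continuous_const, by simp [hp, hr1],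
      fun x => ‖x‖ ^ 2 - r ^ 2, ((contDiff_norm_sq ℝ).sub contDiff_const).contDiffOn, ?_, ?_⟩
    · rw [fderiv_sub_const]
      exact fderiv_norm_sq_ne_zero hp0
    · intro x hx
      have hx' : ‖x‖ < 1 := hx
      rw [sub_nonneg, sq_le_sq₀ hr.le (norm_nonneg x)]
      exact ⟨fun h => h.1, fun h => ⟨h, hx'.le⟩⟩
  · refine ⟨{x | r < ‖x‖}, isOpen_lt continuous_const continuous_norm, by simp [hp, hr1],
      fun x => 1 - ‖x‖ ^ 2, (contDiff_const.sub (contDiff_norm_sq ℝ)).contDiffOn, ?_, ?_⟩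
    · rw [fderiv_const_sub, neg_ne_zero]
      exact fderiv_norm_sq_ne_zero hp0
    · intro x hx
      have hx' : r < ‖x‖ := hx
      rw [sub_nonneg, sq_le_one_iff₀ (norm_nonneg x)]
      exact ⟨fun h => h.2, fun h => ⟨hx'.le, h⟩⟩

/-- On the boundary the norm takes only the values `r` and `1`, so a connected subset cannot meet
both spheres. Each sphere is connected because the dimension exceeds one. -/
theorem connectedComponentIn_shell (hr : 0 < r) (hr1 : r < 1) {p : E3} {q : ℝ}
    (hq : q = r ∨ q = 1) (hp : p ∈ Metric.sphere (0 : E3) q) :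
    connectedComponentIn (frontier (shell r)) p = Metric.sphere 0 q := by
  have hfr := frontier_shell hr hr1
  have hsub : Metric.sphere (0 : E3) q ⊆ frontier (shell r) := by
    rw [hfr]
    rcases hq with rfl | rfl
    · exact subset_union_left
    · exact subset_union_right
  refine Subset.antisymm (fun x hx => ?_) ?_
  · have hpc : IsPreconnected (connectedComponentIn (frontier (shell r)) p) :=
      isPreconnected_connectedComponentIn
    have himg := hpc.image (fun x : E3 => ‖x‖) continuous_norm.continuousOn
    have hval : ∀ y ∈ connectedComponentIn (frontier (shell r)) p, ‖y‖ = r ∨ ‖y‖ = 1 :=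
      fun y hy => by
        have := connectedComponentIn_subset _ _ hy
        rw [hfr] at this
        simpa using this
    have hpm := mem_connectedComponentIn (hsub hp)
    have hoc := himg.ordConnected
    have key : ∀ y z, y ∈ connectedComponentIn (frontier (shell r)) p →
        z ∈ connectedComponentIn (frontier (shell r)) p → ‖y‖ = r → ‖z‖ = 1 → False := by
      intro y z hy hz hyr hz1
      have h1 := hoc.out (mem_image_of_mem _ hy) (mem_image_of_mem _ hz)
        (show (r + 1) / 2 ∈ Icc ‖y‖ ‖z‖ by rw [hyr, hz1]; constructor <;> linarith)
      obtain ⟨w, hw, hw2⟩ := h1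
      simp only at hw2
      rcases hval w hw with h | h <;> linarith
    rw [mem_sphere_zero_iff_norm] at hp ⊢
    rcases hval x hx with h | h <;> rcases hq with rfl | rfl
    · exact h
    · exact (key x p hx hpm h hp).elim
    · exact (key p x hpm hx hp h).elim
    · exact h
  · have hrank : 1 < Module.rank ℝ E3 := by
      rw [← Module.finrank_eq_rank, finrank_euclideanSpace_fin]; norm_num
    exact (isPreconnected_sphere hrank 0 q).subset_connectedComponentIn hp hsub

/-- Needed to identify `fderivWithin` with `fderiv` on the boundary. Near the inner sphere the shell
is not convex, but it contains a piece of the half-space `⟨p, x⟩ ≥ r ^ 2`, by Cauchy-Schwarz. -/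
theorem uniqueDiffWithinAt_shell (hr : 0 < r) (hr1 : r < 1) {p : E3}
    (hp : p ∈ frontier (shell r)) : UniqueDiffWithinAt ℝ (shell r) p := by
  rw [frontier_shell hr hr1] at hp
  rcases hp with hp | hp <;> rw [mem_sphere_zero_iff_norm] at hp
  · have hV : {x : E3 | ‖x‖ < 1} ∈ 𝓝 p :=
      (isOpen_lt continuous_norm continuous_const).mem_nhds (by simp [hp, hr1])
    have hconv : Convex ℝ {x : E3 | r ^ 2 ≤ innerSL ℝ p x} :=
      convex_halfSpace_ge (innerSL ℝ p).isLinear _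
    have hpp : innerSL ℝ p p = r ^ 2 := by
      rw [innerSL_apply_apply, real_inner_self_eq_norm_sq, hp]
    have hint : (interior {x : E3 | r ^ 2 ≤ innerSL ℝ p x}).Nonempty := by
      refine ⟨(2 : ℝ) • p, interior_maximal (fun x hx => le_of_lt hx)
        (isOpen_lt continuous_const (innerSL ℝ p).continuous) ?_⟩
      change r ^ 2 < innerSL ℝ p ((2 : ℝ) • p)
      rw [map_smul, hpp, smul_eq_mul]
      nlinarith [pow_pos hr 2]
    have h1 := uniqueDiffWithinAt_convex hconv hint (x := p) (subset_closure hpp.ge)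
    refine ((uniqueDiffWithinAt_inter hV).2 h1).mono fun x hx => ⟨?_, le_of_lt hx.2⟩
    have h2 : r ^ 2 ≤ inner ℝ p x := hx.1
    have h3 := h2.trans (real_inner_le_norm p x)
    rw [hp, sq] at h3
    exact le_of_mul_le_mul_left h3 hr
  · have hV : {x : E3 | r < ‖x‖} ∈ 𝓝 p :=
      (isOpen_lt continuous_const continuous_norm).mem_nhds (by simp [hp, hr1])
    have hint : (interior (Metric.closedBall (0 : E3) 1)).Nonempty := by
      rw [interior_closedBall _ one_ne_zero]
      exact ⟨0, by simp⟩
    have h1 := uniqueDiffWithinAt_convex (convex_closedBall (0 : E3) 1) hint (x := p)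
      (subset_closure (by simp [hp]))
    refine ((uniqueDiffWithinAt_inter hV).2 h1).mono fun x hx => ⟨le_of_lt hx.2, ?_⟩
    simpa using hx.1

end

/-! ### Radial collars -/

theorem hasFDerivAt_normalize {θ : E3} (hθ : ‖θ‖ = 1) :
    ∃ L : E3 →L[ℝ] E3, HasFDerivAt (fun x : E3 => ‖x‖⁻¹ • x) L θ ∧
      ∀ v, inner ℝ θ v = 0 → L v = v := by
  have hθ0 : θ ≠ 0 := by rintro rfl; simp at hθ
  have h1 := hasFDerivAt_comp_log_norm hθ0 (hasDerivAt_exp_neg (Real.log ‖θ‖))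
  have h2 : (fun x : E3 => ‖x‖⁻¹) =ᶠ[𝓝 θ] fun x => Real.exp (-Real.log ‖x‖) := by
    filter_upwards [isOpen_ne.mem_nhds hθ0] with x hx
    rw [Real.exp_neg, Real.exp_log (norm_pos_iff.2 hx)]
  refine ⟨_, (h1.congr_of_eventuallyEq h2).smul (hasFDerivAt_id θ), fun v hv => ?_⟩
  simp [hv, hθ]

theorem contDiffOn_radial {ξ : ℝ → ℝ} {s : Set ℝ} (hξ : ContDiffOn ℝ ∞ ξ s) :
    ContDiffOn ℝ ∞ (fun p : ℝ × E3 => ξ p.1 • (‖p.2‖⁻¹ • p.2)) (s ×ˢ {0}ᶜ) := by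
  have h1 : ContDiffOn ℝ ∞ (fun p : ℝ × E3 => ξ p.1) (s ×ˢ {0}ᶜ) :=
    hξ.comp contDiff_fst.contDiffOn fun p hp => hp.1
  have h2 : ContDiffOn ℝ ∞ (fun p : ℝ × E3 => ‖p.2‖⁻¹) (s ×ˢ {0}ᶜ) := fun p hp =>
    (((contDiffAt_norm ℝ hp.2).comp p contDiffAt_snd).inv
      (norm_ne_zero_iff.2 hp.2)).contDiffWithinAt
  exact h1.smul (h2.smul contDiff_snd.contDiffOn)

section

variable {a δ : ℝ}

/-- The inner Euclidean radius. -/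
noncomputable def innerRadius (a : ℝ) : ℝ := Real.exp (2 * arc a 0)

theorem innerRadius_pos : 0 < innerRadius a := Real.exp_pos _

theorem innerRadius_lt_one (ha : 0 < a) : innerRadius a < 1 := by
  rw [innerRadius, Real.exp_lt_one_iff]
  linarith [arc_zero_neg ha]

theorem interior_shell_eq (ha : 0 < a) :
    interior (shell (innerRadius a)) = adsDomain (a + a ^ 3) := by
  rw [interior_shell innerRadius_pos]
  exact Set.ext fun x => (mem_adsDomain_iff_norm ha).symm

/-- The boundary defining function. -/
noncomputable def bdryFun (a δ : ℝ) (x : E3) : ℝ :=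
  invRadius a (Real.log ‖x‖) * bdrySlope a δ (invRadius a (Real.log ‖x‖))

/-- The compactified metric. -/
noncomputable def compactMetric (a δ : ℝ) : MetricField := fun x =>
  (bdrySlope a δ (invRadius a (Real.log ‖x‖)) / ‖x‖) ^ 2 • (1 : Matrix (Fin 3) (Fin 3) ℝ)

theorem ne_zero_of_mem_shell {r : ℝ} (hr : 0 < r) {x : E3} (hx : x ∈ shell r) : x ≠ 0 := by
  rintro rfl
  have := hx.1
  rw [norm_zero] at this
  exact this.not_gt hr

theorem log_norm_mem_range (ha : 0 < a) {x : E3} (hx : x ∈ shell (innerRadius a)) :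
    Real.log ‖x‖ ∈ range (arc a) := by
  have hn := norm_pos_iff.2 (ne_zero_of_mem_shell innerRadius_pos hx)
  exact mem_range_arc_of_mem_Icc ha
    ⟨(Real.le_log_iff_exp_le hn).2 hx.1, Real.log_nonpos hn.le hx.2⟩

theorem invRadius_nonneg (ha : 0 < a) {x : E3} (hx : x ∈ shell (innerRadius a)) :
    0 ≤ invRadius a (Real.log ‖x‖) := by
  have hn := norm_pos_iff.2 (ne_zero_of_mem_shell innerRadius_pos hx)
  have h1 := (Real.le_log_iff_exp_le hn).2 hx.1
  have h2 := Real.log_nonpos hn.le hx.2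
  obtain ⟨y, hy⟩ := log_norm_mem_range ha hx
  rw [← hy, ← arc_neg_one ha, (strictMono_arc ha).le_iff_le] at h1
  rw [← hy] at h2
  have h3 : y ≤ 1 := by
    rw [← (strictMono_arc ha).le_iff_le, arc_one]; exact h2
  rw [invRadius, ← hy, arcInv_arc ha]
  exact div_nonneg (by nlinarith) ha.le

/-- The collar is radial, `(s, θ) ↦ ξ s • θ`, extended to all nonzero `θ` by normalisation.
Rotational symmetry makes both `g_t` and `h` multiples of `g₀`, so the conditions reduce to the
one-variable facts of `exists_collarRadius`. -/
theorem hasHyperbolicCollar (ha : 0 < a) (h : IsCollarWidth a δ) {ς : ℝ} (hς : ς = 1 ∨ ς = -1) :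
    HasHyperbolicCollar (shell (innerRadius a)) (adsMetric (a + a ^ 3)) (compactMetric a δ)
      (bdryFun a δ) (Metric.sphere 0 (Real.exp (arc a ς))) := by
  obtain ⟨ε, hε, ξ, ξ', C, hξ0, hξ⟩ := exists_collarRadius ha h hς
  have hIco : ∀ s ∈ Ico 0 ε, s ∈ Ioo (-ε) ε := fun s hs => ⟨by linarith [hs.1], hs.2⟩
  have hIoo : ∀ s ∈ Ioo 0 ε, s ∈ Ioo (-ε) ε := fun s hs => ⟨by linarith [hs.1], hs.2⟩
  have h0 : (0 : ℝ) ∈ Ioo (-ε) ε := ⟨by linarith, hε⟩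
  let Φ : ℝ → E3 → E3 := fun s x => ξ s • (‖x‖⁻¹ • x)
  have hΦ : ∀ s, ∀ θ ∈ Metric.sphere (0 : E3) 1, Φ s θ = ξ s • θ := fun s θ hθ => by
    rw [mem_sphere_zero_iff_norm] at hθ
    simp [Φ, hθ]
  have hnorm : ∀ s ∈ Ioo (-ε) ε, ∀ θ ∈ Metric.sphere (0 : E3) 1, ‖Φ s θ‖ = ξ s :=
    fun s hs θ hθ => by
      rw [hΦ s θ hθ, norm_smul, mem_sphere_zero_iff_norm.1 hθ, mul_one,
        Real.norm_of_nonneg (hξ s hs).1.le]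
  have ht : ∀ s ∈ Ioo (-ε) ε, ∀ θ ∈ Metric.sphere (0 : E3) 1, bdryFun a δ (Φ s θ) = s :=
    fun s hs θ hθ => by
      rw [bdryFun, hnorm s hs θ hθ]
      exact (hξ s hs).2.2.2.1
  have hfd : ∀ s, ∀ θ ∈ Metric.sphere (0 : E3) 1, ∀ v, inner ℝ θ v = 0 →
      fderiv ℝ (Φ s) θ v = ξ s • v := fun s θ hθ v hv => by
    obtain ⟨L, hL, hLv⟩ := hasFDerivAt_normalize (mem_sphere_zero_iff_norm.1 hθ)
    have h1 := (hL.const_smul (ξ s)).fderiv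
    change fderiv ℝ (fun x : E3 => ξ s • (‖x‖⁻¹ • x)) θ v = _
    change fderiv ℝ (fun x : E3 => ξ s • (‖x‖⁻¹ • x)) θ = _ at h1
    rw [h1, smul_apply, hLv v hv]
  refine ⟨ε, hε, Φ, contDiffOn_radial fun s hs => (hξ s (hIco s hs)).2.1.contDiffWithinAt, ?_,
    fun s hs => ht s (hIco s hs), ?_, ?_, ?_, fun s θ =>
      (Real.sinh s ^ 2 * areaRadius a (Real.log (ξ s)) ^ 2) • 1, fun θ => (a + a ^ 3) • 1, ?_, ?_,
      ?_, C, ?_⟩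
  · rintro ⟨s, θ⟩ ⟨hs, hθ⟩ ⟨s', θ'⟩ ⟨hs', hθ'⟩ heq
    simp only at hs hθ hs' hθ' heq
    have h1 : s = s' := by
      rw [← ht s (hIco s hs) θ hθ, heq, ht s' (hIco s' hs') θ' hθ']
    subst h1
    rw [hΦ s θ hθ, hΦ s θ' hθ'] at heq
    have := smul_right_injective E3 (hξ s (hIco s hs)).1.ne' heq
    rw [this]
  · ext x
    rw [mem_sphere_zero_iff_norm, ← hξ0]
    constructor
    · rintro ⟨θ, hθ, rfl⟩
      exact hnorm 0 h0 θ hθ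
    · intro hx
      have h1 := (hξ 0 h0).1
      have hmem : (ξ 0)⁻¹ • x ∈ Metric.sphere (0 : E3) 1 := by
        rw [mem_sphere_zero_iff_norm, norm_smul, hx, norm_inv, Real.norm_of_nonneg h1.le,
          inv_mul_cancel₀ h1.ne']
      exact ⟨_, hmem, by rw [hΦ 0 _ hmem, smul_inv_smul₀ h1.ne']⟩
  -- As `ξ'` does not vanish, the image of the two-sided interval is open; intersecting with the
  -- shell removes exactly the negative parameters.
  · have hopen : IsOpen (ξ '' Ioo (-ε) ε) := by
      rw [isOpen_iff_mem_nhds]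
      rintro _ ⟨s, hs, rfl⟩
      have h1 := (hξ s hs).2.1.hasStrictDerivAt' (hξ s hs).2.2.2.2.1 (by simp)
      rw [← h1.map_nhds_eq (hξ s hs).2.2.2.2.2.1]
      exact image_mem_map (isOpen_Ioo.mem_nhds hs)
    refine ⟨{x : E3 | ‖x‖ ∈ ξ '' Ioo (-ε) ε}, hopen.preimage continuous_norm, fun x hx => ?_, ?_⟩
    · rw [mem_sphere_zero_iff_norm] at hx
      exact ⟨0, h0, by simp only [hξ0, hx]⟩
    · ext x
      constructor
      · rintro ⟨⟨s, θ⟩, ⟨hs, hθ⟩, rfl⟩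
        have hn := hnorm s (hIco s hs) θ hθ
        refine ⟨⟨s, hIco s hs, hn.symm⟩, ?_⟩
        change ‖Φ s θ‖ ∈ Icc (innerRadius a) 1
        rw [hn]
        exact (hξ s (hIco s hs)).2.2.1.2 hs.1
      · rintro ⟨⟨s, hs, hsx⟩, hK⟩
        have hK' : ‖x‖ ∈ Icc (innerRadius a) 1 := hK
        rw [← hsx] at hK'
        have hs0 := (hξ s hs).2.2.1.1 hK'
        have h1 := (hξ s hs).1
        have hmem : (ξ s)⁻¹ • x ∈ Metric.sphere (0 : E3) 1 := by
          rw [mem_sphere_zero_iff_norm, norm_smul, ← hsx, norm_inv, Real.norm_of_nonneg h1.le,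
            inv_mul_cancel₀ h1.ne']
        exact ⟨(s, (ξ s)⁻¹ • x), ⟨⟨hs0, hs.2⟩, hmem⟩, by
          change Φ s ((ξ s)⁻¹ • x) = x
          rw [hΦ s _ hmem, smul_inv_smul₀ h1.ne']⟩
  · intro θ hθ v w hv hw
    have h1 := (hξ 0 h0).1
    have hu : invRadius a (Real.log (ξ 0)) = 0 := by
      rw [hξ0, Real.log_exp, invRadius, arcInv_arc ha]
      rcases hς with rfl | rfl <;> norm_num
    rw [hfd 0 θ hθ v hv, hfd 0 θ hθ w hw, compactMetric, form_smul_one, hnorm 0 h0 θ hθ, hu,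
      bdrySlope_of_le h.pos h.pos.le, defSlope_zero, real_inner_smul_left, real_inner_smul_right]
    field_simp
  · intro s hs θ hθ
    have hs' := hIoo s hs
    obtain ⟨h1, -, -, -, hd, -, h2⟩ := hξ s hs'
    obtain ⟨h3, h4, -⟩ := h2 hs.1
    refine ⟨Matrix.isSymm_one.smul _, fun p q v w hv hw => ?_⟩
    have hderiv : deriv (fun σ => Φ σ θ) s = ξ' s • θ := by
      have h5 : (fun σ => Φ σ θ) = fun σ => ξ σ • θ := funext fun σ => hΦ σ θ hθ
      rw [h5]
      exact (hd.smul_const θ).deriv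
    have hdom : Φ s θ ∈ adsDomain (a + a ^ 3) := by
      rw [mem_adsDomain_iff ha, hnorm s hs' θ hθ]; exact h3
    have hsinh := Real.sinh_pos_iff.2 hs.1
    have hθθ : inner ℝ θ θ = (1 : ℝ) := by
      rw [real_inner_self_eq_norm_sq, mem_sphere_zero_iff_norm.1 hθ, one_pow]
    have hvθ : inner ℝ v θ = (0 : ℝ) := by rw [real_inner_comm]; exact hv
    rw [hderiv, hfd s θ hθ v hv, hfd s θ hθ w hw, adsMetric_eq ha hdom, form_smul_one,
      form_smul_one, hnorm s hs' θ hθ]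
    simp only [inner_add_left, inner_add_right, real_inner_smul_left, real_inner_smul_right, hθθ,
      hw, hvθ, mul_zero, add_zero, zero_add, mul_one]
    have h6 : (areaRadius a (Real.log (ξ s)) / ξ s) ^ 2 * ξ' s ^ 2 = (Real.sinh s ^ 2)⁻¹ := by
      rw [← h4]; ring
    have h7 : (areaRadius a (Real.log (ξ s)) / ξ s) ^ 2 * ξ s ^ 2 =
        areaRadius a (Real.log (ξ s)) ^ 2 := by field_simp
    have h8 : (Real.sinh s ^ 2)⁻¹ * Real.sinh s ^ 2 = 1 := inv_mul_cancel₀ (by positivity)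
    linear_combination p * q * h6 + inner ℝ v w * h7 -
      areaRadius a (Real.log (ξ s)) ^ 2 * inner ℝ v w * h8
  · exact fun i j => contDiffOn_const
  · exact fun θ _ => Matrix.isSymm_one.smul _
  · intro s hs θ hθ v w hv hw
    have h1 := ((hξ s (hIoo s hs)).2.2.2.2.2.2 hs.1).2.2
    rw [form_smul_one, form_smul_one]
    have h2 : Real.sinh s ^ 2 * areaRadius a (Real.log (ξ s)) ^ 2 * inner ℝ v w - inner ℝ v w -
        s ^ 3 / 3 * ((a + a ^ 3) * inner ℝ v w) =
        (Real.sinh s ^ 2 * areaRadius a (Real.log (ξ s)) ^ 2 - 1 - (a + a ^ 3) / 3 * s ^ 3) *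
          inner ℝ v w := by ring
    rw [h2, abs_mul, mul_assoc (C * s ^ 4)]
    exact mul_le_mul h1 (abs_real_inner_le_norm v w) (abs_nonneg _) ((abs_nonneg _).trans h1)

theorem isConformallyCompactified (ha : 0 < a) (h : IsCollarWidth a δ) :
    IsConformallyCompactified (shell (innerRadius a)) (adsMetric (a + a ^ 3)) := by
  have hr := innerRadius_pos (a := a)
  have hr1 := innerRadius_lt_one ha
  have hδ := h.pos
  have hlog : ∀ x ∈ shell (innerRadius a),
      ContDiffAt ℝ ∞ (fun x : E3 => invRadius a (Real.log ‖x‖)) x :=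
    fun x hx => (contDiffAt_invRadius ha (log_norm_mem_range ha hx)).comp x
      (contDiffAt_log_norm (ne_zero_of_mem_shell hr hx))
  have hslope : ∀ x ∈ shell (innerRadius a),
      ContDiffAt ℝ ∞ (fun x : E3 => bdrySlope a δ (invRadius a (Real.log ‖x‖))) x := fun x hx =>
    (contDiffAt_bdrySlope ha h (by linarith [invRadius_nonneg ha hx])).comp x (hlog x hx)
  have ht : ∀ x ∈ shell (innerRadius a), ContDiffAt ℝ ∞ (bdryFun a δ) x := fun x hx =>
    (hlog x hx).mul (hslope x hx)
  have hpos : ∀ x ∈ shell (innerRadius a),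
      0 < bdrySlope a δ (invRadius a (Real.log ‖x‖)) := fun x hx =>
    bdrySlope_pos h (invRadius_nonneg ha hx)
  have hfr : ∀ x ∈ frontier (shell (innerRadius a)), ∃ ς : ℝ, (ς = 1 ∨ ς = -1) ∧
      ‖x‖ = Real.exp (arc a ς) := fun x hx => by
    rw [frontier_shell hr hr1] at hx
    rcases hx with hx | hx <;> rw [mem_sphere_zero_iff_norm] at hx
    · exact ⟨-1, .inr rfl, by rw [hx, arc_neg_one ha, innerRadius]⟩
    · exact ⟨1, .inl rfl, by rw [hx, arc_one, Real.exp_zero]⟩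
  have hfrK : frontier (shell (innerRadius a)) ⊆ shell (innerRadius a) :=
    isCompact_shell.isClosed.frontier_subset
  have hinv0 : ∀ x ∈ frontier (shell (innerRadius a)), invRadius a (Real.log ‖x‖) = 0 :=
    fun x hx => by
      obtain ⟨ς, hς, hx⟩ := hfr x hx
      rw [hx, Real.log_exp, invRadius, arcInv_arc ha]
      rcases hς with rfl | rfl <;> norm_num
  have hinvpos : ∀ x ∈ adsDomain (a + a ^ 3), 0 < invRadius a (Real.log ‖x‖) := fun x hx =>
    div_pos (one_sub_arcInv_sq_pos ha ((mem_adsDomain_iff ha).1 hx)) ha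
  refine ⟨isCompactSmoothRegion_shell hr hr1, by
    rw [interior_shell_eq ha]; exact isRiemannianMetric_adsMetric ha, bdryFun a δ,
    compactMetric a δ, fun x hx => (ht x hx).contDiffWithinAt, fun x hx => ?_, fun x hx => ?_, ?_,
    fun x hx => ?_, fun x hx => ?_, fun p hp => ?_⟩
  · rw [bdryFun, hinv0 x hx, zero_mul]
  · have hx' := hx
    rw [interior_shell_eq ha] at hx'
    exact mul_pos (hinvpos x hx') (hpos x (interior_subset hx))
  · refine isRiemannianMetric_smul_one (c := fun x =>
      (bdrySlope a δ (invRadius a (Real.log ‖x‖)) / ‖x‖) ^ 2) (fun x hx => ?_) (fun x hx => ?_)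
      fun x hx => rfl
    · have hx0 := ne_zero_of_mem_shell hr hx
      exact ((((hslope x hx).of_le (WithTop.coe_le_coe.2 (le_top : (3 : ℕ∞) ≤ ⊤))).div
        (contDiffAt_norm ℝ hx0)
        (norm_ne_zero_iff.2 hx0)).pow 2).contDiffWithinAt
    · have := norm_pos_iff.2 (ne_zero_of_mem_shell hr hx)
      have := hpos x hx
      positivity
  · rw [interior_shell_eq ha] at hx
    have := hinvpos x hx
    rw [adsMetric_eq ha hx, smul_smul, compactMetric, areaRadius_eq_inv, bdryFun]
    congr 1
    field_simp
  · obtain ⟨ς, hς, hxς⟩ := hfr x hx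
    have hxK := hfrK hx
    have hx0 := ne_zero_of_mem_shell hr hxK
    have hn := norm_pos_iff.2 hx0
    have hς2 : ς ^ 2 = 1 := by rcases hς with rfl | rfl <;> norm_num
    -- At the boundary `u = 0`, the slope factor is `1` and `√(quartic a (±1)) = a`, so `dt / d(log
    -- ‖x‖) = -ς`. The compactified metric is `|dx| ^ 2 / ‖x‖ ^ 2` there, whence the unit length of
    -- `dt`.
    have hd : HasFDerivAt (bdryFun a δ) ((-ς / ‖x‖ ^ 2) • innerSL ℝ x) x := by
      have h1 := hasFDerivAt_comp_log_norm hx0 (hasDerivAt_invRadius ha (log_norm_mem_range ha hxK))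
      have h2 := h1.mul ((hslope x hxK).differentiableAt (by simp)).hasFDerivAt
      refine h2.congr_fderiv ?_
      have hY : arcInv a (Real.log ‖x‖) = ς := by rw [hxς, Real.log_exp, arcInv_arc ha]
      have hq : √(quartic a ς) = a := by
        rw [quartic, hς2]; norm_num; exact Real.sqrt_sq ha.le
      rw [hinv0 x hx, bdrySlope_of_le hδ hδ.le, defSlope_zero, hY, hq, zero_smul, zero_add,
        one_smul, mul_div_cancel_right₀ _ ha.ne']
    have hfw : ∀ i, fderivWithin ℝ (bdryFun a δ) (shell (innerRadius a)) x
        (EuclideanSpace.single i 1) = -ς / ‖x‖ ^ 2 * x i := fun i => by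
      rw [fderivWithin_eq_fderiv (uniqueDiffWithinAt_shell hr hr1 hx) hd.differentiableAt]
      exact pd_eq_of_hasFDerivAt hd i
    have hnsq := norm_sq_eq_sum x
    rw [compactMetric, hinv0 x hx, bdrySlope_of_le hδ hδ.le, defSlope_zero,
      inv_smul_one (by positivity)]
    simp only [hfw]
    simp [Fin.sum_univ_three, Matrix.one_apply]
    field_simp
    rw [hς2]
    linear_combination -hnsq
  · obtain ⟨ς, hς, hxς⟩ := hfr p hp
    have h1 : Real.exp (arc a ς) = innerRadius a ∨ Real.exp (arc a ς) = 1 := by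
      rcases hς with rfl | rfl
      · right; rw [arc_one, Real.exp_zero]
      · left; rw [arc_neg_one ha, innerRadius]
    rw [connectedComponentIn_shell hr hr1 h1 (mem_sphere_zero_iff_norm.2 hxς)]
    exact hasHyperbolicCollar ha h hς

theorem isAsymptoticallyHyperbolic_adsMetric (ha : 0 < a) :
    IsAsymptoticallyHyperbolic (adsDomain (a + a ^ 3)) (adsMetric (a + a ^ 3)) := by
  obtain ⟨δ, h⟩ := exists_isCollarWidth ha
  refine ⟨isOpen_adsDomain ha, fun hc => ?_, isRiemannianMetric_adsMetric ha,
    isCompleteMetric_adsMetric ha, shell (innerRadius a), adsMetric (a + a ^ 3), id,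
    contDiffOn_id, ?_, fun x _ v w => by simp, isConformallyCompactified ha h⟩
  -- A compact open subset of the connected space `E3` would be empty or everything; the horizon
  -- sphere and the origin rule these out.
  · have hclopen : IsClopen (adsDomain (a + a ^ 3)) := ⟨hc.isClosed, isOpen_adsDomain ha⟩
    rcases isClopen_iff.1 hclopen with h1 | h1
    · have hm : (EuclideanSpace.single 0 (Real.exp (arc a 0)) : E3) ∈ adsDomain (a + a ^ 3) := by
        rw [mem_adsDomain_iff ha]
        have h2 := arc_zero_neg ha
        have h3 : ‖(EuclideanSpace.single 0 (Real.exp (arc a 0)) : E3)‖ = Real.exp (arc a 0) := by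
          simp
        rw [h3, Real.log_exp]
        exact ⟨by linarith, h2⟩
      rw [h1] at hm
      exact hm
    · have hm : (0 : E3) ∈ adsDomain (a + a ^ 3) := by rw [h1]; trivial
      exact ne_zero_of_mem_adsDomain ha hm rfl
  · rw [interior_shell_eq ha]
    exact bijOn_id _

end

end AdSSch

theorem mainTheorem3 (M : ℝ) (hM : 0 < M) :
    -- the metric is defined, smooth and complete on the complement of a ball
    0 < AdSSch.rho0 M ∧
    ContDiffOn ℝ ∞ (AdSSch.phi M) (Ioi (AdSSch.rho0 M)) ∧
    AdSSch.IsRiemannianMetric ∞ (AdSSch.adsDomain M) (AdSSch.adsMetric M) ∧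
    AdSSch.IsCompleteMetric (AdSSch.adsDomain M) (AdSSch.adsMetric M) ∧
    -- (i)
    (∀ ρ, AdSSch.rho0 M < ρ → 1 < AdSSch.phi M ρ) ∧
    Tendsto (AdSSch.phi M) atTop (𝓝 1) ∧
    Tendsto (AdSSch.phi M) (𝓝[>] (AdSSch.rho0 M)) atTop ∧
    -- (ii)
    AdSSch.IsAsymptoticallyHyperbolic (AdSSch.adsDomain M) (AdSSch.adsMetric M) ∧
    (∀ x ∈ AdSSch.adsDomain M, AdSSch.scalarCurvature (AdSSch.adsMetric M) x = -6) ∧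
    -- (iii)
    (∀ ρ, AdSSch.rho0 M < ρ → deriv (AdSSch.phi M) ρ < 0 ∧
      HasDerivAt (fun σ => Real.sinh σ ^ 2 * deriv (AdSSch.phi M) σ)
        (3 / 4 * Real.sinh ρ ^ 2 * (AdSSch.phi M ρ * (AdSSch.phi M ρ ^ 4 - 1))) ρ) ∧
    -- (iv)
    (∃ ρ₂ ρ₁ ρ₂' : ℝ, ρ₁ < ρ₂ ∧ ρ₂' < ρ₁ ∧ AdSSch.rho0 M < ρ₂' ∧
      ∀ c, AdSSch.rho0 M < c →
        (AdSSch.LevelHasMeanCurvature M c 2 ↔ c = ρ₂) ∧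
        (AdSSch.LevelHasMeanCurvature M c 0 ↔ c = ρ₁) ∧
        (AdSSch.LevelHasMeanCurvature M c (-2) ↔ c = ρ₂')) := by
  obtain ⟨a, ha, rfl⟩ := AdSSch.exists_horizon hM
  exact ⟨AdSSch.rho0_pos ha, AdSSch.contDiffOn_phi ha, AdSSch.isRiemannianMetric_adsMetric ha,
    AdSSch.isCompleteMetric_adsMetric ha, fun ρ hρ => AdSSch.one_lt_phi ha hρ,
    AdSSch.tendsto_phi_atTop ha, AdSSch.tendsto_phi_rho0 ha,
    AdSSch.isAsymptoticallyHyperbolic_adsMetric ha,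
    fun x hx => AdSSch.scalarCurvature_adsMetric ha hx,
    fun ρ hρ => ⟨AdSSch.deriv_phi_neg ha hρ, AdSSch.hasDerivAt_sinh_sq_mul_deriv_phi ha hρ⟩,
    AdSSch.exists_levels ha⟩
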